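/- **Theorem.** An instance of *factorized binary polynomial optimization* is given by positive integers $s$ and $n_1,\dots,n_s$, a nonempty finite family $\mathcal I$ of subsets of $[s]=\{1,\dots,s\}$ (the same subset may occur several times in the family), and vectors $c^{I,j}\in\mathbb Q^{n_j}$ for $I\in\mathcal I$, $j\in I$; the problem is to find an optimal solution of $$\text{(F)}\qquad \max\ \sum_{I\in\mathcal I}\ \prod_{j\in I}\langle c^{I,j},x^j\rangle\qquad\text{s.t. } x^j\in\{0,1\}^{n_j}\quad\forall j\in[s].$$ For $j\in[s]$ let $m_j$ be the number of members $I\in\mathcal I$ that contain $j$ and at least one index strictly smaller than $j$. There is an algorithm (one program for a random access machine that performs additions, subtractions, multiplications, divisions and comparisons of numbers at unit cost, where natural numbers serve for indices and counters and rational numbers for the data) that solves every instance of (F) and has the following properties. 1. There are a constant $\theta$ and a polynomial $f$, both independent of the instance, such that the number of elementary operations (arithmetic operations, comparisons, reads, writes and branchings) is at most $$s\,\theta^{s-1}\,n_2^{m_2}n_3^{m_3}\cdots n_s^{m_s}\,f(n_1+n_2+\dots+n_s+|\mathcal I|),$$ and the size (number of bits) of every number produced in the course of the execution is at most a fixed polynomial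 in the size of the input. 2. In particular, the algorithm runs in strongly polynomial time on the instances in which $s$ and $m_2,\dots,m_s$ are bounded by constants: the number of elementary operations is bounded by a polynomial in the number of numbers in the input, and the size of the numbers produced is bounded by a polynomial in the size of the input. 3. Likewise, the algorithm runs in strongly polynomial time on the instances in which $s$ and $|\mathcal I|$ are bounded by constants. -/

import Mathlib

/-!
A model of computation with unit-cost arithmetic (a random access machine with rational registers,
programmed in a structured language), factorized binary polynomial optimization, and what it means
to solve it.
-/

namespace FBPO

/-! ### The machine -/

/-- The memory: arrays of natural numbers (used for dimensions, indices and counters) and arrays of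
rational numbers. `σ.nat a i` and `σ.rat a i` are the cells number `i` of the arrays number `a`. -/
structure Mem where
  nat : ℕ → ℕ → ℕ
  rat : ℕ → ℕ → ℚ

/-- The number of bits of a rational number in lowest terms, with one bit for the sign. -/
def ratSize (q : ℚ) : ℕ := 1 + Nat.size q.num.natAbs + Nat.size q.den

/-- Expressions with natural values. Array names are fixed in the program, cells are computed. -/
inductive NExpr where
  | lit (k : ℕ)
  | get (a : ℕ) (i : NExpr)
  | add (e f : NExpr)
  | sub (e f : NExpr)
  | mul (e f : NExpr)

namespace NExpr

def eval (σ : Mem) : NExpr → ℕ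
  | lit k => k
  | get a i => σ.nat a (i.eval σ)
  | add e f => e.eval σ + f.eval σ
  | sub e f => e.eval σ - f.eval σ
  | mul e f => e.eval σ * f.eval σ

/-- The number of elementary operations of an evaluation. -/
def cost : NExpr → ℕ
  | lit _ => 1
  | get _ i => i.cost + 1
  | add e f => e.cost + f.cost + 1
  | sub e f => e.cost + f.cost + 1
  | mul e f => e.cost + f.cost + 1

/-- Every number that is produced by the evaluation has at most `B` bits. -/
def Ok (B : ℕ) (σ : Mem) : NExpr → Prop
  | lit k => Nat.size k ≤ B
  | get a i => i.Ok B σ ∧ Nat.size (σ.nat a (i.eval σ)) ≤ B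
  | add e f => e.Ok B σ ∧ f.Ok B σ ∧ Nat.size (e.eval σ + f.eval σ) ≤ B
  | sub e f => e.Ok B σ ∧ f.Ok B σ ∧ Nat.size (e.eval σ - f.eval σ) ≤ B
  | mul e f => e.Ok B σ ∧ f.Ok B σ ∧ Nat.size (e.eval σ * f.eval σ) ≤ B

end NExpr

/-- Expressions with rational values. -/
inductive RExpr where
  | lit (q : ℚ)
  | get (a : ℕ) (i : NExpr)
  | add (e f : RExpr)
  | sub (e f : RExpr)
  | mul (e f : RExpr)
  | div (e f : RExpr)

namespace RExpr

def eval (σ : Mem) : RExpr → ℚ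
  | lit q => q
  | get a i => σ.rat a (i.eval σ)
  | add e f => e.eval σ + f.eval σ
  | sub e f => e.eval σ - f.eval σ
  | mul e f => e.eval σ * f.eval σ
  | div e f => e.eval σ / f.eval σ

/-- The number of elementary operations of an evaluation. -/
def cost : RExpr → ℕ
  | lit _ => 1
  | get _ i => i.cost + 1
  | add e f => e.cost + f.cost + 1
  | sub e f => e.cost + f.cost + 1
  | mul e f => e.cost + f.cost + 1
  | div e f => e.cost + f.cost + 1

/-- No division by zero takes place, and every number that is produced by the evaluation has at
most `B` bits. -/
def Ok (B : ℕ) (σ : Mem) : RExpr → Prop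
  | lit q => ratSize q ≤ B
  | get a i => i.Ok B σ ∧ ratSize (σ.rat a (i.eval σ)) ≤ B
  | add e f => e.Ok B σ ∧ f.Ok B σ ∧ ratSize (e.eval σ + f.eval σ) ≤ B
  | sub e f => e.Ok B σ ∧ f.Ok B σ ∧ ratSize (e.eval σ - f.eval σ) ≤ B
  | mul e f => e.Ok B σ ∧ f.Ok B σ ∧ ratSize (e.eval σ * f.eval σ) ≤ B
  | div e f => e.Ok B σ ∧ f.Ok B σ ∧ f.eval σ ≠ 0 ∧ ratSize (e.eval σ / f.eval σ) ≤ B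

end RExpr

/-- Comparisons and their Boolean combinations. -/
inductive Test where
  | natLt (e f : NExpr)
  | natEq (e f : NExpr)
  | ratLt (e f : RExpr)
  | ratEq (e f : RExpr)
  | not (b : Test)
  | and (b c : Test)

namespace Test

def Holds (σ : Mem) : Test → Prop
  | natLt e f => e.eval σ < f.eval σ
  | natEq e f => e.eval σ = f.eval σ
  | ratLt e f => e.eval σ < f.eval σ
  | ratEq e f => e.eval σ = f.eval σ
  | not b => ¬ b.Holds σ
  | and b c => b.Holds σ ∧ c.Holds σ

/-- The number of elementary operations of a test. -/
def cost : Test → ℕ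
  | natLt e f => e.cost + f.cost + 1
  | natEq e f => e.cost + f.cost + 1
  | ratLt e f => e.cost + f.cost + 1
  | ratEq e f => e.cost + f.cost + 1
  | not b => b.cost + 1
  | and b c => b.cost + c.cost + 1

/-- The expressions in the test are evaluated without division by zero, and every number that is
produced has at most `B` bits. -/
def Ok (B : ℕ) (σ : Mem) : Test → Prop
  | natLt e f => e.Ok B σ ∧ f.Ok B σ
  | natEq e f => e.Ok B σ ∧ f.Ok B σ
  | ratLt e f => e.Ok B σ ∧ f.Ok B σ
  | ratEq e f => e.Ok B σ ∧ f.Ok B σ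
  | not b => b.Ok B σ
  | and b c => b.Ok B σ ∧ c.Ok B σ

end Test

/-- Programs. `setNat a i e` and `setRat a i e` write the value of `e` into the cell whose number is
the value of `i`, of the array number `a`; `loop b p` repeats `p` as long as `b` holds. -/
inductive Prog where
  | skip
  | setNat (a : ℕ) (i e : NExpr)
  | setRat (a : ℕ) (i : NExpr) (e : RExpr)
  | seq (p q : Prog)
  | ite (b : Test) (p q : Prog)
  | loop (b : Test) (p : Prog)

/-- The memory after writing `v` into cell `i` of the array `a` of natural numbers. -/
def Mem.writeNat (σ : Mem) (a i v : ℕ) : Mem :=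
  { σ with nat := Function.update σ.nat a (Function.update (σ.nat a) i v) }

/-- The memory after writing `v` into cell `i` of the array `a` of rational numbers. -/
def Mem.writeRat (σ : Mem) (a i : ℕ) (v : ℚ) : Mem :=
  { σ with rat := Function.update σ.rat a (Function.update (σ.rat a) i v) }

/-- `Runs B p σ t τ`: the program `p`, started with memory `σ`, halts with memory `τ` after exactly
`t` elementary operations (arithmetic operations, comparisons, reads, writes and branchings, on
natural and on rational numbers alike); it never divides by zero, and every number produced in the
course of the execution, addresses included, has at most `B` bits. -/
inductive Runs (B : ℕ) : Prog → Mem → ℕ → Mem → Prop where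
  | skip (σ : Mem) : Runs B Prog.skip σ 1 σ
  | setNat {a : ℕ} {i e : NExpr} {σ : Mem} (hi : i.Ok B σ) (he : e.Ok B σ) :
      Runs B (Prog.setNat a i e) σ (i.cost + e.cost + 1) (σ.writeNat a (i.eval σ) (e.eval σ))
  | setRat {a : ℕ} {i : NExpr} {e : RExpr} {σ : Mem} (hi : i.Ok B σ) (he : e.Ok B σ) :
      Runs B (Prog.setRat a i e) σ (i.cost + e.cost + 1) (σ.writeRat a (i.eval σ) (e.eval σ))
  | seq {p q : Prog} {σ τ υ : Mem} {t u : ℕ} (hp : Runs B p σ t τ) (hq : Runs B q τ u υ) :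
      Runs B (Prog.seq p q) σ (t + u) υ
  | iteTrue {b : Test} {p q : Prog} {σ τ : Mem} {t : ℕ} (hb : b.Ok B σ) (h : b.Holds σ)
      (hp : Runs B p σ t τ) : Runs B (Prog.ite b p q) σ (b.cost + 1 + t) τ
  | iteFalse {b : Test} {p q : Prog} {σ τ : Mem} {t : ℕ} (hb : b.Ok B σ) (h : ¬ b.Holds σ)
      (hq : Runs B q σ t τ) : Runs B (Prog.ite b p q) σ (b.cost + 1 + t) τ
  | loopDone {b : Test} {p : Prog} {σ : Mem} (hb : b.Ok B σ) (h : ¬ b.Holds σ) :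
      Runs B (Prog.loop b p) σ (b.cost + 1) σ
  | loopStep {b : Test} {p : Prog} {σ τ υ : Mem} {t u : ℕ} (hb : b.Ok B σ) (h : b.Holds σ)
      (hp : Runs B p σ t τ) (hl : Runs B (Prog.loop b p) τ u υ) :
      Runs B (Prog.loop b p) σ (b.cost + 1 + t + u) υ

/-! ### Factorized binary polynomial optimization -/

/-- The data of a problem: `s` groups of `n j` variables, and a nonempty family of subsets of the
set of groups, given as `I 0, …, I (r - 1)` (the same subset may occur several times), with a vector
`c i j` for every `j ∈ I i`. The vectors `c i j` with `j ∉ I i` are not part of the problem: no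
definition below depends on them. -/
structure Data where
  s : ℕ
  s_pos : 0 < s
  n : Fin s → ℕ
  n_pos : ∀ j, 0 < n j
  r : ℕ
  r_pos : 0 < r
  I : Fin r → Finset (Fin s)
  c : Fin r → (j : Fin s) → Fin (n j) → ℚ

namespace Data

variable (P : Data)

/-- The objective function. -/
def objective (x : (j : Fin P.s) → Fin (P.n j) → ℚ) : ℚ :=
  ∑ i, ∏ j ∈ P.I i, (P.c i j) ⬝ᵥ (x j)

/-- All the entries of the vectors `x j` are `0` or `1`. -/
def IsBinary (x : (j : Fin P.s) → Fin (P.n j) → ℚ) : Prop :=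
  ∀ j k, x j k = 0 ∨ x j k = 1

/-- `x` is an optimal solution. -/
def IsOptimal (x : (j : Fin P.s) → Fin (P.n j) → ℚ) : Prop :=
  P.IsBinary x ∧ ∀ y, P.IsBinary y → P.objective y ≤ P.objective x

/-- The number of members of the family that contain `j` and at least one strictly smaller
element. -/
def m (j : Fin P.s) : ℕ :=
  (Finset.univ.filter fun i : Fin P.r => j ∈ P.I i ∧ ∃ l ∈ P.I i, l < j).card

/-- The total number of variables. -/
def numVars : ℕ := ∑ j, P.n j

/-- The vectors `c i j`, with zeros in the place of those that are not part of the problem. -/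
def entry (i : Fin P.r) (j : Fin P.s) (k : Fin (P.n j)) : ℚ :=
  if j ∈ P.I i then P.c i j k else 0

/-- The position of the variable `x j k` in the concatenation of the vectors `x j`. -/
def pos (j : Fin P.s) (k : Fin (P.n j)) : ℕ :=
  (finSigmaFinEquiv (⟨j, k⟩ : (j : Fin P.s) × Fin (P.n j)) : ℕ)

/-- The memory that holds the input and is zero elsewhere. The arrays of natural numbers are
array `0` with `s, r`, array `1` with the `n j`, and array `2` with the incidence matrix of the
family, row by row. Array `0` of rational numbers holds, row by row, the matrix whose row `i` is
the concatenation of the vectors `c i j`. -/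
def input : Mem where
  nat a k :=
    if a = 0 then (if k = 0 then P.s else if k = 1 then P.r else 0)
    else if a = 1 then (if h : k < P.s then P.n ⟨k, h⟩ else 0)
    else if a = 2 then
      (if h : k < P.r * P.s then
        (if (finProdFinEquiv.symm ⟨k, h⟩).2 ∈ P.I (finProdFinEquiv.symm ⟨k, h⟩).1 then 1 else 0)
      else 0)
    else 0
  rat a k :=
    if a = 0 then
      (if h : k < P.r * ∑ j, P.n j then
        let u := finProdFinEquiv.symm ⟨k, h⟩
        let v := finSigmaFinEquiv.symm u.2
        P.entry u.1 v.1 v.2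
      else 0)
    else 0

/-- The vectors that a program returns: their concatenation is in array `1` of rational numbers. -/
def output (σ : Mem) (j : Fin P.s) (k : Fin (P.n j)) : ℚ := σ.rat 1 (P.pos j k)

/-- The number of numbers in the input. -/
def dim : ℕ := 2 + P.s + P.r * P.s + P.r * P.numVars

/-- The number of bits of the input. -/
def size : ℕ :=
  Nat.size P.s + Nat.size P.r + ∑ j, Nat.size (P.n j) + P.r * P.s +
    ∑ i, ∑ j, ∑ k, ratSize (P.entry i j k)

end Data

/-- The program `p` solves the problem `P` with at most `T` elementary operations, and every number
produced in the course of the execution has at most `B` bits. -/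
def Solves (p : Prog) (P : Data) (T B : ℕ) : Prop :=
  ∃ t σ, Runs B p P.input t σ ∧ t ≤ T ∧ P.IsOptimal (P.output σ)

/-- The program `p` solves the problems of the class `K` in strongly polynomial time: the number of
operations is polynomial in the number of numbers in the input, and the size of the numbers
produced is polynomial in the size of the input. -/
def StronglyPolynomialOn (p : Prog) (K : Set Data) : Prop :=
  ∃ f g : Polynomial ℕ, ∀ P ∈ K, Solves p P (f.eval P.dim) (g.eval P.size)

end FBPO

/-!
An optimal solution is found by rounding one group of variables after the other, from the last
group to the first.

If all groups except the group `j` are fixed, the objective is an affine function of `x j`. The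
products that involve `j` but no earlier group contribute coefficients `d` that depend on the
later groups only (`Inst.constPart`), and the other products that involve `j`, of which there are
`m j`, contribute a linear function of `m j` unknown values `μ`, the products of the factors that
belong to the other groups (`Inst.linPart`). So `x j k = 1` if `a k * μ + d k > 0` and `x j k = 0`
if it is negative. The vector `μ` is not known, but only the signs of the functions
`a k * μ + d k` matter. Moving `μ` within its cell of the arrangement of their zero sets leads to a vertex, at
which no function has changed its sign except to zero, and which is determined by a basis of the
rows `a k`, at most `m j` of them, whose functions vanish there (`exists_vertex_basis`). To have
definite signs off the basis, the constants `d` are perturbed by infinitesimals of different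
orders, one for each row: they become vectors, with the unit vectors appended and compared
lexicographically (`tableau`, `LexPos`). On the rows of the basis the values of `x j` are part of
the choice. Hence the choice for the group `j` is a ternary vector with at most `m j` nonzero
digits (not in the basis; in the basis with value `0`; in the basis with value `1`), and one of
the at most `8 * n j ^ m j` choices (`card_ternary_le`) is right for an optimal solution
(`exists_rounds`, `Inst.exists_admissible`).

The program `solve` runs through the ternary vectors for all groups at once, ordered as numbers in
ternary notation (`advance`), computes for each of them the rounded solution (`tryChoice`), and
keeps the best. The signs are found by Gaussian elimination with the rows of the basis, whose
entries are quotients of determinants of the original matrix and therefore of polynomial size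
(`Elim.ratSize_le`).

For the analysis of the program, `wp b K p σ Q` says that `p` halts, that all cells have at most
`b` bits afterwards and satisfy `Q`, and that the number of operations is at most the value at `K`
of a polynomial `p.time` that is read off the syntax of `p`, provided that no loop in it is
repeated more than `K` times. A bound for the numbers that occur inside expressions follows in the
same way from the bound for the cells (`Prog.wt`). Only the main loop, which is repeated once for
each choice, is treated separately (`runs_loop`).
-/


namespace FBPO

/-! ### Sizes of numbers -/

theorem size_mul_le (x y : ℕ) : Nat.size (x * y) ≤ Nat.size x + Nat.size y := by
  rw [Nat.size_le, pow_add]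
  exact Nat.mul_lt_mul'' (Nat.lt_size_self x) (Nat.lt_size_self y)

theorem size_add_le (x y : ℕ) : Nat.size (x + y) ≤ Nat.size x + Nat.size y + 1 := by
  rw [Nat.size_le]
  have h1 := Nat.lt_size_self x
  have h2 := Nat.lt_size_self y
  have h3 : 2 ^ Nat.size x ≤ 2 ^ (Nat.size x + Nat.size y) :=
    Nat.pow_le_pow_right (by decide) (by omega)
  have h4 : 2 ^ Nat.size y ≤ 2 ^ (Nat.size x + Nat.size y) :=
    Nat.pow_le_pow_right (by decide) (by omega)
  rw [pow_succ]
  omega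

theorem size_le_self (x : ℕ) : Nat.size x ≤ x := by
  rw [Nat.size_le]
  exact Nat.lt_two_pow_self

/-- The size of a fraction is controlled by any of its representations, in lowest terms or not. -/
theorem ratSize_div_le (a b : ℤ) (hb : b ≠ 0) :
    ratSize ((a : ℚ) / b) ≤ 1 + Nat.size a.natAbs + Nat.size b.natAbs := by
  unfold ratSize
  have h1 : ((a : ℚ) / b).num.natAbs ≤ a.natAbs := by
    by_cases ha : a = 0
    · simp [ha]
    · exact Nat.le_of_dvd (Int.natAbs_pos.2 ha) (Int.natAbs_dvd_natAbs.2
        (by simpa [Rat.divInt_eq_div] using Rat.num_dvd a hb))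
  have h2 : ((a : ℚ) / b).den ≤ b.natAbs := by
    have h := Rat.den_dvd a b
    rw [Rat.divInt_eq_div] at h
    have h' := Int.natAbs_dvd_natAbs.2 h
    simpa using Nat.le_of_dvd (Int.natAbs_pos.2 hb) h'
  have h3 := Nat.size_le_size h1
  have h4 := Nat.size_le_size h2
  omega

theorem ratSize_zero : ratSize 0 = 2 := by
  simp [ratSize]

theorem ratSize_one : ratSize 1 = 3 := by
  simp [ratSize]

theorem one_le_ratSize (q : ℚ) : 1 ≤ ratSize q := by
  unfold ratSize; omega

theorem ratSize_mul_le (x y : ℚ) : ratSize (x * y) ≤ ratSize x + ratSize y := by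
  have h : x * y = ((x.num * y.num : ℤ) : ℚ) / ((x.den * y.den : ℤ) : ℚ) := by
    push_cast
    rw [mul_div_mul_comm, Rat.num_div_den, Rat.num_div_den]
  have h1 := ratSize_div_le (x.num * y.num) (x.den * y.den) (by simp)
  rw [← h] at h1
  have h2 := size_mul_le x.num.natAbs y.num.natAbs
  have h3 := size_mul_le x.den y.den
  simp only [Int.natAbs_mul, Int.natAbs_natCast] at h1
  unfold ratSize at *
  omega

theorem ratSize_div_le_add (x y : ℚ) : ratSize (x / y) ≤ ratSize x + ratSize y := by
  by_cases hy : y = 0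
  · subst hy
    have := one_le_ratSize x
    simp only [div_zero, ratSize_zero]
    omega
  have hn : y.num ≠ 0 := by simpa using hy
  have h : x / y = ((x.num * y.den : ℤ) : ℚ) / ((x.den * y.num : ℤ) : ℚ) := by
    push_cast
    conv_lhs => rw [← Rat.num_div_den x, ← Rat.num_div_den y]
    rw [div_div_div_eq]
  have h1 := ratSize_div_le (x.num * y.den) (x.den * y.num) (by simp [hn])
  rw [← h] at h1
  have h2 := size_mul_le x.num.natAbs y.den
  have h3 := size_mul_le x.den y.num.natAbs
  simp only [Int.natAbs_mul, Int.natAbs_natCast] at h1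
  unfold ratSize at *
  omega

theorem ratSize_neg (x : ℚ) : ratSize (-x) = ratSize x := by
  simp [ratSize]

theorem ratSize_add_le (x y : ℚ) : ratSize (x + y) ≤ 2 * (ratSize x + ratSize y) := by
  have h : x + y = ((x.num * y.den + x.den * y.num : ℤ) : ℚ) / ((x.den * y.den : ℤ) : ℚ) := by
    push_cast
    conv_lhs => rw [← Rat.num_div_den x, ← Rat.num_div_den y]
    rw [div_add_div]
    · simp
    · simp
  have h1 := ratSize_div_le (x.num * y.den + x.den * y.num) (x.den * y.den) (by simp)
  rw [← h] at h1
  have h2 := size_mul_le x.num.natAbs y.den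
  have h3 := size_mul_le x.den y.num.natAbs
  have h4 := size_mul_le x.den y.den
  have h5 := Nat.size_le_size (Int.natAbs_add_le (x.num * y.den) (x.den * y.num))
  have h6 := size_add_le (x.num * y.den).natAbs (x.den * y.num).natAbs
  simp only [Int.natAbs_mul, Int.natAbs_natCast] at *
  unfold ratSize at *
  omega

theorem ratSize_sub_le (x y : ℚ) : ratSize (x - y) ≤ 2 * (ratSize x + ratSize y) := by
  rw [sub_eq_add_neg, ← ratSize_neg y]
  exact ratSize_add_le x (-y)

/-! ### Memories with bounded cells, and the evaluation of expressions -/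

/-- Every cell of the memory holds a number of at most `b` bits. -/
structure Bdd (b : ℕ) (σ : Mem) : Prop where
  nat : ∀ a i, Nat.size (σ.nat a i) ≤ b
  rat : ∀ a i, ratSize (σ.rat a i) ≤ b

/-- A factor by which the evaluation of the expression can increase the number of bits. -/
def NExpr.wt : NExpr → ℕ
  | lit k => k + 1
  | get _ i => i.wt + 1
  | add e f => e.wt + f.wt + 1
  | sub e f => e.wt + f.wt + 1
  | mul e f => e.wt + f.wt + 1

/-- A factor by which the evaluation of the expression can increase the number of bits. -/
def RExpr.wt : RExpr → ℕ
  | lit q => ratSize q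
  | get _ i => i.wt + 1
  | add e f => 2 * (e.wt + f.wt)
  | sub e f => 2 * (e.wt + f.wt)
  | mul e f => e.wt + f.wt
  | div e f => e.wt + f.wt

/-- A factor by which the evaluation of the test can increase the number of bits. -/
def Test.wt : Test → ℕ
  | natLt e f => e.wt + f.wt
  | natEq e f => e.wt + f.wt
  | ratLt e f => e.wt + f.wt
  | ratEq e f => e.wt + f.wt
  | not b => b.wt
  | and b c => b.wt + c.wt

/-- The evaluation of the expression performs no division by zero. -/
def RExpr.DivOk (σ : Mem) : RExpr → Prop
  | lit _ => True
  | get _ _ => True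
  | add e f => e.DivOk σ ∧ f.DivOk σ
  | sub e f => e.DivOk σ ∧ f.DivOk σ
  | mul e f => e.DivOk σ ∧ f.DivOk σ
  | div e f => e.DivOk σ ∧ f.DivOk σ ∧ f.eval σ ≠ 0

/-- The evaluation of the test performs no division by zero. -/
def Test.DivOk (σ : Mem) : Test → Prop
  | natLt _ _ => True
  | natEq _ _ => True
  | ratLt e f => e.DivOk σ ∧ f.DivOk σ
  | ratEq e f => e.DivOk σ ∧ f.DivOk σ
  | not b => b.DivOk σ
  | and b c => b.DivOk σ ∧ c.DivOk σ

theorem NExpr.Ok.mono {B B' : ℕ} (h : B ≤ B') {σ : Mem} :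
    ∀ {e : NExpr}, e.Ok B σ → e.Ok B' σ
  | lit _, he => le_trans he h
  | get _ _, he => ⟨he.1.mono h, he.2.trans h⟩
  | add _ _, he => ⟨he.1.mono h, he.2.1.mono h, he.2.2.trans h⟩
  | sub _ _, he => ⟨he.1.mono h, he.2.1.mono h, he.2.2.trans h⟩
  | mul _ _, he => ⟨he.1.mono h, he.2.1.mono h, he.2.2.trans h⟩

theorem RExpr.Ok.mono {B B' : ℕ} (h : B ≤ B') {σ : Mem} :
    ∀ {e : RExpr}, e.Ok B σ → e.Ok B' σ
  | lit _, he => le_trans he h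
  | get _ _, he => ⟨he.1.mono h, he.2.trans h⟩
  | add _ _, he => ⟨he.1.mono h, he.2.1.mono h, he.2.2.trans h⟩
  | sub _ _, he => ⟨he.1.mono h, he.2.1.mono h, he.2.2.trans h⟩
  | mul _ _, he => ⟨he.1.mono h, he.2.1.mono h, he.2.2.trans h⟩
  | div _ _, he => ⟨he.1.mono h, he.2.1.mono h, he.2.2.1, he.2.2.2.trans h⟩

theorem Test.Ok.mono {B B' : ℕ} (h : B ≤ B') {σ : Mem} :
    ∀ {b : Test}, b.Ok B σ → b.Ok B' σ
  | natLt _ _, hb => ⟨hb.1.mono h, hb.2.mono h⟩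
  | natEq _ _, hb => ⟨hb.1.mono h, hb.2.mono h⟩
  | ratLt _ _, hb => ⟨hb.1.mono h, hb.2.mono h⟩
  | ratEq _ _, hb => ⟨hb.1.mono h, hb.2.mono h⟩
  | not c, hb => Test.Ok.mono (b := c) h hb
  | and _ _, hb => ⟨hb.1.mono h, hb.2.mono h⟩

/-- In a memory with cells of at most `b` bits, an expression produces only numbers of at most
`wt * b` bits. -/
theorem NExpr.ok_of_bdd {b : ℕ} (hb : 1 ≤ b) {σ : Mem} (hσ : Bdd b σ) (e : NExpr) :
    e.Ok (e.wt * b) σ ∧ Nat.size (e.eval σ) ≤ e.wt * b := by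
  induction e with
  | lit k =>
    have h : Nat.size k ≤ (k + 1) * b := (size_le_self k).trans (by nlinarith)
    exact ⟨h, h⟩
  | get a i ih =>
    have h := hσ.nat a (i.eval σ)
    have h2 : Nat.size (σ.nat a (i.eval σ)) ≤ (i.wt + 1) * b := h.trans (by nlinarith)
    exact ⟨⟨ih.1.mono (by simp only [wt]; nlinarith), h2⟩, h2⟩
  | add e f ihe ihf =>
    have h := size_add_le (e.eval σ) (f.eval σ)
    have h2 : Nat.size (e.eval σ + f.eval σ) ≤ (e.wt + f.wt + 1) * b := by nlinarith [ihe.2, ihf.2]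
    exact ⟨⟨ihe.1.mono (by simp only [wt]; nlinarith), ihf.1.mono (by simp only [wt]; nlinarith), h2⟩,
      h2⟩
  | sub e f ihe ihf =>
    have h := Nat.size_le_size (Nat.sub_le (e.eval σ) (f.eval σ))
    have h2 : Nat.size (e.eval σ - f.eval σ) ≤ (e.wt + f.wt + 1) * b := by nlinarith [ihe.2, ihf.2]
    exact ⟨⟨ihe.1.mono (by simp only [wt]; nlinarith), ihf.1.mono (by simp only [wt]; nlinarith), h2⟩,
      h2⟩
  | mul e f ihe ihf =>
    have h := size_mul_le (e.eval σ) (f.eval σ)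
    have h2 : Nat.size (e.eval σ * f.eval σ) ≤ (e.wt + f.wt + 1) * b := by nlinarith [ihe.2, ihf.2]
    exact ⟨⟨ihe.1.mono (by simp only [wt]; nlinarith), ihf.1.mono (by simp only [wt]; nlinarith), h2⟩,
      h2⟩

theorem RExpr.ok_of_bdd {b : ℕ} (hb : 1 ≤ b) {σ : Mem} (hσ : Bdd b σ) (e : RExpr)
    (hd : e.DivOk σ) : e.Ok (e.wt * b) σ ∧ ratSize (e.eval σ) ≤ e.wt * b := by
  induction e with
  | lit q =>
    have h : ratSize q ≤ ratSize q * b := by nlinarith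
    exact ⟨h, h⟩
  | get a i =>
    have h := hσ.rat a (i.eval σ)
    have h2 : ratSize (σ.rat a (i.eval σ)) ≤ (i.wt + 1) * b := h.trans (by nlinarith)
    exact ⟨⟨(i.ok_of_bdd hb hσ).1.mono (by simp only [wt]; nlinarith), h2⟩, h2⟩
  | add e f ihe ihf =>
    have ihe := ihe hd.1
    have ihf := ihf hd.2
    have h := ratSize_add_le (e.eval σ) (f.eval σ)
    have h2 : ratSize (e.eval σ + f.eval σ) ≤ (2 * (e.wt + f.wt)) * b := by nlinarith
    exact ⟨⟨ihe.1.mono (by simp only [wt]; nlinarith), ihf.1.mono (by simp only [wt]; nlinarith), h2⟩,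
      h2⟩
  | sub e f ihe ihf =>
    have ihe := ihe hd.1
    have ihf := ihf hd.2
    have h := ratSize_sub_le (e.eval σ) (f.eval σ)
    have h2 : ratSize (e.eval σ - f.eval σ) ≤ (2 * (e.wt + f.wt)) * b := by nlinarith
    exact ⟨⟨ihe.1.mono (by simp only [wt]; nlinarith), ihf.1.mono (by simp only [wt]; nlinarith), h2⟩,
      h2⟩
  | mul e f ihe ihf =>
    have ihe := ihe hd.1
    have ihf := ihf hd.2
    have h := ratSize_mul_le (e.eval σ) (f.eval σ)
    have h2 : ratSize (e.eval σ * f.eval σ) ≤ (e.wt + f.wt) * b := by nlinarith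
    exact ⟨⟨ihe.1.mono (by simp only [wt]; nlinarith), ihf.1.mono (by simp only [wt]; nlinarith), h2⟩,
      h2⟩
  | div e f ihe ihf =>
    have ihe := ihe hd.1
    have ihf := ihf hd.2.1
    have h := ratSize_div_le_add (e.eval σ) (f.eval σ)
    have h2 : ratSize (e.eval σ / f.eval σ) ≤ (e.wt + f.wt) * b := by nlinarith
    exact ⟨⟨ihe.1.mono (by simp only [wt]; nlinarith), ihf.1.mono (by simp only [wt]; nlinarith),
      hd.2.2, h2⟩, h2⟩

theorem Test.ok_of_bdd {b : ℕ} (hb : 1 ≤ b) {σ : Mem} (hσ : Bdd b σ) (c : Test)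
    (hd : c.DivOk σ) : c.Ok (c.wt * b) σ := by
  induction c with
  | natLt e f =>
    exact ⟨(e.ok_of_bdd hb hσ).1.mono (by simp only [wt]; nlinarith),
      (f.ok_of_bdd hb hσ).1.mono (by simp only [wt]; nlinarith)⟩
  | natEq e f =>
    exact ⟨(e.ok_of_bdd hb hσ).1.mono (by simp only [wt]; nlinarith),
      (f.ok_of_bdd hb hσ).1.mono (by simp only [wt]; nlinarith)⟩
  | ratLt e f =>
    exact ⟨(e.ok_of_bdd hb hσ hd.1).1.mono (by simp only [wt]; nlinarith),
      (f.ok_of_bdd hb hσ hd.2).1.mono (by simp only [wt]; nlinarith)⟩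
  | ratEq e f =>
    exact ⟨(e.ok_of_bdd hb hσ hd.1).1.mono (by simp only [wt]; nlinarith),
      (f.ok_of_bdd hb hσ hd.2).1.mono (by simp only [wt]; nlinarith)⟩
  | not c ih => exact ih hd
  | and c d ihc ihd =>
    exact ⟨(ihc hd.1).mono (by simp only [wt]; nlinarith),
      (ihd hd.2).mono (by simp only [wt]; nlinarith)⟩

theorem Runs.mono {B B' : ℕ} (h : B ≤ B') {p : Prog} {σ τ : Mem} {t : ℕ} (hr : Runs B p σ t τ) :
    Runs B' p σ t τ := by
  induction hr with
  | skip σ => exact .skip σ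
  | setNat hi he => exact .setNat (hi.mono h) (he.mono h)
  | setRat hi he => exact .setRat (hi.mono h) (he.mono h)
  | seq _ _ ihp ihq => exact .seq ihp ihq
  | iteTrue hb hh _ ih => exact .iteTrue (hb.mono h) hh ih
  | iteFalse hb hh _ ih => exact .iteFalse (hb.mono h) hh ih
  | loopDone hb hh => exact .loopDone (hb.mono h) hh
  | loopStep hb hh _ _ ih1 ih2 => exact .loopStep (hb.mono h) hh ih1 ih2

/-! ### Writing to the memory -/

@[simp] theorem Mem.writeNat_nat_self (σ : Mem) (a i v : ℕ) :
    (σ.writeNat a i v).nat a = Function.update (σ.nat a) i v := by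
  simp [Mem.writeNat]

@[simp] theorem Mem.writeNat_nat_ne (σ : Mem) {a a' : ℕ} (i v : ℕ) (h : a' ≠ a) :
    (σ.writeNat a i v).nat a' = σ.nat a' := by
  simp [Mem.writeNat, h]

@[simp] theorem Mem.writeNat_rat (σ : Mem) (a i v : ℕ) : (σ.writeNat a i v).rat = σ.rat := rfl

@[simp] theorem Mem.writeRat_rat_self (σ : Mem) (a i : ℕ) (v : ℚ) :
    (σ.writeRat a i v).rat a = Function.update (σ.rat a) i v := by
  simp [Mem.writeRat]

@[simp] theorem Mem.writeRat_rat_ne (σ : Mem) {a a' : ℕ} (i : ℕ) (v : ℚ) (h : a' ≠ a) :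
    (σ.writeRat a i v).rat a' = σ.rat a' := by
  simp [Mem.writeRat, h]

@[simp] theorem Mem.writeRat_nat (σ : Mem) (a i : ℕ) (v : ℚ) : (σ.writeRat a i v).nat = σ.nat := rfl

theorem Bdd.writeNat {b : ℕ} {σ : Mem} (hσ : Bdd b σ) (a i : ℕ) {v : ℕ} (hv : Nat.size v ≤ b) :
    Bdd b (σ.writeNat a i v) := by
  refine ⟨fun a' i' => ?_, hσ.rat⟩
  by_cases h : a' = a
  · subst h
    by_cases h' : i' = i
    · simpa [h'] using hv
    · simpa [h'] using hσ.nat a' i'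
  · simpa [h] using hσ.nat a' i'

theorem Bdd.writeRat {b : ℕ} {σ : Mem} (hσ : Bdd b σ) (a i : ℕ) {v : ℚ} (hv : ratSize v ≤ b) :
    Bdd b (σ.writeRat a i v) := by
  refine ⟨hσ.nat, fun a' i' => ?_⟩
  by_cases h : a' = a
  · subst h
    by_cases h' : i' = i
    · simpa [h'] using hv
    · simpa [h'] using hσ.rat a' i'
  · simpa [h] using hσ.rat a' i'

/-! ### Syntactic bounds on programs, and weakest preconditions -/

/-- A factor by which a single evaluation in the program can increase the number of bits. -/
def Prog.wt : Prog → ℕ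
  | skip => 1
  | setNat _ i e => i.wt + e.wt
  | setRat _ i e => i.wt + e.wt
  | seq p q => p.wt + q.wt
  | ite b p q => b.wt + p.wt + q.wt
  | loop b p => b.wt + p.wt

/-- The number of elementary operations of the program, as a polynomial in an upper bound for the
number of repetitions of each loop. -/
noncomputable def Prog.time : Prog → Polynomial ℕ
  | skip => 1
  | setNat _ i e => Polynomial.C (i.cost + e.cost + 1)
  | setRat _ i e => Polynomial.C (i.cost + e.cost + 1)
  | seq p q => p.time + q.time
  | ite b p q => Polynomial.C (b.cost + 1) + p.time + q.time
  | loop b p => Polynomial.X * (Polynomial.C (b.cost + 1) + p.time) + Polynomial.C (b.cost + 1)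

/-- The arrays of natural numbers to which the program writes. -/
def Prog.natW : Prog → List ℕ
  | skip => []
  | setNat a _ _ => [a]
  | setRat _ _ _ => []
  | seq p q => p.natW ++ q.natW
  | ite _ p q => p.natW ++ q.natW
  | loop _ p => p.natW

/-- The arrays of rational numbers to which the program writes. -/
def Prog.ratW : Prog → List ℕ
  | skip => []
  | setNat _ _ _ => []
  | setRat a _ _ => [a]
  | seq p q => p.ratW ++ q.ratW
  | ite _ p q => p.ratW ++ q.ratW
  | loop _ p => p.ratW

/-- The memories agree except in the arrays to which the program writes. -/
structure Frame (p : Prog) (σ τ : Mem) : Prop where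
  nat : ∀ a, a ∉ p.natW → τ.nat a = σ.nat a
  rat : ∀ a, a ∉ p.ratW → τ.rat a = σ.rat a

theorem Frame.refl (p : Prog) (σ : Mem) : Frame p σ σ := ⟨fun _ _ => rfl, fun _ _ => rfl⟩

theorem Frame.trans {p : Prog} {σ τ υ : Mem} (h : Frame p σ τ) (h' : Frame p τ υ) :
    Frame p σ υ :=
  ⟨fun a ha => (h'.nat a ha).trans (h.nat a ha), fun a ha => (h'.rat a ha).trans (h.rat a ha)⟩

theorem Frame.of_subset {p q : Prog} {σ τ : Mem} (h : Frame p σ τ)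
    (h1 : ∀ a ∈ p.natW, a ∈ q.natW) (h2 : ∀ a ∈ p.ratW, a ∈ q.ratW) : Frame q σ τ :=
  ⟨fun a ha => h.nat a fun h' => ha (h1 a h'), fun a ha => h.rat a fun h' => ha (h2 a h')⟩

/-- A run changes only the arrays to which the program writes. -/
theorem Runs.frame {B : ℕ} {p : Prog} {σ τ : Mem} {t : ℕ} (h : Runs B p σ t τ) : Frame p σ τ := by
  induction h with
  | skip σ => exact .refl _ _
  | setNat => exact ⟨fun a ha => Mem.writeNat_nat_ne _ _ _ (by simpa [Prog.natW] using ha),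
      fun _ _ => rfl⟩
  | setRat => exact ⟨fun _ _ => rfl,
      fun a ha => Mem.writeRat_rat_ne _ _ _ (by simpa [Prog.ratW] using ha)⟩
  | seq _ _ ihp ihq =>
    exact (ihp.of_subset (by simp +contextual [Prog.natW]) (by simp +contextual [Prog.ratW])).trans
      (ihq.of_subset (by simp +contextual [Prog.natW]) (by simp +contextual [Prog.ratW]))
  | iteTrue _ _ _ ih =>
    exact ih.of_subset (by simp +contextual [Prog.natW]) (by simp +contextual [Prog.ratW])
  | iteFalse _ _ _ ih =>
    exact ih.of_subset (by simp +contextual [Prog.natW]) (by simp +contextual [Prog.ratW])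
  | loopDone => exact .refl _ _
  | loopStep _ _ _ _ ih1 ih2 =>
    exact (ih1.of_subset (by simp [Prog.natW]) (by simp [Prog.ratW])).trans ih2

/-- Started with the memory `σ`, the program halts with a memory that has the property `Q`. All
memory cells keep at most `b` bits, and the number of operations is at most the value of `p.time` at
`K`, which is what follows if every loop is repeated at most `K` times. -/
def wp (b K : ℕ) (p : Prog) (σ : Mem) (Q : Mem → Prop) : Prop :=
  ∃ t τ, Runs (p.wt * b) p σ t τ ∧ t ≤ p.time.eval K ∧ Bdd b τ ∧ Q τ

section Rules

variable {b K : ℕ} {σ : Mem} {Q Q' : Mem → Prop}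

theorem wp.imp {p : Prog} (h : wp b K p σ Q)
    (hQ : ∀ τ, Bdd b τ → Frame p σ τ → Q τ → Q' τ) : wp b K p σ Q' := by
  obtain ⟨t, τ, h1, h2, h3, h4⟩ := h
  exact ⟨t, τ, h1, h2, h3, hQ τ h3 h1.frame h4⟩

theorem wp_skip (hσ : Bdd b σ) (h : Q σ) : wp b K .skip σ Q :=
  ⟨1, σ, .skip σ, by simp [Prog.time], hσ, h⟩

theorem wp_setNat (hb : 1 ≤ b) (hσ : Bdd b σ) {a : ℕ} {i e : NExpr} (he : Nat.size (e.eval σ) ≤ b)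
    (h : Q (σ.writeNat a (i.eval σ) (e.eval σ))) : wp b K (.setNat a i e) σ Q :=
  ⟨_, _, .setNat ((i.ok_of_bdd hb hσ).1.mono (by simp only [Prog.wt]; nlinarith))
      ((e.ok_of_bdd hb hσ).1.mono (by simp only [Prog.wt]; nlinarith)),
    by simp [Prog.time], hσ.writeNat _ _ he, h⟩

theorem wp_setRat (hb : 1 ≤ b) (hσ : Bdd b σ) {a : ℕ} {i : NExpr} {e : RExpr} (hd : e.DivOk σ)
    (he : ratSize (e.eval σ) ≤ b)
    (h : Q (σ.writeRat a (i.eval σ) (e.eval σ))) : wp b K (.setRat a i e) σ Q :=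
  ⟨_, _, .setRat ((i.ok_of_bdd hb hσ).1.mono (by simp only [Prog.wt]; nlinarith))
      ((e.ok_of_bdd hb hσ hd).1.mono (by simp only [Prog.wt]; nlinarith)),
    by simp [Prog.time], hσ.writeRat _ _ he, h⟩

theorem wp_seq {p q : Prog} (h : wp b K p σ fun τ => Bdd b τ → Frame p σ τ → wp b K q τ Q) :
    wp b K (.seq p q) σ Q := by
  obtain ⟨t, τ, h1, h2, h3, h4⟩ := h
  obtain ⟨u, υ, h5, h6, h7, h8⟩ := h4 h3 h1.frame
  refine ⟨t + u, υ, .seq (h1.mono ?_) (h5.mono ?_), ?_, h7, h8⟩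
  · simp only [Prog.wt]; nlinarith
  · simp only [Prog.wt]; nlinarith
  · simp only [Prog.time, Polynomial.eval_add]; omega

theorem wp_ite (hb : 1 ≤ b) (hσ : Bdd b σ) {c : Test} {p q : Prog} (hd : c.DivOk σ)
    (h1 : c.Holds σ → wp b K p σ Q) (h2 : ¬ c.Holds σ → wp b K q σ Q) :
    wp b K (.ite c p q) σ Q := by
  have hc := (c.ok_of_bdd hb hσ hd).mono (B' := (Prog.ite c p q).wt * b)
    (by simp only [Prog.wt]; nlinarith)
  by_cases h : c.Holds σ
  · obtain ⟨t, τ, h1, h2, h3, h4⟩ := h1 h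
    refine ⟨_, τ, .iteTrue hc h (h1.mono ?_), ?_, h3, h4⟩
    · simp only [Prog.wt]; nlinarith
    · simp [Prog.time]; omega
  · obtain ⟨t, τ, h1, h2, h3, h4⟩ := h2 h
    refine ⟨_, τ, .iteFalse hc h (h1.mono ?_), ?_, h3, h4⟩
    · simp only [Prog.wt]; nlinarith
    · simp [Prog.time]; omega

/-- The counter `v` (cell `0` of the array number `v`) runs from `0` to the value of `e`. -/
def Prog.forTo (v : ℕ) (e : NExpr) (p : Prog) : Prog :=
  .seq (.setNat v (.lit 0) (.lit 0))
    (.loop (.natLt (.get v (.lit 0)) e)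
      (.seq p (.setNat v (.lit 0) (.add (.get v (.lit 0)) (.lit 1)))))

/-- The rule for counting loops: `Inv k` is the invariant before the repetition number `k`. -/
theorem wp_for (hb : 1 ≤ b) (hσ : Bdd b σ) {v : ℕ} {e : NExpr} {p : Prog} (N : ℕ) (hN : N ≤ K)
    (hKb : K ≤ b) (hv : v ∉ p.natW) (Inv : ℕ → Mem → Prop)
    (he : ∀ τ, Frame (.forTo v e p) σ τ → e.eval τ = N)
    (h0 : Inv 0 (σ.writeNat v 0 0))
    (hs : ∀ k < N, ∀ τ, Bdd b τ → Frame (.forTo v e p) σ τ → τ.nat v 0 = k → Inv k τ →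
      wp b K p τ fun υ => Bdd b υ → Frame p τ υ → Frame (.forTo v e p) σ υ → υ.nat v 0 = k →
        Inv (k + 1) (υ.writeNat v 0 (k + 1)))
    (hQ : ∀ τ, Bdd b τ → Frame (.forTo v e p) σ τ → τ.nat v 0 = N → Inv N τ → Q τ) :
    wp b K (.forTo v e p) σ Q := by
  set c : Test := .natLt (.get v (.lit 0)) e with hc
  set q : Prog := .seq p (.setNat v (.lit 0) (.add (.get v (.lit 0)) (.lit 1))) with hq
  set B := (Prog.forTo v e p).wt * b with hB
  have hB1 : (Prog.loop c q).wt * b ≤ B := by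
    rw [hB]; simp only [Prog.forTo, Prog.wt]; exact Nat.mul_le_mul_right _ (by simp [hc, hq, Prog.wt])
  have hB2 : c.wt * b ≤ B := le_trans (Nat.mul_le_mul_right _ (by simp [Prog.wt])) hB1
  have hB3 : p.wt * b ≤ B := le_trans (Nat.mul_le_mul_right _ (by simp [hq, Prog.wt]; omega)) hB1
  have hB4 : (Prog.setNat v (.lit 0) (.add (.get v (.lit 0)) (.lit 1))).wt * b ≤ B :=
    le_trans (Nat.mul_le_mul_right _ (by simp [hq, Prog.wt]; omega)) hB1
  have hfor : ∀ τ x, Frame (.forTo v e p) σ τ → Frame (.forTo v e p) σ (τ.writeNat v 0 x) := by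
    intro τ x h
    refine ⟨fun a ha => ?_, fun a ha => h.rat a ha⟩
    rw [Mem.writeNat_nat_ne, h.nat a ha]
    rintro rfl
    simp [Prog.forTo, Prog.natW] at ha
  have key : ∀ d k, k + d = N → ∀ τ, Bdd b τ → Frame (.forTo v e p) σ τ → τ.nat v 0 = k → Inv k τ →
      ∃ t υ, Runs B (.loop c q) τ t υ ∧
        t ≤ d * (c.cost + 1 + q.time.eval K) + (c.cost + 1) ∧ Bdd b υ ∧ Q υ := by
    intro d
    induction d with
    | zero =>
      intro k hk τ hτ hF hvk hI
      obtain rfl : k = N := by omega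
      refine ⟨_, τ, .loopDone ((c.ok_of_bdd hb hτ trivial).mono hB2) ?_, ?_, hτ, hQ τ hτ hF hvk hI⟩
      · simp [hc, Test.Holds, NExpr.eval, he τ hF, hvk]
      · simp
    | succ d ih =>
      intro k hk τ hτ hF hvk hI
      obtain ⟨t, υ, h1, h2, h3, h4⟩ := hs k (by omega) τ hτ hF hvk hI
      have hFυ : Frame (.forTo v e p) σ υ := hF.trans (h1.frame.of_subset
        (fun a ha => by simp [Prog.forTo, Prog.natW, ha]) (fun a ha => by simp [Prog.forTo, Prog.ratW, ha]))
      have hvυ : υ.nat v 0 = k := by rw [h1.frame.nat v hv, hvk]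
      have h4 := h4 h3 h1.frame hFυ hvυ
      have hsz : Nat.size (k + 1) ≤ b := (size_le_self _).trans (by omega)
      have hw : Runs B (.setNat v (.lit 0) (.add (.get v (.lit 0)) (.lit 1))) υ
          ((NExpr.lit 0).cost + (NExpr.add (.get v (.lit 0)) (.lit 1)).cost + 1)
          (υ.writeNat v 0 (k + 1)) := by
        have := Runs.setNat (a := v) (i := .lit 0) (e := .add (.get v (.lit 0)) (.lit 1)) (B := B)
          (σ := υ) ((NExpr.ok_of_bdd hb h3 _).1.mono ((Nat.mul_le_mul_right b
            (by simp only [Prog.wt]; omega)).trans hB4))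
          ((NExpr.ok_of_bdd hb h3 _).1.mono ((Nat.mul_le_mul_right b
            (by simp only [Prog.wt]; omega)).trans hB4))
        simpa [NExpr.eval, hvυ] using this
      obtain ⟨u, ω, g1, g2, g3, g4⟩ := ih (k + 1) (by omega) (υ.writeNat v 0 (k + 1))
        (h3.writeNat _ _ hsz) (hfor _ _ hFυ) (by simp) h4
      refine ⟨_, ω, .loopStep ((c.ok_of_bdd hb hτ trivial).mono hB2) ?_
        (.seq (h1.mono hB3) hw) g1, ?_, g3, g4⟩
      · simp only [hc, Test.Holds, NExpr.eval, he τ hF, hvk]; omega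
      · simp only [hq, Prog.time, Polynomial.eval_add, Polynomial.eval_C] at g2 ⊢
        nlinarith
  obtain ⟨t, υ, h1, h2, h3, h4⟩ := key N 0 (by omega) (σ.writeNat v 0 0)
    (hσ.writeNat _ _ (by simp)) (hfor _ _ (.refl _ _)) (by simp) h0
  refine ⟨_, υ, .seq (.setNat ((NExpr.ok_of_bdd hb hσ _).1.mono ?_)
    ((NExpr.ok_of_bdd hb hσ _).1.mono ?_)) h1, ?_, h3, h4⟩
  · exact (Nat.mul_le_mul_right b (by simp only [Prog.forTo, Prog.wt]; omega))
  · exact (Nat.mul_le_mul_right b (by simp only [Prog.forTo, Prog.wt]; omega))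
  · have : N * (c.cost + 1 + q.time.eval K) ≤ K * (c.cost + 1 + q.time.eval K) :=
      Nat.mul_le_mul_right _ hN
    simp only [Prog.forTo, Prog.time, Polynomial.eval_add, Polynomial.eval_C, Polynomial.eval_mul,
      Polynomial.eval_X, hq, hc] at *
    omega

end Rules

/-! ### Vertices of arrangements over ordered vector spaces -/

section Vertex

variable {V : Type*} [AddCommGroup V] [Module ℚ V] {κ ι : Type*} [Fintype ι]

/-- The value at `x` of the affine function number `k`, for linear parts `a` with rational
coefficients and constants `d`, when the coordinates of points and the constants are in an ordered
vector space. -/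
def affineVal (a : κ → ι → ℚ) (d : κ → V) (x : ι → V) (k : κ) : V := ∑ i, a k i • x i + d k

theorem affineVal_move (a : κ → ι → ℚ) (d : κ → V) (x : ι → V) (u : ι → ℚ) (τ : V) (k : κ) :
    affineVal a d (fun i => x i + u i • τ) k = affineVal a d x k + (∑ i, a k i * u i) • τ := by
  simp only [affineVal, smul_add, Finset.sum_add_distrib, Finset.sum_smul, mul_smul]
  abel

variable [LinearOrder V] [IsOrderedAddMonoid V] [PosSMulStrictMono ℚ V] [Fintype κ]

/-- Moving from a point towards a vertex of the cell of the arrangement that contains it: there is a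
point at which no affine function has changed its sign, except that it may have become zero, and at
which the linear parts of the functions that are zero span all the linear parts. -/
theorem exists_vertex (a : κ → ι → ℚ) (d : κ → V) (x₀ : ι → V) :
    ∃ x : ι → V, (∀ k, (0 ≤ affineVal a d x₀ k → 0 ≤ affineVal a d x k) ∧
        (affineVal a d x₀ k ≤ 0 → affineVal a d x k ≤ 0)) ∧
      ∀ u : ι → ℚ, (∀ k, affineVal a d x k = 0 → ∑ i, a k i * u i = 0) →
        ∀ k, ∑ i, a k i * u i = 0 := by
  classical
  let P : (ι → V) → Prop := fun x => ∀ k, (0 ≤ affineVal a d x₀ k → 0 ≤ affineVal a d x k) ∧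
        (affineVal a d x₀ k ≤ 0 → affineVal a d x k ≤ 0)
  let Z : (ι → V) → Finset κ := fun x => Finset.univ.filter fun k => affineVal a d x k = 0
  -- a point with the largest number of zeros
  obtain ⟨x, hx, hmax⟩ : ∃ x, P x ∧ ∀ y, P y → (Z y).card ≤ (Z x).card := by
    have hbdd : BddAbove {N | ∃ x, P x ∧ (Z x).card = N} :=
      ⟨Fintype.card κ, by rintro _ ⟨x, -, rfl⟩; exact Finset.card_le_univ _⟩
    obtain ⟨x, hx, hN⟩ := Nat.sSup_mem (s := {N | ∃ x, P x ∧ (Z x).card = N})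
      ⟨_, ⟨x₀, fun k => ⟨id, id⟩, rfl⟩⟩ hbdd
    exact ⟨x, hx, fun y hy => hN ▸ le_csSup hbdd ⟨y, hy, rfl⟩⟩
  refine ⟨x, hx, ?_⟩
  by_contra! hcon
  obtain ⟨u₀, hu₀, k₀, hk₀⟩ := hcon
  -- after a change of sign, the direction `u` decreases the absolute value of the function `k₀`
  obtain ⟨u, hu, happ⟩ : ∃ u : ι → ℚ, (∀ k, affineVal a d x k = 0 → ∑ i, a k i * u i = 0) ∧
      ∃ k, (affineVal a d x k < 0 ∧ 0 < ∑ i, a k i * u i) ∨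
        (0 < affineVal a d x k ∧ ∑ i, a k i * u i < 0) := by
    have hneg : ∀ k, ∑ i, a k i * (-u₀) i = -∑ i, a k i * u₀ i := fun k => by
      simp [Finset.sum_neg_distrib]
    have hne : affineVal a d x k₀ ≠ 0 := fun h => hk₀ (hu₀ k₀ h)
    have hu₀' : ∀ k, affineVal a d x k = 0 → ∑ i, a k i * (-u₀) i = 0 := fun k hk => by
      rw [hneg, hu₀ k hk, neg_zero]
    rcases lt_or_gt_of_ne hne with h1 | h1 <;> rcases lt_or_gt_of_ne hk₀ with h2 | h2
    · exact ⟨-u₀, hu₀', k₀, Or.inl ⟨h1, by rw [hneg]; linarith⟩⟩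
    · exact ⟨u₀, hu₀, k₀, Or.inl ⟨h1, h2⟩⟩
    · exact ⟨u₀, hu₀, k₀, Or.inr ⟨h1, h2⟩⟩
    · exact ⟨-u₀, hu₀', k₀, Or.inr ⟨h1, by rw [hneg]; linarith⟩⟩
  set v := affineVal a d x with hv
  let g : κ → ℚ := fun k => ∑ i, a k i * u i
  let A : Finset κ := Finset.univ.filter fun k => (v k < 0 ∧ 0 < g k) ∨ (0 < v k ∧ g k < 0)
  let τ : κ → V := fun k => (-(g k)⁻¹) • v k
  have hτ : ∀ k ∈ A, 0 < τ k ∧ v k + g k • τ k = 0 := by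
    intro k hk
    have hk : (v k < 0 ∧ 0 < g k) ∨ (0 < v k ∧ g k < 0) := by simpa [A] using hk
    constructor
    · rcases hk with ⟨h1, h2⟩ | ⟨h1, h2⟩
      · have := smul_pos (inv_pos.2 h2) (neg_pos.2 h1)
        simpa [τ] using this
      · have := smul_pos (neg_pos.2 (inv_lt_zero.2 h2)) h1
        simpa [τ] using this
    · have hg : g k ≠ 0 := by rcases hk with ⟨-, h⟩ | ⟨-, h⟩ <;> [exact h.ne'; exact h.ne]
      simp [τ, smul_smul, hg]
  obtain ⟨k₁, hk₁, hmin⟩ := Finset.exists_min_image A τ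
    (let ⟨k, hk⟩ := happ; ⟨k, by simpa [A, g] using hk⟩)
  set y : ι → V := fun i => x i + u i • τ k₁ with hy
  have hval : ∀ k, affineVal a d y k = v k + g k • τ k₁ := fun k => affineVal_move a d x u _ k
  have hpos := (hτ k₁ hk₁).1
  have hPy : P y := by
    intro k
    -- the weak sign of the function `k` is kept
    have h1 : 0 ≤ v k → 0 ≤ affineVal a d y k := by
      intro h
      rw [hval]
      rcases le_or_gt 0 (g k) with hg | hg
      · exact add_nonneg h (smul_nonneg hg hpos.le)
      · rcases h.eq_or_lt with h0 | h0
        · exact absurd (hu k h0.symm) hg.ne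
        · have hkA : k ∈ A := by simp [A, h0, hg]
          rw [← (hτ k hkA).2]
          have := smul_le_smul_of_nonneg_left (hmin k hkA) (neg_pos.2 hg).le
          simp only [neg_smul, neg_le_neg_iff] at this
          exact add_le_add_right this _
    have h2 : v k ≤ 0 → affineVal a d y k ≤ 0 := by
      intro h
      rw [hval]
      rcases le_or_gt (g k) 0 with hg | hg
      · have := smul_nonneg (neg_nonneg.2 hg) hpos.le
        rw [neg_smul, neg_nonneg] at this
        exact add_nonpos h this
      · rcases h.eq_or_lt with h0 | h0
        · exact absurd (hu k h0) hg.ne'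
        · have hkA : k ∈ A := by simp [A, h0, hg]
          rw [← (hτ k hkA).2]
          exact add_le_add_right (smul_le_smul_of_nonneg_left (hmin k hkA) hg.le) _
    exact ⟨fun h => h1 ((hx k).1 h), fun h => h2 ((hx k).2 h)⟩
  have hsub : insert k₁ (Z x) ⊆ Z y := by
    intro k hk
    rcases Finset.mem_insert.1 hk with rfl | hk
    · simp only [Z, Finset.mem_filter, Finset.mem_univ, true_and, hval]
      exact (hτ k hk₁).2
    · have hk : v k = 0 := by simpa [Z] using hk
      have hg : g k = 0 := hu k hk
      simp [Z, hval, hk, hg]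
  have hnot : k₁ ∉ Z x := by
    intro h
    have h : v k₁ = 0 := by simpa [Z] using h
    simp [A, h] at hk₁
  have h3 := Finset.card_le_card hsub
  rw [Finset.card_insert_of_notMem hnot] at h3
  have h4 := hmax y hPy
  omega

/-- A basis of the linear parts that consists of functions that are zero at the vertex. -/
theorem exists_vertex_basis (a : κ → ι → ℚ) (d : κ → V) (x₀ : ι → V) :
    ∃ (x : ι → V) (S : Set κ), (∀ k, (0 ≤ affineVal a d x₀ k → 0 ≤ affineVal a d x k) ∧
        (affineVal a d x₀ k ≤ 0 → affineVal a d x k ≤ 0)) ∧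
      (∀ k ∈ S, affineVal a d x k = 0) ∧ LinearIndepOn ℚ a S ∧
      ∀ k, a k ∈ Submodule.span ℚ (a '' S) := by
  classical
  obtain ⟨x, hx, hspan⟩ := exists_vertex a d x₀
  set Z : Set κ := {k | affineVal a d x k = 0} with hZ
  obtain ⟨S, hSZ, -, hZS, hS⟩ := exists_linearIndepOn_extension (K := ℚ) (v := a) (s := ∅) (t := Z)
    (by simp) (by simp)
  refine ⟨x, S, hx, fun k hk => hSZ hk, hS, fun k => ?_⟩
  by_contra hk
  have hk' : a k ∉ Submodule.span ℚ (a '' S) := hk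
  obtain ⟨f, hf, hle⟩ := Submodule.exists_le_ker_of_notMem hk'
  have hfe : ∀ y : ι → ℚ, f y = ∑ i, y i * f (Pi.single i 1) := by
    intro y
    conv_lhs => rw [pi_eq_sum_univ' y]
    rw [map_sum]
    refine Finset.sum_congr rfl fun i _ => ?_
    rw [map_smul, smul_eq_mul]
  apply hf
  rw [hfe]
  refine hspan (fun i => f (Pi.single i 1)) (fun l hl => ?_) k
  rw [← hfe]
  exact hle (hZS ⟨l, hl, rfl⟩)

end Vertex

/-! ### Rounding by elimination -/

/-- The first nonzero one among the first `N` terms of the sequence exists and is positive. -/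
def LexPos (N : ℕ) (g : ℕ → ℚ) : Prop := ∃ c < N, 0 < g c ∧ ∀ c' < c, g c' = 0

/-- The coefficient vectors of linear combinations of the rows `k` with `t k ≠ 0`. -/
def SuppIn (t : ℕ → ℕ) (w : ℕ → ℚ) : Prop := ∀ l, t l = 0 → w l = 0

/-- The rows `k` with `t k ≠ 0` of the matrix that consists of the first `n` rows and `r` columns
of `M` are a basis of the row space. -/
structure IsRowBasis (n r : ℕ) (M : ℕ → ℕ → ℚ) (t : ℕ → ℕ) : Prop where
  indep : ∀ w, SuppIn t w → (∀ i < r, ∑ l ∈ Finset.range n, w l * M l i = 0) → ∀ l < n, w l = 0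
  span : ∀ k < n, ∃ w, SuppIn t w ∧ ∀ i < r, M k i = ∑ l ∈ Finset.range n, w l * M l i

/-- The rounding `x` that belongs to the ternary vector `t`: entries `1` and `2` of `t` prescribe
the values `0` and `1`. For every other row `k`, a combination of the rows with nonzero entries of
`t` is subtracted from it so that the columns before column `r` become zero if that is
possible; the value is `1` if the first nonzero entry in the remaining columns is positive. -/
def Rounds (n r : ℕ) (M : ℕ → ℕ → ℚ) (t : ℕ → ℕ) (x : ℕ → ℚ) : Prop :=
  ∀ k < n, (t k = 1 → x k = 0) ∧ (t k = 2 → x k = 1) ∧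
    (t k = 0 → ∃ w, SuppIn t w ∧
      (IsRowBasis n r M t → ∀ i < r, M k i = ∑ l ∈ Finset.range n, w l * M l i) ∧
      (LexPos (n + 1) (fun c => M k (r + c) - ∑ l ∈ Finset.range n, w l * M l (r + c)) → x k = 1) ∧
      (¬ LexPos (n + 1) (fun c => M k (r + c) - ∑ l ∈ Finset.range n, w l * M l (r + c)) → x k = 0))

/-- The matrix with rows `(a k, d k, e k)`, where `e k` is the unit vector number `k`. -/
def tableau (r : ℕ) (a : ℕ → ℕ → ℚ) (d : ℕ → ℚ) (k c : ℕ) : ℚ :=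
  if c < r then a k c else if c = r then d k else if c = r + 1 + k then 1 else 0

instance {n : ℕ} : PosSMulStrictMono ℚ (Lex (Fin n → ℚ)) where
  smul_lt_smul_of_pos_left c hc x y hxy := by
    obtain ⟨i, h1, h2⟩ := hxy
    exact ⟨i, fun j hj => congrArg (c * ·) (h1 j hj), mul_lt_mul_of_pos_left h2 hc⟩

theorem LexPos.congr {N : ℕ} {g g' : ℕ → ℚ} (h : ∀ c < N, g c = g' c) (hg : LexPos N g) :
    LexPos N g' := by
  obtain ⟨c, hc, h1, h2⟩ := hg
  exact ⟨c, hc, h c hc ▸ h1, fun c' hc' => by rw [← h c' (hc'.trans hc)]; exact h2 c' hc'⟩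

theorem lexPos_iff {N : ℕ} (g : ℕ → ℚ) :
    LexPos N g ↔ 0 < (toLex fun c : Fin N => g c : Lex (Fin N → ℚ)) := by
  constructor
  · rintro ⟨c, hc, h1, h2⟩
    exact ⟨⟨c, hc⟩, fun j hj => (h2 j hj).symm, h1⟩
  · rintro ⟨c, h1, h2⟩
    exact ⟨c, c.2, h2, fun c' hc' => (h1 ⟨c', hc'.trans c.2⟩ hc').symm⟩

/-- Every sign pattern of the affine functions is attained, weakly, by the rounding that belongs to
some ternary vector with few nonzero entries. The constants are perturbed by infinitesimals, the
unit vectors of the tableau, so that a vertex of the perturbed arrangement lies on those hyperplanes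
only that belong to the basis. -/
theorem exists_rounds (n r : ℕ) (a : ℕ → ℕ → ℚ) (d lam : ℕ → ℚ) (Q : Finset ℕ)
    (hQ : ∀ k i, i ∉ Q → a k i = 0) :
    ∃ t : ℕ → ℕ, (∀ k, t k ≤ 2) ∧ (∀ k, n ≤ k → t k = 0) ∧
      ((Finset.range n).filter fun k => t k ≠ 0).card ≤ Q.card ∧
      ∃ z : ℕ → ℚ, (∀ k, z k = 0 ∨ z k = 1) ∧
        (∀ k < n, 0 < ∑ i ∈ Finset.range r, a k i * lam i + d k → z k = 1) ∧
        (∀ k < n, ∑ i ∈ Finset.range r, a k i * lam i + d k < 0 → z k = 0) ∧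
        ∀ x, Rounds n r (tableau r a d) t x → ∀ k < n, x k = z k := by
  classical
  -- coordinate `0` is the real part, coordinate `k + 1` the infinitesimal that belongs to row `k`
  let V := Lex (Fin (n + 1) → ℚ)
  let A : Fin n → Fin r → ℚ := fun k i => a k i
  let D : Fin n → V := fun k => toLex fun c =>
    if (c : ℕ) = 0 then d k else if (c : ℕ) = k + 1 then 1 else 0
  let x₀ : Fin r → V := fun i => toLex fun c => if (c : ℕ) = 0 then lam i else 0
  obtain ⟨x, S, hx, hS, hind, hspan⟩ := exists_vertex_basis A D x₀
  obtain ⟨S, rfl⟩ := S.toFinite.exists_finset_coe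
  simp only [Finset.mem_coe] at hS
  have hcoord : ∀ (y : Fin r → V) (k : Fin n) (c : Fin (n + 1)),
      ofLex (affineVal A D y k) c = ∑ i, A k i * ofLex (y i) c + ofLex (D k) c := by
    intro y k c
    have h : ∀ s : Finset (Fin r), ofLex (∑ i ∈ s, A k i • y i) c =
        ∑ i ∈ s, A k i * ofLex (y i) c := by
      intro s
      induction s using Finset.induction_on with
      | empty => rfl
      | insert i s hi ih => rw [Finset.sum_insert hi, Finset.sum_insert hi, ← ih]; rfl
    rw [← h]; rfl
  have hzero : ∀ k, ofLex (affineVal A D x₀ k) 0 =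
      ∑ i ∈ Finset.range r, a k i * lam i + d k := by
    intro k
    rw [hcoord, Finset.sum_range]
    simp [A, D, x₀]
  have hpos : ∀ k : Fin n, 0 < ∑ i ∈ Finset.range r, a k i * lam i + d k →
      0 < affineVal A D x₀ k := by
    intro k hk
    refine ⟨0, fun j hj => absurd hj (by simp), ?_⟩
    change 0 < ofLex (affineVal A D x₀ k) 0
    rwa [hzero]
  have hneg : ∀ k : Fin n, ∑ i ∈ Finset.range r, a k i * lam i + d k < 0 →
      affineVal A D x₀ k < 0 := by
    intro k hk
    refine ⟨0, fun j hj => absurd hj (by simp), ?_⟩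
    change ofLex (affineVal A D x₀ k) 0 < 0
    rwa [hzero]
  let t : ℕ → ℕ := fun k => if h : k < n then
    (if (⟨k, h⟩ : Fin n) ∈ S then (if 0 < affineVal A D x₀ ⟨k, h⟩ then 2 else 1) else 0) else 0
  let z : ℕ → ℚ := fun k => if h : k < n then
    (if 0 < affineVal A D x₀ ⟨k, h⟩ then 1 else 0) else 0
  have htS : ∀ k : Fin n, t k = 0 ↔ k ∉ S := by
    intro k
    simp only [t, k.2, dite_true, Fin.eta]
    split_ifs <;> simp_all
  have hsum : ∀ (w : ℕ → ℚ) (g : ℕ → ℚ), SuppIn t w →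
      ∑ l ∈ Finset.range n, w l * g l = ∑ l ∈ S, w l * g l := by
    intro w g hw
    rw [Finset.sum_range]
    refine (Finset.sum_subset (Finset.subset_univ S) fun l _ hl => ?_).symm
    rw [hw l ((htS l).2 hl), zero_mul]
  have htab : ∀ k i, i < r → tableau r a d k i = a k i := fun k i hi => by simp [tableau, hi]
  have hbasis : IsRowBasis n r (tableau r a d) t := by
    constructor
    · intro w hw h l hl
      by_cases hlS : (⟨l, hl⟩ : Fin n) ∈ S
      · refine linearIndepOn_finset_iff.1 hind (fun l => w l) ?_ ⟨l, hl⟩ hlS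
        funext i
        have h2 := h i i.2
        rw [hsum w _ hw] at h2
        simpa [Finset.sum_apply, A, htab] using h2
      · exact hw l ((htS ⟨l, hl⟩).2 hlS)
    · intro k hk
      obtain ⟨c, hc⟩ := (Submodule.mem_span_image_finset_iff_exists_fun' ℚ).1 (hspan ⟨k, hk⟩)
      let w : ℕ → ℚ := fun l => if h : l < n then (if (⟨l, h⟩ : Fin n) ∈ S then c ⟨l, h⟩ else 0) else 0
      have hw : SuppIn t w := by
        intro l hl
        simp only [w]
        split_ifs with h1 h2
        · exact absurd h2 ((htS ⟨l, h1⟩).1 hl)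
        · rfl
        · rfl
      refine ⟨w, hw, fun i hi => ?_⟩
      have h2 := congrFun hc ⟨i, hi⟩
      rw [hsum w _ hw, htab k i hi]
      simp only [Finset.sum_apply, Pi.smul_apply, smul_eq_mul, A] at h2
      rw [← h2]
      refine Finset.sum_congr rfl fun l hl => ?_
      rw [htab l i hi]
      simp [w, hl]
  refine ⟨t, ?_, ?_, ?_, z, ?_, ?_, ?_, ?_⟩
  · intro k
    simp only [t]
    split_ifs <;> omega
  · intro k hk
    simp [t, hk.not_gt]
  · have h1 : ((Finset.range n).filter fun k => t k ≠ 0).card = S.card := by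
      rw [← Finset.card_map Fin.valEmbedding]
      congr 1
      ext k
      simp only [Finset.mem_filter, Finset.mem_range, Finset.mem_map, Fin.valEmbedding_apply]
      constructor
      · rintro ⟨hk, h⟩
        exact ⟨⟨k, hk⟩, by_contra fun h' => h ((htS ⟨k, hk⟩).2 h'), rfl⟩
      · rintro ⟨l, hl, rfl⟩
        exact ⟨l.2, fun h => (htS l).1 h hl⟩
    rw [h1]
    -- extension by zero maps the vectors that are supported in `Q` to the rows
    let E : (Q → ℚ) →ₗ[ℚ] (Fin r → ℚ) :=
      { toFun := fun y i => if h : (i : ℕ) ∈ Q then y ⟨i, h⟩ else 0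
        map_add' := fun y y' => by funext i; by_cases h : (i : ℕ) ∈ Q <;> simp [h]
        map_smul' := fun c y => by funext i; by_cases h : (i : ℕ) ∈ Q <;> simp [h] }
    have hE : A = E ∘ fun (k : Fin n) (i : Q) => a k i := by
      funext k i
      by_cases h : (i : ℕ) ∈ Q
      · simp [E, A, h]
      · simp [E, A, h, hQ k i h]
    rw [hE] at hind
    have h2 : LinearIndependent ℚ fun (k : (S : Set (Fin n))) (i : Q) => a (k : Fin n) i :=
      LinearIndependent.of_comp E hind
    simpa using h2.fintype_card_le_finrank
  · intro k
    simp only [z]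
    split_ifs <;> simp
  · intro k hk h
    simp [z, hk, hpos ⟨k, hk⟩ h]
  · intro k hk h
    have h' : ¬ 0 < affineVal A D x₀ ⟨k, hk⟩ := fun h' => lt_irrefl _ (h'.trans (hneg ⟨k, hk⟩ h))
    simp only [z, hk, dite_true, if_neg h']
  · intro y hy k hk
    obtain ⟨h1, h2, h3⟩ := hy k hk
    by_cases hkS : (⟨k, hk⟩ : Fin n) ∈ S
    · by_cases hv : 0 < affineVal A D x₀ ⟨k, hk⟩
      · rw [h2 (by simp [t, hk, hkS, hv])]
        simp [z, hk, hv]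
      · rw [h1 (by simp [t, hk, hkS, hv])]
        simp [z, hk, hv]
    · obtain ⟨w, hw, h4, h5, h6⟩ := h3 ((htS ⟨k, hk⟩).2 hkS)
      have h4 := h4 hbasis
      -- the remaining part of the row is the value at the vertex
      have hval : (toLex fun c : Fin (n + 1) => tableau r a d k (r + c) -
          ∑ l ∈ Finset.range n, w l * tableau r a d l (r + c) : V) = affineVal A D x ⟨k, hk⟩ := by
        have hD : ∀ (l : Fin n) (c : Fin (n + 1)), tableau r a d l (r + c) = ofLex (D l) c := by
          intro l c
          simp only [tableau, D, ofLex_toLex]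
          rw [if_neg (by omega)]
          by_cases hc : (c : ℕ) = 0
          · simp [hc]
          · rw [if_neg (by omega), if_neg hc]
            exact if_congr (by omega) rfl rfl
        refine ofLex.injective (funext fun c => ?_)
        rw [hcoord, ofLex_toLex, hD ⟨k, hk⟩ c, hsum w _ hw]
        have e1 : ∀ i : Fin r, A ⟨k, hk⟩ i = ∑ l ∈ S, w l * A l i := by
          intro i
          have := h4 i i.2
          rw [hsum w _ hw, htab k i i.2] at this
          rw [show A ⟨k, hk⟩ i = a k i from rfl, this]
          exact Finset.sum_congr rfl fun l _ => by rw [htab l i i.2]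
        have e2 : ∑ i, A ⟨k, hk⟩ i * ofLex (x i) c =
            ∑ l ∈ S, w l * ∑ i, A l i * ofLex (x i) c := by
          simp only [e1, Finset.sum_mul, Finset.mul_sum]
          rw [Finset.sum_comm]
          exact Finset.sum_congr rfl fun l _ => Finset.sum_congr rfl fun i _ => by ring
        have e3 : ∀ l ∈ S, ∑ i, A l i * ofLex (x i) c = -ofLex (D l) c := by
          intro l hl
          have := hcoord x l c
          rw [hS l hl] at this
          have h0 : ofLex (0 : V) c = 0 := rfl
          rw [h0] at this
          linarith
        have e4 : ∑ l ∈ S, w l * ∑ i, A l i * ofLex (x i) c =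
            -∑ l ∈ S, w l * tableau r a d l (r + c) := by
          rw [← Finset.sum_neg_distrib]
          exact Finset.sum_congr rfl fun l hl => by rw [e3 l hl, mul_neg, ← hD l c]
        rw [e2, e4]
        ring
      -- the value is not zero: the rows of the basis do not meet the infinitesimal of row `k`
      have hne : affineVal A D x ⟨k, hk⟩ ≠ 0 := by
        intro h0
        have := congrFun (congrArg ofLex (hval.trans h0)) ⟨k + 1, by omega⟩
        have h0' : ofLex (0 : V) ⟨k + 1, by omega⟩ = 0 := rfl
        rw [h0', ofLex_toLex, hsum w _ hw, Finset.sum_eq_zero] at this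
        · simp [tableau, add_assoc, add_comm 1 k] at this
        · intro l hl
          have : (l : ℕ) ≠ k := by rintro rfl; exact hkS hl
          simp [tableau]
          omega
      rw [lexPos_iff, hval] at h5 h6
      by_cases hv : 0 < affineVal A D x₀ ⟨k, hk⟩
      · rw [h5 (lt_of_le_of_ne ((hx ⟨k, hk⟩).1 hv.le) hne.symm)]
        simp only [z, hk, dite_true, if_pos hv]
      · rw [h6 ((hx ⟨k, hk⟩).2 (not_lt.1 hv)).not_gt]
        simp only [z, hk, dite_true, if_neg hv]

/-! ### Optimization one group at a time -/

/-- A problem with its data indexed by natural numbers: `s` groups of `n j` variables and `r`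
products; the product number `i` involves the group `j` if `inc i j = 1`. -/
structure Inst where
  s : ℕ
  r : ℕ
  n : ℕ → ℕ
  inc : ℕ → ℕ → ℕ
  c : ℕ → ℕ → ℕ → ℚ
  c_eq_zero : ∀ i j k, inc i j ≠ 1 → c i j k = 0

namespace Inst

variable (G : Inst)

/-- The factor of the product number `i` that belongs to the group `j`. -/
def fac (x : ℕ → ℕ → ℚ) (i j : ℕ) : ℚ :=
  if G.inc i j = 1 then ∑ k ∈ Finset.range (G.n j), G.c i j k * x j k else 1

/-- The objective function. -/
def obj (x : ℕ → ℕ → ℚ) : ℚ := ∑ i ∈ Finset.range G.r, ∏ j ∈ Finset.range G.s, G.fac x i j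

/-- The part of the product number `i` that belongs to the groups from `j` on. -/
def gam (x : ℕ → ℕ → ℚ) (j i : ℕ) : ℚ := ∏ l ∈ Finset.Ico j G.s, G.fac x i l

/-- The product number `i` involves the group `j` and a group before it. -/
def Q (i j : ℕ) : Prop := G.inc i j = 1 ∧ ∃ l < j, G.inc i l = 1

open Classical in
/-- The number of products that involve the group `j` and a group before it. -/
noncomputable def m (j : ℕ) : ℕ := ((Finset.range G.r).filter fun i => G.Q i j).card

/-- The variables have the values `0` and `1`; cells that belong to no variable are arbitrary. -/
def Binary (x : ℕ → ℕ → ℚ) : Prop := ∀ j < G.s, ∀ k < G.n j, x j k = 0 ∨ x j k = 1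

open Classical in
/-- The coefficient of the variable `k` of group `j` with the products that involve earlier
groups. -/
noncomputable def linPart (j k i : ℕ) : ℚ := if i < G.r ∧ G.Q i j then G.c i j k else 0

open Classical in
/-- The coefficient of the variable `k` of group `j` with the products that do not involve earlier
groups, when the later groups are fixed. -/
noncomputable def constPart (x : ℕ → ℕ → ℚ) (j k : ℕ) : ℚ :=
  ∑ i ∈ Finset.range G.r, if G.Q i j then 0 else G.gam x (j + 1) i * G.c i j k

/-- The groups from `j₀` on of `x` are the roundings that belong to the ternary vectors `t j`. -/
def RoundsFrom (j₀ : ℕ) (t : ℕ → ℕ → ℕ) (x : ℕ → ℕ → ℚ) : Prop :=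
  ∀ j, j₀ ≤ j → j < G.s →
    Rounds (G.n j) G.r (tableau G.r (G.linPart j) (G.constPart x j)) (t j) (x j)

/-- The choices of ternary vectors for all groups that have to be tried: at most `m j` nonzero digits
in the group `j`. -/
structure Admissible (t : ℕ → ℕ → ℕ) : Prop where
  le_two : ∀ j k, t j k ≤ 2
  eq_zero : ∀ j k, G.n j ≤ k → t j k = 0
  eq_zero' : ∀ j k, G.s ≤ j → t j k = 0
  card_le : ∀ j < G.s, ((Finset.range (G.n j)).filter fun k => t j k ≠ 0).card ≤ G.m j

variable {G}

theorem fac_congr {x y : ℕ → ℕ → ℚ} {j : ℕ} (h : ∀ k < G.n j, x j k = y j k) (i : ℕ) :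
    G.fac x i j = G.fac y i j := by
  unfold fac
  split_ifs
  · exact Finset.sum_congr rfl fun k hk => by rw [h k (Finset.mem_range.1 hk)]
  · rfl

theorem gam_congr {x y : ℕ → ℕ → ℚ} {j : ℕ}
    (h : ∀ l, j ≤ l → l < G.s → ∀ k < G.n l, x l k = y l k) (i : ℕ) :
    G.gam x j i = G.gam y j i :=
  Finset.prod_congr rfl fun l hl =>
    fac_congr (h l (Finset.mem_Ico.1 hl).1 (Finset.mem_Ico.1 hl).2) i

theorem obj_congr {x y : ℕ → ℕ → ℚ} (h : ∀ l < G.s, ∀ k < G.n l, x l k = y l k) :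
    G.obj x = G.obj y :=
  Finset.sum_congr rfl fun i _ => Finset.prod_congr rfl fun l hl =>
    fac_congr (h l (Finset.mem_range.1 hl)) i

theorem gam_zero (x : ℕ → ℕ → ℚ) (i : ℕ) : G.gam x 0 i = ∏ j ∈ Finset.range G.s, G.fac x i j := by
  rw [gam, Finset.range_eq_Ico]

theorem gam_self (x : ℕ → ℕ → ℚ) (i : ℕ) : G.gam x G.s i = 1 := by simp [gam]

theorem gam_step (x : ℕ → ℕ → ℚ) {j : ℕ} (hj : j < G.s) (i : ℕ) :
    G.gam x j i = G.fac x i j * G.gam x (j + 1) i := by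
  rw [gam, Finset.prod_eq_prod_Ico_succ_bot hj]; rfl

theorem constPart_congr {x y : ℕ → ℕ → ℚ} {j : ℕ}
    (h : ∀ l, j + 1 ≤ l → l < G.s → ∀ k < G.n l, x l k = y l k) (k : ℕ) :
    G.constPart x j k = G.constPart y j k := by
  unfold constPart
  exact Finset.sum_congr rfl fun i _ => by rw [gam_congr h]

/-- The value of a product, split into the parts of the groups before `j`, after `j`, and `j`. -/
theorem prod_fac_split (x : ℕ → ℕ → ℚ) {j : ℕ} (hj : j < G.s) (i : ℕ) :
    ∏ l ∈ Finset.range G.s, G.fac x i l =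
      (∏ l ∈ Finset.range j, G.fac x i l) * G.gam x (j + 1) i * G.fac x i j := by
  rw [← Finset.prod_range_mul_prod_Ico _ hj.le, ← gam, gam_step x hj]
  ring

/-- Changing the group `j` changes the objective by an affine function of the change, whose
coefficients come from `linPart` and `constPart`. -/
theorem obj_update_sub (x : ℕ → ℕ → ℚ) {j : ℕ} (hj : j < G.s) (z : ℕ → ℚ) :
    G.obj (Function.update x j z) - G.obj x = ∑ k ∈ Finset.range (G.n j),
      (∑ i ∈ Finset.range G.r, G.linPart j k i *
        ((∏ l ∈ Finset.range j, G.fac x i l) * G.gam x (j + 1) i) + G.constPart x j k) *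
        (z k - x j k) := by
  classical
  set y := Function.update x j z with hy
  have hyl : ∀ l, l ≠ j → ∀ k, y l k = x l k := fun l hl k => by simp [hy, hl]
  have h1 : ∀ i, ∏ l ∈ Finset.range j, G.fac y i l = ∏ l ∈ Finset.range j, G.fac x i l := fun i =>
    Finset.prod_congr rfl fun l hl => fac_congr (fun k _ => hyl l (Finset.mem_range.1 hl).ne k) i
  have h2 : ∀ i, G.gam y (j + 1) i = G.gam x (j + 1) i := fun i =>
    gam_congr (fun l hl _ k _ => hyl l (by omega) k) i
  have h3 : ∀ i, G.fac y i j - G.fac x i j =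
      ∑ k ∈ Finset.range (G.n j), G.c i j k * (z k - x j k) := by
    intro i
    unfold fac
    split_ifs with h
    · rw [← Finset.sum_sub_distrib]
      exact Finset.sum_congr rfl fun k _ => by simp [hy]; ring
    · simp [G.c_eq_zero i j _ h]
  have h4 : ∀ i ∈ Finset.range G.r, ∀ k, (∏ l ∈ Finset.range j, G.fac x i l) * G.gam x (j + 1) i *
      G.c i j k = G.linPart j k i * ((∏ l ∈ Finset.range j, G.fac x i l) * G.gam x (j + 1) i) +
        if G.Q i j then 0 else G.gam x (j + 1) i * G.c i j k := by
    intro i hi k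
    rw [Finset.mem_range] at hi
    by_cases hq : G.Q i j
    · simp [linPart, hq, hi]; ring
    · by_cases hinc : G.inc i j = 1
      · -- no earlier group is involved
        have h5 : ∏ l ∈ Finset.range j, G.fac x i l = 1 := Finset.prod_eq_one fun l hl =>
          if_neg fun h => hq ⟨hinc, l, Finset.mem_range.1 hl, h⟩
        simp [linPart, hq, h5]
      · simp [linPart, hq, G.c_eq_zero i j k hinc]
  have h5 : ∀ k, ∑ i ∈ Finset.range G.r, G.linPart j k i *
        ((∏ l ∈ Finset.range j, G.fac x i l) * G.gam x (j + 1) i) + G.constPart x j k =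
      ∑ i ∈ Finset.range G.r, (∏ l ∈ Finset.range j, G.fac x i l) * G.gam x (j + 1) i *
        G.c i j k := by
    intro k
    rw [constPart, ← Finset.sum_add_distrib]
    exact Finset.sum_congr rfl fun i hi => (h4 i hi k).symm
  simp only [h5, Finset.sum_mul, obj]
  rw [Finset.sum_comm, ← Finset.sum_sub_distrib]
  refine Finset.sum_congr rfl fun i _ => ?_
  rw [prod_fac_split y hj, prod_fac_split x hj, h1, h2, ← mul_sub, h3, Finset.mul_sum]
  exact Finset.sum_congr rfl fun k _ => by ring

theorem exists_optimal : ∃ y, G.Binary y ∧ ∀ y', G.Binary y' → G.obj y' ≤ G.obj y := by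
  classical
  let ext : ((j : Fin G.s) → Fin (G.n j) → Bool) → ℕ → ℕ → ℚ := fun b j k =>
    if h : j < G.s then (if h' : k < G.n j then (if b ⟨j, h⟩ ⟨k, h'⟩ then 1 else 0) else 0) else 0
  obtain ⟨b, hb⟩ := Finite.exists_max fun b => G.obj (ext b)
  refine ⟨ext b, fun j hj k hk => ?_, fun y' hy' => ?_⟩
  · simp only [ext, hj, hk, dite_true]
    split_ifs <;> simp
  · refine le_trans (le_of_eq (obj_congr fun j hj k hk => ?_)) (hb fun j k => decide (y' j k = 1))
    rcases hy' j hj k hk with h | h <;> simp [ext, hj, hk, h]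

/-- The roundings that belong to a suitable admissible choice of ternary vectors are optimal: in an
optimal solution the groups are replaced, from the last to the first, by roundings. -/
theorem exists_admissible (j₀ : ℕ) (hj₀ : j₀ ≤ G.s) : ∃ t, G.Admissible t ∧ ∃ y, G.Binary y ∧
    (∀ y', G.Binary y' → G.obj y' ≤ G.obj y) ∧
    ∀ x, G.RoundsFrom j₀ t x → ∀ j, j₀ ≤ j → j < G.s → ∀ k < G.n j, x j k = y j k := by
  classical
  induction hd : G.s - j₀ generalizing j₀ with
  | zero =>
    obtain ⟨y, hy, hopt⟩ := G.exists_optimal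
    exact ⟨fun _ _ => 0, ⟨by simp, by simp, by simp, by simp⟩, y, hy, hopt, fun x _ j h1 h2 => by omega⟩
  | succ e ih =>
    obtain ⟨t, ht, y, hy, hopt, hround⟩ := ih (j₀ + 1) (by omega) (by omega)
    obtain ⟨t', h1, h2, h3, z, hz, hz1, hz0, hzr⟩ := exists_rounds (G.n j₀) G.r (G.linPart j₀)
      (G.constPart y j₀) (fun i => (∏ l ∈ Finset.range j₀, G.fac y i l) * G.gam y (j₀ + 1) i)
      ((Finset.range G.r).filter fun i => G.Q i j₀) (fun k i hi => by
        simp only [Finset.mem_filter, Finset.mem_range] at hi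
        simp [linPart, hi])
    have hj : j₀ < G.s := by omega
    refine ⟨Function.update t j₀ t', ⟨?_, ?_, ?_, ?_⟩, Function.update y j₀ z, ?_, ?_, ?_⟩
    · intro j k
      by_cases h : j = j₀
      · subst h; simpa using h1 k
      · simpa [h] using ht.le_two j k
    · intro j k hk
      by_cases h : j = j₀
      · subst h; simpa using h2 k hk
      · simpa [h] using ht.eq_zero j k hk
    · intro j k hk
      have h : j ≠ j₀ := by omega
      simpa [h] using ht.eq_zero' j k hk
    · intro j hj'
      by_cases h : j = j₀
      · subst h; simpa [m] using h3
      · simpa [h] using ht.card_le j hj'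
    · intro j hj' k hk
      by_cases h : j = j₀
      · subst h; simpa using hz k
      · simpa [h] using hy j hj' k hk
    · intro y' hy'
      refine (hopt y' hy').trans (sub_nonneg.1 ?_)
      rw [obj_update_sub y hj z]
      refine Finset.sum_nonneg fun k hk => ?_
      rw [Finset.mem_range] at hk
      set v := ∑ i ∈ Finset.range G.r, G.linPart j₀ k i *
        ((∏ l ∈ Finset.range j₀, G.fac y i l) * G.gam y (j₀ + 1) i) + G.constPart y j₀ k with hv
      rcases lt_trichotomy v 0 with h | h | h
      · rw [hz0 k hk h]
        refine mul_nonneg_of_nonpos_of_nonpos h.le ?_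
        rcases hy j₀ hj k hk with h' | h' <;> rw [h'] <;> norm_num
      · rw [h, zero_mul]
      · rw [hz1 k hk h]
        refine mul_nonneg h.le ?_
        rcases hy j₀ hj k hk with h' | h' <;> rw [h'] <;> norm_num
    · intro x hx
      have hx' : ∀ j, j₀ + 1 ≤ j → j < G.s → ∀ k < G.n j, x j k = y j k := by
        refine hround x fun j hj1 hj2 => ?_
        have := hx j (by omega) hj2
        rwa [Function.update_of_ne (by omega)] at this
      intro j hj1 hj2 k hk
      by_cases h : j = j₀
      · subst h
        rw [Function.update_self]
        refine hzr (x j) ?_ k hk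
        have := hx j le_rfl hj2
        rw [Function.update_self] at this
        have hc : G.constPart x j = G.constPart y j := funext fun k => constPart_congr hx' k
        rwa [hc] at this
      · rw [Function.update_of_ne h]
        exact hx' j (by omega) hj2 k hk

end Inst

/-! ### Gaussian elimination -/

/-- The state of the elimination in the matrix `M₀` with `n` rows, `W` columns, pivots in the first
`r` columns, and pivot rows among those with `t k ≠ 0`, when the rows before row `l` have been
treated. The pivots are at `(ρ q, κ q)`. The rows that are still in use are those with `t k = 0` and
those from `l` on. -/
def Elim (n r W : ℕ) (M₀ : ℕ → ℕ → ℚ) (t : ℕ → ℕ) (l : ℕ) (M : ℕ → ℕ → ℚ) : Prop :=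
  ∃ (ι : Type) (_ : Fintype ι) (_ : DecidableEq ι) (ρ κ : ι → ℕ), Function.Injective ρ ∧
    (∀ q, ρ q < l ∧ ρ q < n ∧ t (ρ q) ≠ 0 ∧ κ q < r) ∧
    (Matrix.of fun q q' => M₀ (ρ q) (κ q')).det ≠ 0 ∧
    (∀ k < n, t k = 0 ∨ l ≤ k → ∃ w : ι → ℚ,
      (∀ c < W, M k c = M₀ k c - ∑ q, w q * M₀ (ρ q) c) ∧ ∀ q, M k (κ q) = 0) ∧
    (IsRowBasis n r M₀ t → ∀ k < n, k < l → t k ≠ 0 → ∃ q, ρ q = k)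

section Elimination

variable {n r W : ℕ} {M₀ M M' : ℕ → ℕ → ℚ} {t : ℕ → ℕ} {l : ℕ}

/-- An entry of a row from which a combination of pivot rows has been subtracted is a quotient of
determinants of submatrices of the original matrix. -/
theorem mul_det_eq_det_fromBlocks {ι : Type} [Fintype ι] [DecidableEq ι] {ρ κ : ι → ℕ}
    (hB : (Matrix.of fun q q' => M₀ (ρ q) (κ q')).det ≠ 0) {k c : ℕ} {w : ι → ℚ}
    (hz : ∀ q, M₀ k (κ q) = ∑ q', w q' * M₀ (ρ q') (κ q)) :
    (Matrix.of fun q q' => M₀ (ρ q) (κ q')).det * (M₀ k c - ∑ q, w q * M₀ (ρ q) c) =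
      (Matrix.fromBlocks (Matrix.of fun q q' => M₀ (ρ q) (κ q'))
        (Matrix.of fun q (_ : Unit) => M₀ (ρ q) c) (Matrix.of fun (_ : Unit) q => M₀ k (κ q))
        (Matrix.of fun (_ : Unit) (_ : Unit) => M₀ k c)).det := by
  set B : Matrix ι ι ℚ := Matrix.of fun q q' => M₀ (ρ q) (κ q') with hBdef
  have : Invertible B := Matrix.invertibleOfIsUnitDet B (isUnit_iff_ne_zero.2 hB)
  rw [Matrix.det_fromBlocks₁₁]
  congr 1
  have h1 : (Matrix.of fun (_ : Unit) q => M₀ k (κ q)) = (Matrix.of fun (_ : Unit) q => w q) * B := by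
    ext u q
    simp [Matrix.mul_apply, hBdef, hz]
  rw [h1, Matrix.mul_assoc _ B, mul_invOf_self, Matrix.mul_one]
  simp [Matrix.det_unique, Matrix.mul_apply]

theorem Elim.init : Elim n r W M₀ t 0 M₀ :=
  ⟨Empty, inferInstance, inferInstance, Empty.elim, Empty.elim, fun x => x.elim, fun x => x.elim,
    by simp, fun k _ _ => ⟨Empty.elim, by simp, fun x => x.elim⟩, fun _ k _ hk => by omega⟩

/-- Rows with `t l = 0` are not used as pivot rows. -/
theorem Elim.skip_of_eq_zero (h : Elim n r W M₀ t l M) (ht : t l = 0) :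
    Elim n r W M₀ t (l + 1) M := by
  obtain ⟨ι, i1, i2, ρ, κ, h1, h2, h3, h4, h5⟩ := h
  refine ⟨ι, i1, i2, ρ, κ, h1, fun q => ⟨(h2 q).1.trans (Nat.lt_succ_self l), (h2 q).2⟩, h3,
    fun k hk hkl => h4 k hk (hkl.imp id (by omega)), fun hb k hk hkl hkt => h5 hb k hk ?_ hkt⟩
  have : k ≠ l := by rintro rfl; exact hkt ht
  omega

/-- If a row is zero in the first `r` columns when it could become a pivot row, then the rows with
`t k ≠ 0` are dependent. -/
theorem Elim.skip_of_row_eq_zero (h : Elim n r W M₀ t l M) (hl : l < n) (hr : r ≤ W)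
    (ht : t l ≠ 0) (hM : ∀ i < r, M l i = 0) : Elim n r W M₀ t (l + 1) M := by
  classical
  obtain ⟨ι, i1, i2, ρ, κ, h1, h2, h3, h4, h5⟩ := h
  refine ⟨ι, i1, i2, ρ, κ, h1, fun q => ⟨(h2 q).1.trans (Nat.lt_succ_self l), (h2 q).2⟩, h3,
    fun k hk hkl => h4 k hk (hkl.imp id (by omega)), fun hb => ?_⟩
  exfalso
  obtain ⟨w, hw, -⟩ := h4 l hl (Or.inr le_rfl)
  let v : ℕ → ℚ := fun k => (if k = l then 1 else 0) - ∑ q, if k = ρ q then w q else 0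
  have hv : v l = 1 := by
    have : ∀ q, l ≠ ρ q := fun q => (h2 q).1.ne'
    simp [v, this]
  have hsum : ∀ g : ℕ → ℚ, ∑ k ∈ Finset.range n, v k * g k = g l - ∑ q, w q * g (ρ q) := by
    intro g
    simp only [v, sub_mul, Finset.sum_sub_distrib, Finset.sum_mul]
    rw [Finset.sum_comm]
    congr 1
    · simp [hl]
    · refine Finset.sum_congr rfl fun q _ => ?_
      simp [(h2 q).2.1]
  have := hb.indep v (fun k hk => ?_) (fun i hi => ?_) l hl
  · rw [hv] at this
    exact one_ne_zero this
  · have e1 : k ≠ l := by rintro rfl; exact ht hk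
    have e2 : ∀ q, k ≠ ρ q := by rintro q rfl; exact (h2 q).2.2.1 hk
    simp [v, e1, e2]
  · rw [hsum (fun k => M₀ k i), ← hw i (hi.trans_le hr), hM i hi]

/-- A row with a nonzero entry in the first `r` columns becomes a pivot row: a multiple of it is
subtracted from the other rows that are still in use. -/
theorem Elim.pivot (h : Elim n r W M₀ t l M) (hl : l < n) (hr : r ≤ W) (ht : t l ≠ 0) {i : ℕ}
    (hi : i < r) (hM : M l i ≠ 0)
    (hM' : ∀ k < n, t k = 0 ∨ l + 1 ≤ k → ∀ c < W, M' k c = M k c - M k i / M l i * M l c) :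
    Elim n r W M₀ t (l + 1) M' := by
  classical
  obtain ⟨ι, i1, i2, ρ, κ, h1, h2, h3, h4, h5⟩ := h
  obtain ⟨wl, hwl, hzl⟩ := h4 l hl (Or.inr le_rfl)
  refine ⟨ι ⊕ Unit, inferInstance, inferInstance, Sum.elim ρ fun _ => l, Sum.elim κ fun _ => i,
    ?_, ?_, ?_, ?_, ?_⟩
  · have := fun q => (h2 q).1.ne
    rintro (q | q) (q' | q') hq
    · exact congrArg _ (h1 hq)
    · exact absurd hq (this q)
    · exact absurd hq.symm (this q')
    · rfl
  · rintro (q | q)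
    · exact ⟨(h2 q).1.trans (Nat.lt_succ_self l), (h2 q).2⟩
    · exact ⟨Nat.lt_succ_self l, hl, ht, hi⟩
  · have := mul_det_eq_det_fromBlocks (k := l) (c := i) (w := wl) h3 fun q => by
      have e := hwl (κ q) ((h2 q).2.2.2.trans_le hr)
      rw [hzl q] at e
      linarith
    rw [← hwl i (hi.trans_le hr)] at this
    have e : (Matrix.of fun q q' => M₀ (Sum.elim ρ (fun _ : Unit => l) q)
        (Sum.elim κ (fun _ : Unit => i) q')) =
        Matrix.fromBlocks (Matrix.of fun q q' => M₀ (ρ q) (κ q'))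
        (Matrix.of fun q (_ : Unit) => M₀ (ρ q) i) (Matrix.of fun (_ : Unit) q => M₀ l (κ q))
        (Matrix.of fun (_ : Unit) (_ : Unit) => M₀ l i) := by
      ext (q | q) (q' | q') <;> rfl
    rw [e, ← this]
    exact mul_ne_zero h3 hM
  · intro k hk hkl
    obtain ⟨w, hw, hz⟩ := h4 k hk (hkl.imp id (by omega))
    refine ⟨Sum.elim (fun q => w q - M k i / M l i * wl q) fun _ => M k i / M l i, ?_, ?_⟩
    · intro c hc
      rw [hM' k hk hkl c hc, hw c hc, hwl c hc, Fintype.sum_sum_type]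
      simp only [Sum.elim_inl, Sum.elim_inr, Finset.univ_unique, Finset.sum_singleton, sub_mul,
        Finset.sum_sub_distrib, mul_assoc, ← Finset.mul_sum]
      ring
    · rintro (q | q)
      · simp only [Sum.elim_inl]
        rw [hM' k hk hkl _ ((h2 q).2.2.2.trans_le hr), hz q, hzl q]
        ring
      · simp only [Sum.elim_inr]
        rw [hM' k hk hkl _ (hi.trans_le hr), div_mul_cancel₀ _ hM, sub_self]
  · intro hb k hk hkl hkt
    by_cases hkl' : k = l
    · exact ⟨Sum.inr (), hkl'.symm⟩
    · obtain ⟨q, hq⟩ := h5 hb k hk (by omega) hkt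
      exact ⟨Sum.inl q, hq⟩

/-- The result of the elimination in a row that is not a pivot row. -/
theorem Elim.result (h : Elim n r W M₀ t n M) (hr : r ≤ W) {k : ℕ} (hk : k < n) (hkt : t k = 0) :
    ∃ w, SuppIn t w ∧
      (IsRowBasis n r M₀ t → ∀ i < r, M₀ k i = ∑ l ∈ Finset.range n, w l * M₀ l i) ∧
      ∀ c < W, M k c = M₀ k c - ∑ l ∈ Finset.range n, w l * M₀ l c := by
  classical
  obtain ⟨ι, i1, i2, ρ, κ, h1, h2, h3, h4, h5⟩ := h
  obtain ⟨w, hw, hz⟩ := h4 k hk (Or.inl hkt)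
  let v : ℕ → ℚ := fun k => ∑ q, if k = ρ q then w q else 0
  have hsum : ∀ g : ℕ → ℚ, ∑ k ∈ Finset.range n, v k * g k = ∑ q, w q * g (ρ q) := by
    intro g
    simp only [v, Finset.sum_mul]
    rw [Finset.sum_comm]
    refine Finset.sum_congr rfl fun q _ => ?_
    simp [(h2 q).2.1]
  have hv : SuppIn t v := by
    intro k hk
    have e2 : ∀ q, k ≠ ρ q := by rintro q rfl; exact (h2 q).2.2.1 hk
    simp [v, e2]
  have hMv : ∀ c < W, M k c = M₀ k c - ∑ l ∈ Finset.range n, v l * M₀ l c := by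
    intro c hc
    rw [hsum (fun l => M₀ l c), hw c hc]
  refine ⟨v, hv, fun hb => ?_, hMv⟩
  obtain ⟨u, hu, huk⟩ := hb.span k hk
  let y : ℕ → ℚ := fun l => u l - v l
  have hy : ∀ i < r, M k i = ∑ l ∈ Finset.range n, y l * M₀ l i := by
    intro i hi
    rw [hMv i (hi.trans_le hr), huk i hi, ← Finset.sum_sub_distrib]
    exact Finset.sum_congr rfl fun l _ => by simp only [y]; ring
  have hyρ : ∀ g : ℕ → ℚ, ∑ l ∈ Finset.range n, y l * g l = ∑ q, y (ρ q) * g (ρ q) := by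
    intro g
    refine Eq.trans ?_ (Finset.sum_map Finset.univ ⟨ρ, h1⟩ fun l => y l * g l)
    refine (Finset.sum_subset (fun l hl => ?_) fun l hl hl' => ?_).symm
    · obtain ⟨q, -, rfl⟩ := Finset.mem_map.1 hl
      exact Finset.mem_range.2 (h2 q).2.1
    · have : t l = 0 := by
        by_contra hne
        obtain ⟨q, hq⟩ := h5 hb l (Finset.mem_range.1 hl) (Finset.mem_range.1 hl) hne
        exact hl' (Finset.mem_map.2 ⟨q, Finset.mem_univ _, hq⟩)
      simp [y, hu l this, hv l this]
  have hy0 : (fun q => y (ρ q)) = 0 := by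
    refine Matrix.eq_zero_of_vecMul_eq_zero h3 (funext fun q => ?_)
    have e := hy (κ q) (h2 q).2.2.2
    rw [hz q, hyρ (fun l => M₀ l (κ q))] at e
    simpa [Matrix.vecMul, dotProduct] using e.symm
  intro i hi
  have e := hy i hi
  rw [hyρ (fun l => M₀ l i), Finset.sum_eq_zero fun q _ => by
    rw [show y (ρ q) = 0 from congrFun hy0 q, zero_mul]] at e
  have e' := hMv i (hi.trans_le hr)
  linarith

/-! ### Sizes of the numbers in the elimination -/

/-- `q` is a fraction with denominator `D` and numerator at most `A` in absolute value. -/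
def FracLe (D A : ℕ) (q : ℚ) : Prop := ∃ z : ℤ, q * D = z ∧ z.natAbs ≤ A

theorem FracLe.zero (D A : ℕ) : FracLe D A 0 := ⟨0, by simp, by simp⟩

theorem FracLe.mono {D A A' : ℕ} {q : ℚ} (h : FracLe D A q) (hA : A ≤ A') : FracLe D A' q := by
  obtain ⟨z, h1, h2⟩ := h
  exact ⟨z, h1, h2.trans hA⟩

theorem FracLe.mul {D A D' A' : ℕ} {x y : ℚ} (hx : FracLe D A x) (hy : FracLe D' A' y) :
    FracLe (D * D') (A * A') (x * y) := by
  obtain ⟨z, h1, h2⟩ := hx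
  obtain ⟨z', h3, h4⟩ := hy
  refine ⟨z * z', ?_, ?_⟩
  · push_cast
    rw [← h1, ← h3]; ring
  · rw [Int.natAbs_mul]
    exact Nat.mul_le_mul h2 h4

theorem FracLe.scale {D A : ℕ} {x : ℚ} (hx : FracLe D A x) (m : ℕ) : FracLe (D * m) (A * m) x := by
  simpa using hx.mul (show FracLe m m 1 from ⟨m, by simp, by simp⟩)

theorem FracLe.add {D A A' : ℕ} {x y : ℚ} (hx : FracLe D A x) (hy : FracLe D A' y) :
    FracLe D (A + A') (x + y) := by
  obtain ⟨z, h1, h2⟩ := hx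
  obtain ⟨z', h3, h4⟩ := hy
  refine ⟨z + z', ?_, (Int.natAbs_add_le _ _).trans (by omega)⟩
  push_cast
  rw [← h1, ← h3]; ring

theorem FracLe.sum {ι : Type*} (s : Finset ι) {D A : ℕ} {f : ι → ℚ}
    (h : ∀ i ∈ s, FracLe D A (f i)) : FracLe D (s.card * A) (∑ i ∈ s, f i) := by
  classical
  induction s using Finset.induction_on with
  | empty => simpa using FracLe.zero D 0
  | insert i s hi ih =>
    rw [Finset.sum_insert hi, Finset.card_insert_of_notMem hi, add_comm s.card, add_mul, one_mul]
    exact (h i (Finset.mem_insert_self i s)).add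
      (ih fun j hj => h j (Finset.mem_insert_of_mem hj))

theorem FracLe.ratSize_le {D A : ℕ} (hD : D ≠ 0) {x : ℚ} (hx : FracLe D A x) :
    ratSize x ≤ 1 + Nat.size A + Nat.size D := by
  obtain ⟨z, h1, h2⟩ := hx
  have hD' : (D : ℚ) ≠ 0 := by exact_mod_cast hD
  have hx : x = (z : ℚ) / ((D : ℤ) : ℚ) := by
    rw [← h1]; push_cast; field_simp
  have h3 := ratSize_div_le z D (by exact_mod_cast hD)
  rw [← hx, Int.natAbs_natCast] at h3
  have h4 := Nat.size_le_size h2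
  omega

theorem FracLe.det {ι : Type*} [Fintype ι] [DecidableEq ι] {D A : ℕ} {B : Matrix ι ι ℚ}
    (h : ∀ i j, FracLe D A (B i j)) :
    FracLe (D ^ Fintype.card ι) ((Fintype.card ι).factorial * A ^ Fintype.card ι) B.det := by
  choose z h1 h2 using h
  refine ⟨(Matrix.of z).det, ?_, ?_⟩
  · have : ((Matrix.of z).map (Int.castRingHom ℚ)) = (D : ℚ) • B := by
      ext i j
      simp [← h1, mul_comm]
    have e := RingHom.map_det (Int.castRingHom ℚ) (Matrix.of z)
    rw [RingHom.mapMatrix_apply, this, Matrix.det_smul] at e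
    simp only [eq_intCast] at e
    rw [e]; push_cast; ring
  · have := Matrix.det_le (A := Matrix.of z) (abv := AbsoluteValue.abs) (x := (A : ℤ)) fun i j => by
      have := h2 i j
      simp only [Matrix.of_apply, AbsoluteValue.abs_apply, Int.abs_eq_natAbs]
      omega
    simp only [AbsoluteValue.abs_apply, nsmul_eq_mul] at this
    zify
    simpa using this

/-- The size of a quotient of two fractions. -/
theorem ratSize_le_of_mul_eq {D D' A A' : ℕ} (hD : D ≠ 0) (hD' : D' ≠ 0) {x y z : ℚ}
    (hx : FracLe D A x) (hz : FracLe D' A' z) (hz0 : z ≠ 0) (h : z * y = x) :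
    ratSize y ≤ 1 + Nat.size (A * D') + Nat.size (D * A') := by
  obtain ⟨p, h1, h2⟩ := hx
  obtain ⟨q, h3, h4⟩ := hz
  have hD1 : (D : ℚ) ≠ 0 := by exact_mod_cast hD
  have hD2 : (D' : ℚ) ≠ 0 := by exact_mod_cast hD'
  have hq : (q : ℚ) ≠ 0 := by rw [← h3]; exact mul_ne_zero hz0 hD2
  have hq' : q ≠ 0 := by exact_mod_cast hq
  have hy : y = ((p * D' : ℤ) : ℚ) / ((D * q : ℤ) : ℚ) := by
    push_cast
    rw [← h1, ← h3, ← h]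
    field_simp
  have h5 := ratSize_div_le (p * D') (D * q) (mul_ne_zero (by exact_mod_cast hD) hq')
  rw [← hy, Int.natAbs_mul, Int.natAbs_mul, Int.natAbs_natCast, Int.natAbs_natCast] at h5
  have h6 := Nat.size_le_size (Nat.mul_le_mul_right D' h2)
  have h7 := Nat.size_le_size (Nat.mul_le_mul_left D h4)
  omega

theorem size_pow_succ_le (x n : ℕ) : Nat.size (x ^ (n + 1)) ≤ (n + 1) * Nat.size x := by
  induction n with
  | zero => simp
  | succ n ih =>
    rw [pow_succ]
    have := size_mul_le (x ^ (n + 1)) x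
    nlinarith

/-- All the numbers that occur in the elimination have polynomial size. -/
theorem Elim.ratSize_le (h : Elim n r W M₀ t l M) (hr : r ≤ W) {D A : ℕ} (hD : 1 ≤ D) (hA : 1 ≤ A)
    (hM₀ : ∀ k < n, ∀ c < W, FracLe D A (M₀ k c)) {k c : ℕ} (hk : k < n) (hkl : t k = 0 ∨ l ≤ k)
    (hc : c < W) :
    ratSize (M k c) ≤ 1 + 2 * ((n + 1) * (Nat.size (n + 1) + Nat.size D + Nat.size A)) := by
  obtain ⟨ι, i1, i2, ρ, κ, h1, h2, h3, h4, h5⟩ := h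
  obtain ⟨w, hw, hz⟩ := h4 k hk hkl
  have hcard : Fintype.card ι ≤ n := by
    simpa using Fintype.card_le_of_injective (fun q => (⟨ρ q, (h2 q).2.1⟩ : Fin n))
      fun q q' hq => h1 (by simpa using hq)
  have hκ : ∀ q, κ q < W := fun q => (h2 q).2.2.2.trans_le hr
  have hdet := mul_det_eq_det_fromBlocks (k := k) (c := c) (w := w) h3 fun q => by
    have e := hw (κ q) (hκ q)
    rw [hz q] at e
    linarith
  rw [← hw c hc] at hdet
  have b1 := FracLe.det (B := Matrix.of fun q q' => M₀ (ρ q) (κ q')) fun q q' =>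
    hM₀ _ (h2 q).2.1 _ (hκ q')
  have b2 := FracLe.det (D := D) (A := A) (B := Matrix.fromBlocks
    (Matrix.of fun q q' => M₀ (ρ q) (κ q'))
    (Matrix.of fun q (_ : Unit) => M₀ (ρ q) c) (Matrix.of fun (_ : Unit) q => M₀ k (κ q))
    (Matrix.of fun (_ : Unit) (_ : Unit) => M₀ k c)) (by
      rintro (q | q) (q' | q')
      · exact hM₀ _ (h2 q).2.1 _ (hκ q')
      · exact hM₀ _ (h2 q).2.1 _ hc
      · exact hM₀ _ hk _ (hκ q')
      · exact hM₀ _ hk _ hc)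
  rw [Fintype.card_sum, Fintype.card_unit] at b2
  set p := Fintype.card ι
  have h6 := ratSize_le_of_mul_eq (by positivity) (by positivity) b2 b1 h3 hdet
  have hfac : ∀ m ≤ n + 1, m.factorial ≤ (n + 1) ^ (n + 1) := fun m hm =>
    (Nat.factorial_le hm).trans (Nat.factorial_le_pow _)
  have hpw : ∀ x m, 1 ≤ x → m ≤ n + 1 → x ^ m ≤ x ^ (n + 1) := fun x m hx hm =>
    Nat.pow_le_pow_right hx hm
  have e1 : (p + 1).factorial * A ^ (p + 1) * D ^ p ≤
      (n + 1) ^ (n + 1) * A ^ (n + 1) * D ^ (n + 1) :=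
    Nat.mul_le_mul (Nat.mul_le_mul (hfac _ (by omega)) (hpw _ _ hA (by omega)))
      (hpw _ _ hD (by omega))
  have e2 : D ^ (p + 1) * (p.factorial * A ^ p) ≤
      D ^ (n + 1) * ((n + 1) ^ (n + 1) * A ^ (n + 1)) :=
    Nat.mul_le_mul (hpw _ _ hD (by omega))
      (Nat.mul_le_mul (hfac _ (by omega)) (hpw _ _ hA (by omega)))
  have e3 := Nat.size_le_size e1
  have e4 := Nat.size_le_size e2
  rw [mul_comm (D ^ (n + 1))] at e4
  have e5 := size_mul_le ((n + 1) ^ (n + 1) * A ^ (n + 1)) (D ^ (n + 1))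
  have e6 := size_mul_le ((n + 1) ^ (n + 1)) (A ^ (n + 1))
  have e7 := size_pow_succ_le (n + 1) n
  have e8 := size_pow_succ_le A n
  have e9 := size_pow_succ_le D n
  have e10 : (n + 1) * (Nat.size (n + 1) + Nat.size D + Nat.size A) =
    (n + 1) * Nat.size (n + 1) + (n + 1) * Nat.size D + (n + 1) * Nat.size A := by ring
  omega

end Elimination

/-! ### The layout of the memory

The arrays of natural numbers are, besides the input in the arrays `0`, `1`, `2`: array `3` with the
positions of the groups, array `4` with the relation `Q`, array `5` with the numbers `m j`, array `6`
with the ternary vectors of all groups, array `7` with the group of each position, and array `8` with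
the number of nonzero digits in each group. Cell `0` of the other arrays is used as a variable: `10`
for the number of variables; `11` for products, `12` for groups, `13`, `14`, `15` for rows and
columns, `16` for positions, `21` for the number of groups that have been treated; `17` and `18` for
the column of a pivot and whether there is one (`18` also in `productTables`); `19` for whether the
enumeration goes on; `20` for a sign; `23`, `24`, `25` for the size, the width of the matrix, and the
position of the current group.

The arrays of rational numbers are, besides the coefficients in array `0` and the output in array `1`:
array `2` with the products over the groups that have been treated, array `3` with the matrix of the
current group, row by row, and array `4` with the current solution. The variables are `5` for sums, `6`
for a factor in the elimination, and `7` for the best value so far. -/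

namespace Inst

/-- The position of the first variable of the group `j`. -/
def off (G : Inst) (j : ℕ) : ℕ := ∑ l ∈ Finset.range j, G.n l

/-- The total number of variables. -/
def N (G : Inst) : ℕ := G.off G.s

theorem off_succ (G : Inst) (j : ℕ) : G.off (j + 1) = G.off j + G.n j :=
  Finset.sum_range_succ _ _

theorem off_mono (G : Inst) : Monotone G.off := fun _ _ h =>
  Finset.sum_le_sum_of_subset (Finset.range_mono h)

theorem off_add_lt (G : Inst) {j k : ℕ} (hj : j < G.s) (hk : k < G.n j) :
    G.off j + k < G.N := by
  have h := G.off_mono (show j + 1 ≤ G.s from hj)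
  rw [off_succ] at h
  unfold N; omega

theorem n_le_N (G : Inst) {j : ℕ} (hj : j < G.s) : G.n j ≤ G.N := by
  have h := G.off_mono (show j + 1 ≤ G.s from hj)
  rw [off_succ] at h
  unfold N; omega

theorem off_add_inj (G : Inst) {j k j' k' : ℕ} (hk : k < G.n j) (hk' : k' < G.n j')
    (h : G.off j + k = G.off j' + k') : j = j' ∧ k = k' := by
  have h1 : ∀ {j k j' k' : ℕ}, k < G.n j → G.off j + k = G.off j' + k' → ¬ j < j' := by
    intro j k j' k' hk h hlt
    have h2 := G.off_mono (show j + 1 ≤ j' from hlt)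
    rw [off_succ] at h2
    omega
  have h3 : j = j' := by
    have := h1 hk h
    have := h1 hk' h.symm
    omega
  subst h3
  omega

theorem exists_off_add (G : Inst) {p : ℕ} (hp : p < G.N) :
    ∃ j k, j < G.s ∧ k < G.n j ∧ p = G.off j + k := by
  have key : ∀ s, p < G.off s → ∃ j k, j < s ∧ k < G.n j ∧ p = G.off j + k := by
    intro s
    induction s with
    | zero => intro h; simp [off] at h
    | succ s ih =>
      intro h
      by_cases h' : p < G.off s
      · obtain ⟨j, k, h1, h2, h3⟩ := ih h'
        exact ⟨j, k, by omega, h2, h3⟩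
      · rw [off_succ] at h
        exact ⟨s, p - G.off s, by omega, by omega, by omega⟩
  exact key _ hp

end Inst

/-- Cells of a matrix of width `W` that is stored row by row do not overlap. -/
theorem flat_inj {W k c k' c' : ℕ} (hc : c < W) (hc' : c' < W) (h : k * W + c = k' * W + c') :
    k = k' ∧ c = c' := by
  have h1 : (k * W + c) / W = k := by
    rw [mul_comm, Nat.mul_add_div (by omega), Nat.div_eq_of_lt hc, add_zero]
  have h2 : (k' * W + c') / W = k' := by
    rw [mul_comm, Nat.mul_add_div (by omega), Nat.div_eq_of_lt hc', add_zero]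
  have h3 : k = k' := by rw [← h1, ← h2, h]
  subst h3
  omega

/-- The memory holds the input. -/
structure Input (G : Inst) (σ : Mem) : Prop where
  s : σ.nat 0 0 = G.s
  r : σ.nat 0 1 = G.r
  n : ∀ j < G.s, σ.nat 1 j = G.n j
  inc : ∀ i < G.r, ∀ j < G.s, σ.nat 2 (i * G.s + j) = G.inc i j
  c : ∀ i < G.r, ∀ j < G.s, ∀ k < G.n j, σ.rat 0 (i * G.N + (G.off j + k)) = G.c i j k

/-- The memory holds the input and the tables that are computed once: the positions of the groups,
the relation `Q`, the numbers `m j`, the group of each variable, and the number of variables. -/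
structure Env (G : Inst) (σ : Mem) : Prop extends Input G σ where
  off : ∀ j < G.s, σ.nat 3 j = G.off j
  q : ∀ i < G.r, ∀ j < G.s, (σ.nat 4 (i * G.s + j) = 1 ↔ G.Q i j)
  m : ∀ j < G.s, σ.nat 5 j = G.m j
  grp : ∀ j < G.s, ∀ k < G.n j, σ.nat 7 (G.off j + k) = j
  N : σ.nat 10 0 = G.N

theorem Input.of_eq {G : Inst} {σ τ : Mem} (h : Input G σ)
    (hn : ∀ a ∈ [0, 1, 2], τ.nat a = σ.nat a) (hr : τ.rat 0 = σ.rat 0) : Input G τ where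
  s := by rw [hn 0 (by decide)]; exact h.s
  r := by rw [hn 0 (by decide)]; exact h.r
  n := by rw [hn 1 (by decide)]; exact h.n
  inc := by rw [hn 2 (by decide)]; exact h.inc
  c := by rw [hr]; exact h.c

theorem Env.of_eq {G : Inst} {σ τ : Mem} (h : Env G σ)
    (hn : ∀ a ∈ [0, 1, 2, 3, 4, 5, 7, 10], τ.nat a = σ.nat a) (hr : τ.rat 0 = σ.rat 0) :
    Env G τ where
  toInput := h.toInput.of_eq (fun a ha => hn a (by simp at ha ⊢; omega)) hr
  off := by rw [hn 3 (by decide)]; exact h.off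
  q := by rw [hn 4 (by decide)]; exact h.q
  m := by rw [hn 5 (by decide)]; exact h.m
  grp := by rw [hn 7 (by decide)]; exact h.grp
  N := by rw [hn 10 (by decide)]; exact h.N

theorem Env.frame {G : Inst} {σ τ : Mem} {p : Prog} (h : Env G σ) (hF : Frame p σ τ)
    (hn : ∀ a ∈ [0, 1, 2, 3, 4, 5, 7, 10], a ∉ p.natW) (hr : 0 ∉ p.ratW) : Env G τ :=
  h.of_eq (fun a ha => hF.nat a (hn a ha)) (hF.rat 0 hr)

/-- The values of the variables in the memory. -/
def xOf (G : Inst) (σ : Mem) (j k : ℕ) : ℚ := σ.rat 4 (G.off j + k)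

/-- The ternary vectors in the memory. -/
def tOf (G : Inst) (σ : Mem) (j k : ℕ) : ℕ :=
  if j < G.s ∧ k < G.n j then σ.nat 6 (G.off j + k) else 0

/-- Bounds for the numbers that occur: `K` for the number of repetitions of a loop, `E` and `F` for
the denominators and numerators of the rational numbers before the elimination, `b` for the number
of bits of all memory cells. -/
structure Bounds (G : Inst) (b K E F : ℕ) : Prop where
  s_le : G.s ≤ G.N
  K_le : G.N + G.r + 1 ≤ K
  le_b : K ≤ b
  one_le_E : 1 ≤ E
  E_le_F : E ≤ F
  bits : 2 * (1 + 2 * ((K + 1) * (Nat.size (K + 1) + Nat.size E + Nat.size F))) ≤ b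
  entry : ∀ i < G.r, ∀ j < G.s, ∀ k < G.n j, FracLe E F (G.c i j k)
  fac : ∀ x, G.Binary x → ∀ i < G.r, ∀ j < G.s, ∀ k ≤ G.n j,
    FracLe E F (∑ k' ∈ Finset.range k, G.c i j k' * x j k')
  gam : ∀ x, G.Binary x → ∀ i < G.r, ∀ j ≤ G.s, FracLe E F (G.gam x j i)
  term : ∀ x, G.Binary x → ∀ j < G.s, ∀ k < G.n j, ∀ (p : ℕ → Prop) [DecidablePred p], ∀ i ≤ G.r,
    FracLe E F (∑ i' ∈ Finset.range i, if p i' then 0 else G.gam x (j + 1) i' * G.c i' j k)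
  obj : ∀ x, G.Binary x → ∀ i ≤ G.r, FracLe E F (∑ i' ∈ Finset.range i, G.gam x 0 i')

namespace Bounds

variable {G : Inst} {b K E F : ℕ}

theorem one_le_F (h : Bounds G b K E F) : 1 ≤ F := h.one_le_E.trans h.E_le_F

theorem one_le_b (h : Bounds G b K E F) : 1 ≤ b := by
  have := h.K_le; have := h.le_b; omega

theorem three_le_b (h : Bounds G b K E F) : 3 ≤ b := by
  have := h.bits
  have h1 : 1 ≤ Nat.size (K + 1) := Nat.size_pos.2 (by omega)
  nlinarith

theorem size_le (h : Bounds G b K E F) {x : ℕ} (hx : x ≤ K) : Nat.size x ≤ b :=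
  (size_le_self x).trans (hx.trans h.le_b)

theorem ratSize_le (h : Bounds G b K E F) {x : ℚ} (hx : FracLe E F x) : ratSize x ≤ b := by
  have h1 := hx.ratSize_le (by have := h.one_le_E; omega)
  have h2 := h.bits
  nlinarith

theorem zero_le (h : Bounds G b K E F) : ratSize 0 ≤ b := by
  rw [ratSize_zero]; have := h.three_le_b; omega

theorem one_le (h : Bounds G b K E F) : ratSize 1 ≤ b := by
  rw [ratSize_one]; exact h.three_le_b

end Bounds

/-! ### The matrix of a group -/

/-- The scalar variable that is kept in cell `0` of the array `a`. -/
abbrev gv (a : ℕ) : NExpr := .get a (.lit 0)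

/-- The scalar variable that is kept in cell `0` of the array `a`. -/
abbrev rv (a : ℕ) : RExpr := .get a (.lit 0)

/-- The number of products. -/
abbrev rE : NExpr := .get 0 (.lit 1)

/-- The index of the cell `(i, j)` of the incidence matrix. -/
abbrev incAt : NExpr := .add (.mul (gv 11) (.get 0 (.lit 0))) (gv 12)

/-- The index of the coefficient of the product `i` and the variable `k` of the current group. -/
abbrev coefAt : NExpr := .add (.mul (gv 11) (gv 10)) (.add (gv 25) (gv 13))

/-- The index of the cell in row `e` and column `f` of the matrix. -/
abbrev matAt (e f : NExpr) : NExpr := .add (.mul e (gv 24)) f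

/-- Sets all products to the empty product. -/
def initGam : Prog := .forTo 11 rE (.setRat 2 (gv 11) (.lit 1))

/-- The columns with the coefficients of products that involve earlier groups. -/
def buildLin : Prog :=
  .forTo 11 rE (.ite (.natEq (.get 4 incAt) (.lit 1))
    (.setRat 3 (matAt (gv 13) (gv 11)) (.get 0 coefAt))
    (.setRat 3 (matAt (gv 13) (gv 11)) (.lit 0)))

/-- The coefficient with the other products. -/
def buildConst : Prog :=
  .seq (.setRat 5 (.lit 0) (.lit 0))
    (.forTo 11 rE (.ite (.natEq (.get 4 incAt) (.lit 1)) .skip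
      (.setRat 5 (.lit 0) (.add (rv 5) (.mul (.get 2 (gv 11)) (.get 0 coefAt))))))

/-- The row of the identity matrix. -/
def buildUnit : Prog :=
  .forTo 14 (gv 23) (.ite (.natEq (gv 14) (gv 13))
    (.setRat 3 (matAt (gv 13) (.add (.add rE (.lit 1)) (gv 14))) (.lit 1))
    (.setRat 3 (matAt (gv 13) (.add (.add rE (.lit 1)) (gv 14))) (.lit 0)))

/-- Writes the matrix `tableau` of the current group. -/
def buildMat : Prog :=
  .forTo 13 (gv 23) (.seq buildLin (.seq buildConst
    (.seq (.setRat 3 (matAt (gv 13) rE) (rv 5)) buildUnit)))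

/-- The memory is prepared for the treatment of the group `j`: besides the tables, it holds the
number `j`, the size of the group, the width of the matrix, and the position of the group. -/
structure Level (G : Inst) (j : ℕ) (σ : Mem) : Prop extends Env G σ where
  hj : j < G.s
  jv : σ.nat 12 0 = j
  nj : σ.nat 23 0 = G.n j
  W : σ.nat 24 0 = G.r + 1 + G.n j
  o : σ.nat 25 0 = G.off j

theorem Level.frame {G : Inst} {j : ℕ} {σ τ : Mem} {p : Prog} (h : Level G j σ) (hF : Frame p σ τ)
    (hn : ∀ a ∈ [0, 1, 2, 3, 4, 5, 7, 10, 12, 23, 24, 25], a ∉ p.natW) (hr : 0 ∉ p.ratW) :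
    Level G j τ where
  toEnv := h.toEnv.frame hF (fun a ha => hn a (by simp at ha ⊢; omega)) hr
  hj := h.hj
  jv := by rw [hF.nat 12 (hn 12 (by decide))]; exact h.jv
  nj := by rw [hF.nat 23 (hn 23 (by decide))]; exact h.nj
  W := by rw [hF.nat 24 (hn 24 (by decide))]; exact h.W
  o := by rw [hF.nat 25 (hn 25 (by decide))]; exact h.o

section Specs

variable {G : Inst} {b K E F : ℕ} {σ : Mem} {Q : Mem → Prop}

theorem wp_initGam (hB : Bounds G b K E F) (hσ : Bdd b σ) (he : Env G σ) :
    wp b K initGam σ fun τ => ∀ i < G.r, τ.rat 2 i = 1 := by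
  refine wp_for hB.one_le_b hσ G.r (by have := hB.K_le; omega) hB.le_b (by decide)
    (fun k τ => ∀ i < k, τ.rat 2 i = 1) ?_ (by simp) ?_ (fun τ _ _ _ h => h)
  · intro τ hF
    simp [NExpr.eval, hF.nat 0 (by decide), he.r]
  · intro k hk τ hτ hF hv hI
    refine wp_setRat hB.one_le_b hτ (by simp [RExpr.DivOk]) hB.one_le ?_
    intro _ _ _ _ i hi
    simp only [NExpr.eval, RExpr.eval, hv, Mem.writeNat_rat, Mem.writeRat_rat_self]
    by_cases h : i = k
    · simp [h]
    · simpa [h] using hI i (by omega)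

/-- The first `c` cells of row `k` and all cells of the rows before row `k` agree with `M₀`. -/
def Filled (M₀ : ℕ → ℕ → ℚ) (W k c : ℕ) (σ : Mem) : Prop :=
  (∀ k' < k, ∀ c' < W, σ.rat 3 (k' * W + c') = M₀ k' c') ∧
    ∀ c' < c, σ.rat 3 (k * W + c') = M₀ k c'

theorem Filled.of_eq {M₀ : ℕ → ℕ → ℚ} {W k c : ℕ} {σ τ : Mem} (h : Filled M₀ W k c σ)
    (he : τ.rat 3 = σ.rat 3) : Filled M₀ W k c τ := by
  unfold Filled; rw [he]; exact h

theorem Filled.write {M₀ : ℕ → ℕ → ℚ} {W k c : ℕ} {σ τ : Mem} (h : Filled M₀ W k c σ) (hc : c < W)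
    (he : τ.rat 3 = Function.update (σ.rat 3) (k * W + c) (M₀ k c)) : Filled M₀ W k (c + 1) τ := by
  constructor
  · intro k' hk' c' hc'
    rw [he, Function.update_of_ne, h.1 k' hk' c' hc']
    intro h'
    have := (flat_inj hc' hc h').1
    omega
  · intro c' hc'
    rw [he]
    by_cases h' : c' = c
    · subst h'; simp
    · rw [Function.update_of_ne (by omega), h.2 c' (by omega)]

theorem Filled.next {M₀ : ℕ → ℕ → ℚ} {W k : ℕ} {σ : Mem} (h : Filled M₀ W k W σ) :
    Filled M₀ W (k + 1) 0 σ := by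
  refine ⟨fun k' hk' c' hc' => ?_, fun c' hc' => by omega⟩
  by_cases h' : k' = k
  · subst h'; exact h.2 c' hc'
  · exact h.1 k' (by omega) c' hc'

theorem wp_buildLin (hB : Bounds G b K E F) (hσ : Bdd b σ) {j k : ℕ} (hl : Level G j σ)
    (hk : k < G.n j) (hkv : σ.nat 13 0 = k) {d : ℕ → ℚ}
    (hf : Filled (tableau G.r (G.linPart j) d) (G.r + 1 + G.n j) k 0 σ) :
    wp b K buildLin σ fun τ =>
      Filled (tableau G.r (G.linPart j) d) (G.r + 1 + G.n j) k G.r τ := by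
  refine wp_for hB.one_le_b hσ G.r (by have := hB.K_le; omega) hB.le_b (by decide)
    (fun i τ => Filled (tableau G.r (G.linPart j) d) (G.r + 1 + G.n j) k i τ) ?_
    (hf.of_eq (by simp)) ?_ (fun τ _ _ _ h => h)
  · intro τ hF
    simp [NExpr.eval, hF.nat 0 (by decide), hl.r]
  · intro i hi τ hτ hF hv hI
    have hl' : Level G j τ := hl.frame hF (by decide) (by decide)
    have hk' : τ.nat 13 0 = k := by rw [hF.nat 13 (by decide), hkv]
    have hq := hl'.q i hi j hl.hj
    have hc := hl'.c i hi j hl.hj k hk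
    refine wp_ite hB.one_le_b hτ (by simp [Test.DivOk]) (fun h => ?_) (fun h => ?_)
    · simp only [Test.Holds, NExpr.eval, hv, hl'.s, hl'.jv, hq] at h
      refine wp_setRat hB.one_le_b hτ (by simp [RExpr.DivOk]) ?_ ?_
      · simp only [RExpr.eval, NExpr.eval, hv, hl'.N, hl'.o, hk', hc]
        exact hB.ratSize_le (hB.entry i hi j hl.hj k hk)
      · intro _ _ _ _
        refine hI.write (by omega) ?_
        simp [RExpr.eval, NExpr.eval, hv, hl'.N, hl'.o, hk', hc, hl'.W, tableau, hi, Inst.linPart, h]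
    · simp only [Test.Holds, NExpr.eval, hv, hl'.s, hl'.jv, hq] at h
      refine wp_setRat hB.one_le_b hτ (by simp [RExpr.DivOk]) hB.zero_le ?_
      intro _ _ _ _
      refine hI.write (by omega) ?_
      simp [RExpr.eval, NExpr.eval, hv, hk', hl'.W, tableau, hi, Inst.linPart, h]

theorem wp_buildConst (hB : Bounds G b K E F) (hσ : Bdd b σ) {j k : ℕ} (hl : Level G j σ)
    (hk : k < G.n j) (hkv : σ.nat 13 0 = k) {x : ℕ → ℕ → ℚ} (hx : G.Binary x)
    (hg : ∀ i < G.r, σ.rat 2 i = G.gam x (j + 1) i) :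
    wp b K buildConst σ fun τ => τ.rat 5 0 = G.constPart x j k := by
  classical
  refine wp_seq (wp_setRat hB.one_le_b hσ (by simp [RExpr.DivOk]) hB.zero_le ?_)
  intro hσ₁ hF₁
  set σ₁ := σ.writeRat 5 (NExpr.eval σ (.lit 0)) (RExpr.eval σ (.lit 0)) with hσ₁def
  have hl₁ : Level G j σ₁ := hl.frame hF₁ (by decide) (by decide)
  refine wp_for hB.one_le_b hσ₁ G.r (by have := hB.K_le; omega) hB.le_b (by decide)
    (fun i τ => τ.rat 5 0 = ∑ i' ∈ Finset.range i,
      if G.Q i' j then 0 else G.gam x (j + 1) i' * G.c i' j k) ?_ ?_ ?_ (fun τ _ _ _ h => h)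
  · intro τ hF
    simp [NExpr.eval, hF.nat 0 (by decide), hl₁.r]
  · simp [hσ₁def, NExpr.eval, RExpr.eval]
  · intro i hi τ hτ hF hv hI
    have hl' : Level G j τ := hl₁.frame hF (by decide) (by decide)
    have hk' : τ.nat 13 0 = k := by
      rw [hF.nat 13 (by decide), hF₁.nat 13 (by decide), hkv]
    have hq := hl'.q i hi j hl.hj
    have hc := hl'.c i hi j hl.hj k hk
    have hg' : τ.rat 2 i = G.gam x (j + 1) i := by
      rw [hF.rat 2 (by decide), hF₁.rat 2 (by decide), hg i hi]
    refine wp_ite hB.one_le_b hτ (by simp [Test.DivOk]) (fun h => ?_) (fun h => ?_)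
    · simp only [Test.Holds, NExpr.eval, hv, hl'.s, hl'.jv, hq] at h
      refine wp_skip hτ fun _ _ _ _ => ?_
      rw [Finset.sum_range_succ, if_pos h, add_zero]
      exact hI
    · simp only [Test.Holds, NExpr.eval, hv, hl'.s, hl'.jv, hq] at h
      have hval : RExpr.eval τ (.add (rv 5) (.mul (.get 2 (gv 11)) (.get 0 coefAt))) =
          ∑ i' ∈ Finset.range (i + 1),
            if G.Q i' j then 0 else G.gam x (j + 1) i' * G.c i' j k := by
        rw [Finset.sum_range_succ, if_neg h, ← hI]
        simp only [RExpr.eval, NExpr.eval, hv, hl'.N, hl'.o, hk', hc, hg']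
      refine wp_setRat hB.one_le_b hτ (by simp [RExpr.DivOk]) ?_ ?_
      · rw [hval]
        exact hB.ratSize_le (hB.term x hx j hl.hj k hk _ (i + 1) hi)
      · intro _ _ _ _
        rw [hval]
        simp [NExpr.eval]

theorem wp_buildUnit (hB : Bounds G b K E F) (hσ : Bdd b σ) {j k : ℕ} (hl : Level G j σ)
    (hkv : σ.nat 13 0 = k) {a : ℕ → ℕ → ℚ} {d : ℕ → ℚ}
    (hf : Filled (tableau G.r a d) (G.r + 1 + G.n j) k (G.r + 1) σ) :
    wp b K buildUnit σ fun τ =>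
      Filled (tableau G.r a d) (G.r + 1 + G.n j) k (G.r + 1 + G.n j) τ := by
  have hnN := G.n_le_N hl.hj
  refine wp_for hB.one_le_b hσ (G.n j) (by have := hB.K_le; omega) hB.le_b (by decide)
    (fun i τ => Filled (tableau G.r a d) (G.r + 1 + G.n j) k (G.r + 1 + i) τ) ?_
    (hf.of_eq (by simp)) ?_ (fun τ _ _ _ h => h)
  · intro τ hF
    simp [NExpr.eval, hF.nat 23 (by decide), hl.nj]
  · intro i hi τ hτ hF hv hI
    have hl' : Level G j τ := hl.frame hF (by decide) (by decide)
    have hk' : τ.nat 13 0 = k := by rw [hF.nat 13 (by decide), hkv]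
    refine wp_ite hB.one_le_b hτ (by simp [Test.DivOk]) (fun h => ?_) (fun h => ?_)
    · simp only [Test.Holds, NExpr.eval, hv, hk'] at h
      refine wp_setRat hB.one_le_b hτ (by simp [RExpr.DivOk]) hB.one_le ?_
      intro _ _ _ _
      refine hI.write (by omega) ?_
      simp [RExpr.eval, NExpr.eval, hv, hk', hl'.W, hl'.r, tableau, h, add_assoc]
    · simp only [Test.Holds, NExpr.eval, hv, hk'] at h
      refine wp_setRat hB.one_le_b hτ (by simp [RExpr.DivOk]) hB.zero_le ?_
      intro _ _ _ _
      refine hI.write (by omega) ?_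
      simp [RExpr.eval, NExpr.eval, hv, hk', hl'.W, hl'.r, tableau, h, add_assoc]

theorem wp_buildMat (hB : Bounds G b K E F) (hσ : Bdd b σ) {j : ℕ} (hl : Level G j σ)
    {x : ℕ → ℕ → ℚ} (hx : G.Binary x) (hg : ∀ i < G.r, σ.rat 2 i = G.gam x (j + 1) i) :
    wp b K buildMat σ fun τ => ∀ k < G.n j, ∀ c < G.r + 1 + G.n j,
      τ.rat 3 (k * (G.r + 1 + G.n j) + c) = tableau G.r (G.linPart j) (G.constPart x j) k c := by
  have hnN := G.n_le_N hl.hj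
  refine wp_for hB.one_le_b hσ (G.n j) (by have := hB.K_le; omega) hB.le_b (by decide)
    (fun k τ => Filled (tableau G.r (G.linPart j) (G.constPart x j)) (G.r + 1 + G.n j) k 0 τ) ?_
    ⟨by simp, by simp⟩ ?_ (fun τ _ _ _ h => h.1)
  · intro τ hF
    simp [NExpr.eval, hF.nat 23 (by decide), hl.nj]
  · intro k hk τ hτ hF hv hI
    have hl' : Level G j τ := hl.frame hF (by decide) (by decide)
    have hg' : ∀ i < G.r, τ.rat 2 i = G.gam x (j + 1) i := by
      rw [hF.rat 2 (by decide)]; exact hg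
    refine wp_seq ((wp_buildLin hB hτ hl' hk hv hI).imp ?_)
    intro τ₁ hτ₁ hF₁ hI₁ _ _
    have hl₁ : Level G j τ₁ := hl'.frame hF₁ (by decide) (by decide)
    have hv₁ : τ₁.nat 13 0 = k := by rw [hF₁.nat 13 (by decide), hv]
    refine wp_seq ((wp_buildConst hB hτ₁ hl₁ hk hv₁ hx
      (by rw [hF₁.rat 2 (by decide)]; exact hg')).imp ?_)
    intro τ₂ hτ₂ hF₂ hI₂ _ _
    have hl₂ : Level G j τ₂ := hl₁.frame hF₂ (by decide) (by decide)
    have hv₂ : τ₂.nat 13 0 = k := by rw [hF₂.nat 13 (by decide), hv₁]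
    refine wp_seq (wp_setRat hB.one_le_b hτ₂ (by simp [RExpr.DivOk]) (hτ₂.rat _ _) ?_)
    intro hτ₃ hF₃
    refine (wp_buildUnit hB hτ₃ (hl₂.frame hF₃ (by decide) (by decide)) (k := k)
      (by rw [hF₃.nat 13 (by decide), hv₂])
      (Filled.write (hI₁.of_eq (hF₂.rat 3 (by decide))) (by omega) ?_)).imp ?_
    · simp [RExpr.eval, NExpr.eval, hv₂, hl₂.W, hl₂.r, hI₂, tableau]
    · intro τ₄ _ _ h _ _ _ _
      exact (h.next).of_eq (by simp)

end Specs

/-! ### Elimination and rounding in a group -/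

/-- The entry of the matrix in row `e` and column `f`. -/
abbrev matE (e f : NExpr) : RExpr := .get 3 (matAt e f)

/-- The entry of the ternary vector that belongs to the variable `e` of the current group. -/
abbrev tE (e : NExpr) : NExpr := .get 6 (.add (gv 25) e)

/-- Looks for a nonzero entry in row `l` among the columns that are used for pivots. -/
def findPivot : Prog :=
  .seq (.setNat 18 (.lit 0) (.lit 0))
    (.forTo 11 rE (.ite (.ratEq (matE (gv 14) (gv 11)) (.lit 0)) .skip
      (.seq (.setNat 18 (.lit 0) (.lit 1)) (.setNat 17 (.lit 0) (gv 11)))))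

/-- Subtracts a multiple of row `l` from row `k`. -/
def elimRow : Prog :=
  .seq (.setRat 6 (.lit 0) (.div (matE (gv 13) (gv 17)) (matE (gv 14) (gv 17))))
    (.forTo 15 (gv 24) (.setRat 3 (matAt (gv 13) (gv 15))
      (.sub (matE (gv 13) (gv 15)) (.mul (rv 6) (matE (gv 14) (gv 15))))))

/-- Subtracts multiples of the pivot row `l` from the rows that are still in use: those with zero
entry in the ternary vector and those after row `l`. -/
def elimRows : Prog :=
  .forTo 13 (gv 23) (.ite (.and (.not (.natLt (gv 14) (gv 13))) (.not (.natEq (tE (gv 13)) (.lit 0))))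
    .skip elimRow)

/-- The Gaussian elimination with the rows that have a nonzero entry in the ternary vector. -/
def elimMat : Prog :=
  .forTo 14 (gv 23) (.ite (.natEq (tE (gv 14)) (.lit 0)) .skip
    (.seq findPivot (.ite (.natEq (gv 18) (.lit 1)) elimRows .skip)))

/-- Computes the sign of the first nonzero entry of row `k` from column `r` on. -/
def lexSign : Prog :=
  .seq (.setNat 20 (.lit 0) (.lit 0))
    (.forTo 15 (.add (gv 23) (.lit 1)) (.ite (.natEq (gv 20) (.lit 0))
      (.ite (.ratLt (.lit 0) (matE (gv 13) (.add rE (gv 15)))) (.setNat 20 (.lit 0) (.lit 1))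
        (.ite (.ratLt (matE (gv 13) (.add rE (gv 15))) (.lit 0)) (.setNat 20 (.lit 0) (.lit 2)) .skip))
      .skip))

/-- Sets the variable `k` of the current group: by the ternary vector if its entry is not zero, and
otherwise by the sign of the rest of row `k`. -/
def roundVar : Prog :=
  .ite (.natEq (tE (gv 13)) (.lit 0))
    (.seq lexSign (.ite (.natEq (gv 20) (.lit 1)) (.setRat 4 (.add (gv 25) (gv 13)) (.lit 1))
      (.setRat 4 (.add (gv 25) (gv 13)) (.lit 0))))
    (.ite (.natEq (tE (gv 13)) (.lit 2)) (.setRat 4 (.add (gv 25) (gv 13)) (.lit 1))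
      (.setRat 4 (.add (gv 25) (gv 13)) (.lit 0)))

/-- Sets the variables of the current group. -/
def roundGroup : Prog := .forTo 13 (gv 23) roundVar

/-- Multiplies the products by the factors that belong to the current group. -/
def updateGam : Prog :=
  .forTo 11 rE (.ite (.natEq (.get 2 incAt) (.lit 1))
    (.seq (.setRat 5 (.lit 0) (.lit 0))
      (.seq (.forTo 13 (gv 23) (.setRat 5 (.lit 0)
          (.add (rv 5) (.mul (.get 0 coefAt) (.get 4 (.add (gv 25) (gv 13)))))))
        (.setRat 2 (gv 11) (.mul (.get 2 (gv 11)) (rv 5)))))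
    .skip)

/-- Makes the last group that has not been treated the current group. -/
def setLevel : Prog :=
  .seq (.setNat 12 (.lit 0) (.sub (.sub (.get 0 (.lit 0)) (.lit 1)) (gv 21)))
    (.seq (.setNat 23 (.lit 0) (.get 1 (gv 12)))
      (.seq (.setNat 24 (.lit 0) (.add (.add rE (.lit 1)) (gv 23)))
        (.setNat 25 (.lit 0) (.get 3 (gv 12)))))

/-- Treats one group. -/
def groupStep : Prog :=
  .seq setLevel (.seq buildMat (.seq elimMat (.seq roundGroup updateGam)))

/-- Computes the roundings that belong to the ternary vectors in the memory, and the products. -/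
def evalChoice : Prog := .seq initGam (.forTo 21 (.get 0 (.lit 0)) groupStep)

/-- The matrix in the memory, with rows of width `W`. -/
def matOf (W : ℕ) (σ : Mem) (k c : ℕ) : ℚ := σ.rat 3 (k * W + c)

section Specs

variable {G : Inst} {b K E F : ℕ} {σ : Mem} {Q : Mem → Prop}

theorem wp_findPivot (hB : Bounds G b K E F) (hσ : Bdd b σ) {j l : ℕ} (hl : Level G j σ)
    (hlv : σ.nat 14 0 = l) :
    wp b K findPivot σ fun τ =>
      (τ.nat 18 0 = 1 ∧ τ.nat 17 0 < G.r ∧ matOf (G.r + 1 + G.n j) σ l (τ.nat 17 0) ≠ 0) ∨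
      (τ.nat 18 0 ≠ 1 ∧ ∀ i < G.r, matOf (G.r + 1 + G.n j) σ l i = 0) := by
  have hb := hB.one_le_b
  refine wp_seq (wp_setNat hb hσ (by simp [NExpr.eval]) ?_)
  intro hσ₁ hF₁
  have hl₁ := hl.frame hF₁ (by decide) (by decide)
  refine wp_for hb hσ₁ G.r (by have := hB.K_le; omega) hB.le_b (by decide)
    (fun i' τ =>
      (τ.nat 18 0 = 1 ∧ τ.nat 17 0 < G.r ∧ matOf (G.r + 1 + G.n j) σ l (τ.nat 17 0) ≠ 0) ∨
      (τ.nat 18 0 ≠ 1 ∧ ∀ i < i', matOf (G.r + 1 + G.n j) σ l i = 0)) ?_ ?_ ?_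
      (fun τ _ _ _ h => h)
  · intro τ hF
    simp [NExpr.eval, hF.nat 0 (by decide), hl.r]
  · right
    simp [NExpr.eval]
  · intro i hi τ hτ hF hv hI
    have hl' : Level G j τ := hl₁.frame hF (by decide) (by decide)
    have hlv' : τ.nat 14 0 = l := by rw [hF.nat 14 (by decide), hF₁.nat 14 (by decide), hlv]
    have hM : RExpr.eval τ (matE (gv 14) (gv 11)) = matOf (G.r + 1 + G.n j) σ l i := by
      simp [RExpr.eval, NExpr.eval, hlv', hv, hl'.W, hF.rat 3 (by decide), matOf]
    refine wp_ite hb hτ (by simp [Test.DivOk, RExpr.DivOk]) (fun h => ?_) (fun h => ?_)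
    · simp only [Test.Holds, hM] at h
      refine wp_skip hτ fun _ _ _ _ => ?_
      refine hI.imp (by simp) fun ⟨h1, h2⟩ => ⟨by simpa using h1, fun i' hi' => ?_⟩
      by_cases e : i' = i
      · rw [e, h]; simp [RExpr.eval]
      · exact h2 i' (by omega)
    · simp only [Test.Holds, hM] at h
      refine wp_seq (wp_setNat hb hτ (by simpa [NExpr.eval] using hb) fun hτ₁ _ => ?_)
      refine wp_setNat hb hτ₁ (hτ₁.nat _ _) fun _ _ _ _ => ?_
      left
      simp only [NExpr.eval]
      simp [hv, hi]
      simpa [RExpr.eval] using h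

theorem wp_elimRow (hB : Bounds G b K E F) (hσ : Bdd b σ) {j k l p : ℕ} (hl : Level G j σ)
    (hkv : σ.nat 13 0 = k) (hlv : σ.nat 14 0 = l) (hpv : σ.nat 17 0 = p) (hkl : k ≠ l)
    (hp : p < G.r) {M : ℕ → ℕ → ℚ} (hM : ∀ c < G.r + 1 + G.n j,
      matOf (G.r + 1 + G.n j) σ k c = M k c ∧ matOf (G.r + 1 + G.n j) σ l c = M l c)
    (hne : M l p ≠ 0) (hs : ratSize (M k p / M l p) ≤ b)
    (hs' : ∀ c < G.r + 1 + G.n j, ratSize (M k c - M k p / M l p * M l c) ≤ b) :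
    wp b K elimRow σ fun τ =>
      (∀ c < G.r + 1 + G.n j, matOf (G.r + 1 + G.n j) τ k c = M k c - M k p / M l p * M l c) ∧
      ∀ k' ≠ k, ∀ c < G.r + 1 + G.n j,
        matOf (G.r + 1 + G.n j) τ k' c = matOf (G.r + 1 + G.n j) σ k' c := by
  have hb := hB.one_le_b
  have hnN := G.n_le_N hl.hj
  have hp1 := (hM p (by omega)).1
  have hp2 := (hM p (by omega)).2
  simp only [matOf] at hp1 hp2
  have hval : RExpr.eval σ (.div (matE (gv 13) (gv 17)) (matE (gv 14) (gv 17))) =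
      M k p / M l p := by
    simp [RExpr.eval, NExpr.eval, hkv, hlv, hpv, hl.W, hp1, hp2]
  refine wp_seq (wp_setRat hb hσ ?_ (by rw [hval]; exact hs) ?_)
  · simp [RExpr.DivOk, RExpr.eval, NExpr.eval, hlv, hpv, hl.W, hp2, hne]
  rw [hval]
  intro hσ₁ hF₁
  set σ₁ := σ.writeRat 6 (NExpr.eval σ (.lit 0)) (M k p / M l p) with hσ₁def
  have hl₁ : Level G j σ₁ := hl.frame hF₁ (by decide) (by decide)
  have hf₁ : σ₁.rat 6 0 = M k p / M l p := by simp [hσ₁def, NExpr.eval]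
  refine wp_for hb hσ₁ (G.r + 1 + G.n j) (by have := hB.K_le; omega) hB.le_b (by decide)
    (fun c' τ => τ.rat 6 0 = M k p / M l p ∧
      (∀ c < c', c < G.r + 1 + G.n j →
        matOf (G.r + 1 + G.n j) τ k c = M k c - M k p / M l p * M l c) ∧
      (∀ c, c' ≤ c → c < G.r + 1 + G.n j → matOf (G.r + 1 + G.n j) τ k c = M k c) ∧
      ∀ k' ≠ k, ∀ c < G.r + 1 + G.n j,
        matOf (G.r + 1 + G.n j) τ k' c = matOf (G.r + 1 + G.n j) σ k' c) ?_ ?_ ?_ ?_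
  · intro τ hF
    simp [NExpr.eval, hF.nat 24 (by decide), hl₁.W]
  · refine ⟨by simpa using hf₁, by simp, fun c _ hc => ?_, fun k' _ c hc => ?_⟩
    · rw [← (hM c hc).1]; simp [matOf, hσ₁def]
    · simp [matOf, hσ₁def]
  · rintro c hc τ hτ hF hv ⟨h0, h1, h2, h3⟩
    have hl' : Level G j τ := hl₁.frame hF (by decide) (by decide)
    have hkv' : τ.nat 13 0 = k := by rw [hF.nat 13 (by decide), hF₁.nat 13 (by decide), hkv]
    have hlv' : τ.nat 14 0 = l := by rw [hF.nat 14 (by decide), hF₁.nat 14 (by decide), hlv]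
    have e1 := h2 c le_rfl hc
    have e2 := (h3 l hkl.symm c hc).trans (hM c hc).2
    simp only [matOf] at e1 e2
    have hval : RExpr.eval τ (.sub (matE (gv 13) (gv 15)) (.mul (rv 6) (matE (gv 14) (gv 15)))) =
        M k c - M k p / M l p * M l c := by
      simp [RExpr.eval, NExpr.eval, hkv', hlv', hv, hl'.W, e1, e2, h0]
    refine wp_setRat hb hτ (by simp [RExpr.DivOk]) (by rw [hval]; exact hs' c hc) ?_
    rw [hval]
    intro _ _ _ _
    have haddr : NExpr.eval τ (matAt (gv 13) (gv 15)) = k * (G.r + 1 + G.n j) + c := by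
      simp [NExpr.eval, hkv', hv, hl'.W]
    rw [haddr]
    refine ⟨by simpa using h0, fun c'' hc'' hc3 => ?_, fun c'' hc'' hc3 => ?_, fun k' hk' c'' hc'' => ?_⟩
    · by_cases e : c'' = c
      · subst e; simp [matOf]
      · have := h1 c'' (by omega) hc3
        simpa [matOf, e] using this
    · have := h2 c'' (by omega) hc3
      simpa [matOf, show c'' ≠ c by omega] using this
    · have e : k' * (G.r + 1 + G.n j) + c'' ≠ k * (G.r + 1 + G.n j) + c := fun e =>
        hk' (flat_inj hc'' hc e).1
      have := h3 k' hk' c'' hc''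
      simpa [matOf, e] using this
  · rintro τ _ _ _ ⟨-, h1, -, h3⟩
    exact ⟨fun c hc => h1 c hc hc, h3⟩

theorem Bounds.elim_le (hB : Bounds G b K E F) {j l : ℕ} (hj : j < G.s) {M₀ M : ℕ → ℕ → ℚ}
    {t : ℕ → ℕ} (h : Elim (G.n j) G.r (G.r + 1 + G.n j) M₀ t l M)
    (hM₀ : ∀ k < G.n j, ∀ c < G.r + 1 + G.n j, FracLe E F (M₀ k c)) {k c : ℕ} (hk : k < G.n j)
    (hkl : t k = 0 ∨ l ≤ k) (hc : c < G.r + 1 + G.n j) : 2 * ratSize (M k c) ≤ b := by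
  have h1 := h.ratSize_le (by omega) hB.one_le_E hB.one_le_F hM₀ hk hkl hc
  have h2 := hB.bits
  have h3 : G.n j ≤ K := by have := hB.K_le; have := G.n_le_N hj; omega
  have h4 : Nat.size (G.n j + 1) ≤ Nat.size (K + 1) := Nat.size_le_size (by omega)
  have h5 : (G.n j + 1) * (Nat.size (G.n j + 1) + Nat.size E + Nat.size F) ≤
      (K + 1) * (Nat.size (K + 1) + Nat.size E + Nat.size F) :=
    Nat.mul_le_mul (by omega) (by omega)
  omega

theorem wp_elimRows (hB : Bounds G b K E F) (hσ : Bdd b σ) {j l p : ℕ} (hl : Level G j σ)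
    (hlv : σ.nat 14 0 = l) (hln : l < G.n j) (hpv : σ.nat 17 0 = p) (hp : p < G.r)
    {M₀ : ℕ → ℕ → ℚ} {t : ℕ → ℕ} (ht : ∀ k < G.n j, σ.nat 6 (G.off j + k) = t k) (htl : t l ≠ 0)
    (hne : matOf (G.r + 1 + G.n j) σ l p ≠ 0)
    (hM₀ : ∀ k < G.n j, ∀ c < G.r + 1 + G.n j, FracLe E F (M₀ k c))
    (he : Elim (G.n j) G.r (G.r + 1 + G.n j) M₀ t l (matOf (G.r + 1 + G.n j) σ)) :
    wp b K elimRows σ fun τ =>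
      Elim (G.n j) G.r (G.r + 1 + G.n j) M₀ t (l + 1) (matOf (G.r + 1 + G.n j) τ) := by
  have hb := hB.one_le_b
  have hnN := G.n_le_N hl.hj
  set W := G.r + 1 + G.n j with hW
  set M := matOf W σ with hM
  refine wp_for hb hσ (G.n j) (by have := hB.K_le; omega) hB.le_b (by decide)
    (fun k' τ => (∀ k < k', t k = 0 ∨ l + 1 ≤ k → ∀ c < W,
        matOf W τ k c = M k c - M k p / M l p * M l c) ∧
      ∀ k, k' ≤ k ∨ k = l → ∀ c < W, matOf W τ k c = M k c) ?_ ?_ ?_ ?_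
  · intro τ hF
    simp [NExpr.eval, hF.nat 23 (by decide), hl.nj]
  · exact ⟨by simp, fun k _ c _ => by simp [matOf, hM]⟩
  · rintro k hk τ hτ hF hv ⟨h1, h2⟩
    have hl' : Level G j τ := hl.frame hF (by decide) (by decide)
    have hlv' : τ.nat 14 0 = l := by rw [hF.nat 14 (by decide), hlv]
    have hpv' : τ.nat 17 0 = p := by rw [hF.nat 17 (by decide), hpv]
    have htk : τ.nat 6 (G.off j + k) = t k := by rw [hF.nat 6 (by decide), ht k hk]
    refine wp_ite hb hτ (by simp [Test.DivOk]) (fun h => ?_) (fun h => ?_)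
    · simp only [Test.Holds, NExpr.eval, hlv', hv, hl'.o, htk] at h
      refine wp_skip hτ fun _ _ _ _ => ?_
      refine ⟨fun k' hk' hk'' c hc => ?_, fun k' hk' c hc => ?_⟩
      · have : k' ≠ k := by rintro rfl; omega
        simpa [matOf] using h1 k' (by omega) hk'' c hc
      · simpa [matOf] using h2 k' (by omega) c hc
    · simp only [Test.Holds, NExpr.eval, hlv', hv, hl'.o, htk] at h
      have hkl : k ≠ l := by rintro rfl; exact h ⟨lt_irrefl _, htl⟩
      have hk' : t k = 0 ∨ l + 1 ≤ k := by omega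
      have hsz : ∀ c < W, 2 * ratSize (M k c) ≤ b := fun c hc =>
        hB.elim_le hl.hj he hM₀ hk (by omega) hc
      have hsl : ∀ c < W, 2 * ratSize (M l c) ≤ b := fun c hc =>
        hB.elim_le hl.hj he hM₀ hln (by omega) hc
      have hE := he.pivot (M' := fun k c => M k c - M k p / M l p * M l c) hln (by omega) htl hp hne
        (fun _ _ _ _ _ => rfl)
      refine (wp_elimRow hB hτ hl' hv hlv' hpv' hkl hp (M := M)
        (fun c hc => ⟨h2 k (by omega) c hc, h2 l (by omega) c hc⟩) hne ?_ ?_).imp ?_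
      · have h3 := hsz p (by omega)
        have h4 := hsl p (by omega)
        have := ratSize_div_le_add (M k p) (M l p)
        omega
      · intro c hc
        have := hB.elim_le hl.hj hE hM₀ hk hk' hc
        omega
      · rintro τ' - - ⟨h3, h4⟩ _ _ _ _
        refine ⟨fun k' hk1 hk2 c hc => ?_, fun k' hk1 c hc => ?_⟩
        · by_cases e : k' = k
          · subst e; simpa [matOf] using h3 c hc
          · have := (h4 k' e c hc).trans (h1 k' (by omega) hk2 c hc)
            simpa [matOf] using this
        · have := (h4 k' (by omega) c hc).trans (h2 k' (by omega) c hc)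
          simpa [matOf] using this
  · rintro τ _ _ _ ⟨h1, -⟩
    exact he.pivot hln (by omega) htl hp hne fun k hk hk' c hc => h1 k hk hk' c hc

theorem Elim.congr {n r W : ℕ} {M₀ M M' : ℕ → ℕ → ℚ} {t : ℕ → ℕ} {l : ℕ} (h : Elim n r W M₀ t l M)
    (hr : r ≤ W) (hM : ∀ k < n, ∀ c < W, M' k c = M k c) : Elim n r W M₀ t l M' := by
  obtain ⟨ι, i1, i2, ρ, κ, h1, h2, h3, h4, h5⟩ := h
  refine ⟨ι, i1, i2, ρ, κ, h1, h2, h3, fun k hk hkl => ?_, h5⟩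
  obtain ⟨w, hw, hz⟩ := h4 k hk hkl
  exact ⟨w, fun c hc => by rw [hM k hk c hc, hw c hc],
    fun q => by rw [hM k hk _ ((h2 q).2.2.2.trans_le hr), hz q]⟩

theorem wp_elimMat (hB : Bounds G b K E F) (hσ : Bdd b σ) {j : ℕ} (hl : Level G j σ)
    {M₀ : ℕ → ℕ → ℚ} {t : ℕ → ℕ} (ht : ∀ k < G.n j, σ.nat 6 (G.off j + k) = t k)
    (hM₀ : ∀ k < G.n j, ∀ c < G.r + 1 + G.n j, FracLe E F (M₀ k c))
    (hM : ∀ k < G.n j, ∀ c < G.r + 1 + G.n j, σ.rat 3 (k * (G.r + 1 + G.n j) + c) = M₀ k c) :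
    wp b K elimMat σ fun τ =>
      Elim (G.n j) G.r (G.r + 1 + G.n j) M₀ t (G.n j) (matOf (G.r + 1 + G.n j) τ) := by
  have hb := hB.one_le_b
  have hnN := G.n_le_N hl.hj
  refine wp_for hb hσ (G.n j) (by have := hB.K_le; omega) hB.le_b (by decide)
    (fun l τ => Elim (G.n j) G.r (G.r + 1 + G.n j) M₀ t l (matOf (G.r + 1 + G.n j) τ)) ?_ ?_ ?_
    (fun τ _ _ _ h => h)
  · intro τ hF
    simp [NExpr.eval, hF.nat 23 (by decide), hl.nj]
  · exact Elim.init.congr (by omega) fun k hk c hc => by simpa [matOf] using hM k hk c hc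
  · intro l hln τ hτ hF hv hI
    have hl' : Level G j τ := hl.frame hF (by decide) (by decide)
    have ht' : ∀ k < G.n j, τ.nat 6 (G.off j + k) = t k := by
      rw [hF.nat 6 (by decide)]; exact ht
    refine wp_ite hb hτ (by simp [Test.DivOk]) (fun h => ?_) (fun h => ?_)
    · simp only [Test.Holds, NExpr.eval, hv, hl'.o, ht' l hln] at h
      exact wp_skip hτ fun _ _ _ _ => hI.skip_of_eq_zero h
    · simp only [Test.Holds, NExpr.eval, hv, hl'.o, ht' l hln] at h
      refine wp_seq ((wp_findPivot hB hτ hl' hv).imp fun τ₁ hτ₁ hF₁ h₁ _ _ => ?_)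
      have hl₁ : Level G j τ₁ := hl'.frame hF₁ (by decide) (by decide)
      have hM₁ : matOf (G.r + 1 + G.n j) τ₁ = matOf (G.r + 1 + G.n j) τ := by
        unfold matOf; rw [hF₁.rat 3 (by decide)]
      refine wp_ite hb hτ₁ (by simp [Test.DivOk]) (fun h' => ?_) (fun h' => ?_)
      · simp only [Test.Holds, NExpr.eval] at h'
        obtain ⟨-, h2, h3⟩ := h₁.resolve_right fun h => h.1 h'
        refine (wp_elimRows hB hτ₁ hl₁ (by rw [hF₁.nat 14 (by decide), hv]) hln rfl h2
          (by rw [hF₁.nat 6 (by decide)]; exact ht') h (by rwa [hM₁]) hM₀ (by rwa [hM₁])).imp ?_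
        intro τ₂ _ _ h4 _ _ _ _
        exact h4
      · simp only [Test.Holds, NExpr.eval] at h'
        have h2 := (h₁.resolve_left fun h => h' h.1).2
        refine wp_skip hτ₁ fun _ _ _ _ => ?_
        have := hI.skip_of_row_eq_zero hln (by omega) h h2
        rw [← hM₁] at this
        exact this

theorem wp_lexSign (hB : Bounds G b K E F) (hσ : Bdd b σ) {j k : ℕ} (hl : Level G j σ)
    (hkv : σ.nat 13 0 = k) :
    wp b K lexSign σ fun τ =>
      (τ.nat 20 0 = 1 ↔ LexPos (G.n j + 1) fun c => matOf (G.r + 1 + G.n j) σ k (G.r + c)) := by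
  have hb := hB.one_le_b
  have hnN := G.n_le_N hl.hj
  set g : ℕ → ℚ := fun c => matOf (G.r + 1 + G.n j) σ k (G.r + c) with hg
  refine wp_seq (wp_setNat hb hσ (by simp [NExpr.eval]) ?_)
  intro hσ₁ hF₁
  have hl₁ := hl.frame hF₁ (by decide) (by decide)
  refine wp_for hb hσ₁ (G.n j + 1) (by have := hB.K_le; omega) hB.le_b (by decide)
    (fun c τ => (τ.nat 20 0 = 0 ∧ ∀ c' < c, g c' = 0) ∨ (τ.nat 20 0 = 1 ∧ LexPos c g) ∨
      (τ.nat 20 0 = 2 ∧ ∃ c' < c, g c' < 0 ∧ ∀ c'' < c', g c'' = 0)) ?_ ?_ ?_ ?_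
  · intro τ hF
    simp [NExpr.eval, hF.nat 23 (by decide), hl.nj]
  · left; simp [NExpr.eval]
  · intro c hc τ hτ hF hv hI
    have hl' : Level G j τ := hl₁.frame hF (by decide) (by decide)
    have hkv' : τ.nat 13 0 = k := by rw [hF.nat 13 (by decide), hF₁.nat 13 (by decide), hkv]
    have hM : RExpr.eval τ (matE (gv 13) (.add rE (gv 15))) = g c := by
      simp [RExpr.eval, NExpr.eval, hkv', hv, hl'.W, hl'.r, hF.rat 3 (by decide), matOf, hg]
    refine wp_ite hb hτ (by simp [Test.DivOk]) (fun h => ?_) (fun h => ?_)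
    · simp only [Test.Holds, NExpr.eval] at h
      have hI : ∀ c' < c, g c' = 0 := by
        rcases hI with h1 | h1 | h1
        · exact h1.2
        · omega
        · omega
      refine wp_ite hb hτ (by simp [Test.DivOk, RExpr.DivOk]) (fun h1 => ?_) (fun h1 => ?_)
      · rw [Test.Holds, hM, RExpr.eval] at h1
        refine wp_setNat hb hτ (by simpa [NExpr.eval] using hb) fun _ _ _ _ => ?_
        right; left
        exact ⟨by simp [NExpr.eval], c, by omega, h1, hI⟩
      · rw [Test.Holds, hM, RExpr.eval] at h1
        refine wp_ite hb hτ (by simp [Test.DivOk, RExpr.DivOk]) (fun h2 => ?_) (fun h2 => ?_)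
        · rw [Test.Holds, hM, RExpr.eval] at h2
          refine wp_setNat hb hτ (hB.size_le (by
            simp only [NExpr.eval]; have := hB.K_le; have := hB.s_le; have := hl.hj; omega))
            fun _ _ _ _ => ?_
          right; right
          exact ⟨by simp [NExpr.eval], c, by omega, h2, hI⟩
        · rw [Test.Holds, hM, RExpr.eval] at h2
          refine wp_skip hτ fun _ _ _ _ => ?_
          left
          refine ⟨by simpa using h, fun c' hc' => ?_⟩
          by_cases e : c' = c
          · subst e; exact le_antisymm (not_lt.1 h1) (not_lt.1 h2)
          · exact hI c' (by omega)
    · simp only [Test.Holds, NExpr.eval] at h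
      refine wp_skip hτ fun _ _ _ _ => ?_
      rcases hI with h1 | ⟨h1, c', h2, h3⟩ | ⟨h1, c', h2, h3⟩
      · omega
      · right; left; exact ⟨by simpa using h1, c', by omega, h3⟩
      · right; right; exact ⟨by simpa using h1, c', by omega, h3⟩
  · intro τ _ _ _ hI
    rcases hI with ⟨h1, h2⟩ | ⟨h1, h2⟩ | ⟨h1, c, hc, h2, h3⟩
    · refine ⟨by omega, ?_⟩
      rintro ⟨c, hc, h3, -⟩
      rw [h2 c hc] at h3
      exact absurd h3 (lt_irrefl _)
    · exact ⟨fun _ => h2, fun _ => h1⟩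
    · refine ⟨by omega, ?_⟩
      rintro ⟨c', hc', h4, h5⟩
      rcases lt_trichotomy c c' with e | e | e
      · rw [h5 c e] at h2; exact absurd h2 (lt_irrefl _)
      · subst e; linarith
      · rw [h3 c' e] at h4; exact absurd h4 (lt_irrefl _)

theorem wp_roundVar (hB : Bounds G b K E F) (hσ : Bdd b σ) {j k : ℕ} (hl : Level G j σ)
    (hkv : σ.nat 13 0 = k) :
    wp b K roundVar σ fun τ => ∃ v : ℚ, τ.rat 4 = Function.update (σ.rat 4) (G.off j + k) v ∧
      (v = 0 ∨ v = 1) ∧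
      (σ.nat 6 (G.off j + k) = 1 → v = 0) ∧ (σ.nat 6 (G.off j + k) = 2 → v = 1) ∧
      (σ.nat 6 (G.off j + k) = 0 →
        (LexPos (G.n j + 1) (fun c => matOf (G.r + 1 + G.n j) σ k (G.r + c)) → v = 1) ∧
        (¬ LexPos (G.n j + 1) (fun c => matOf (G.r + 1 + G.n j) σ k (G.r + c)) → v = 0)) := by
  have hb := hB.one_le_b
  have hx : ∀ τ, Bdd b τ → Level G j τ → τ.nat 13 0 = k → ∀ v : ℚ, ratSize v ≤ b → ∀ Q : Mem → Prop,
      Q (τ.writeRat 4 (G.off j + k) v) →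
      wp b K (.setRat 4 (.add (gv 25) (gv 13)) (.lit v)) τ Q := by
    intro τ hτ hl' hk' v hv Q hQ
    refine wp_setRat hb hτ (by simp [RExpr.DivOk]) hv ?_
    simpa [NExpr.eval, RExpr.eval, hl'.o, hk'] using hQ
  refine wp_ite hb hσ (by simp [Test.DivOk]) (fun h => ?_) (fun h => ?_)
  · simp only [Test.Holds, NExpr.eval, hkv, hl.o] at h
    refine wp_seq ((wp_lexSign hB hσ hl hkv).imp fun τ₁ hτ₁ hF₁ h₁ _ _ => ?_)
    have hl₁ : Level G j τ₁ := hl.frame hF₁ (by decide) (by decide)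
    have hk₁ : τ₁.nat 13 0 = k := by rw [hF₁.nat 13 (by decide), hkv]
    have hx₁ : τ₁.rat 4 = σ.rat 4 := hF₁.rat 4 (by decide)
    refine wp_ite hb hτ₁ (by simp [Test.DivOk]) (fun h' => ?_) (fun h' => ?_)
    · simp only [Test.Holds, NExpr.eval, h₁] at h'
      refine hx τ₁ hτ₁ hl₁ hk₁ 1 hB.one_le _ ⟨1, by simp [hx₁], Or.inr rfl, by omega, by omega, ?_⟩
      exact fun _ => ⟨fun _ => rfl, fun h'' => absurd h' h''⟩
    · simp only [Test.Holds, NExpr.eval, h₁] at h'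
      refine hx τ₁ hτ₁ hl₁ hk₁ 0 hB.zero_le _ ⟨0, by simp [hx₁], Or.inl rfl, by omega, by omega, ?_⟩
      exact fun _ => ⟨fun h'' => absurd h'' h', fun _ => rfl⟩
  · simp only [Test.Holds, NExpr.eval, hkv, hl.o] at h
    refine wp_ite hb hσ (by simp [Test.DivOk]) (fun h' => ?_) (fun h' => ?_)
    · simp only [Test.Holds, NExpr.eval, hkv, hl.o] at h'
      exact hx σ hσ hl hkv 1 hB.one_le _ ⟨1, by simp, Or.inr rfl, by omega, by simp, by omega⟩
    · simp only [Test.Holds, NExpr.eval, hkv, hl.o] at h'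
      exact hx σ hσ hl hkv 0 hB.zero_le _ ⟨0, by simp, Or.inl rfl, by simp, by omega, by omega⟩

theorem wp_roundGroup (hB : Bounds G b K E F) (hσ : Bdd b σ) {j : ℕ} (hl : Level G j σ)
    (hbin : ∀ p, σ.rat 4 p = 0 ∨ σ.rat 4 p = 1) {M₀ : ℕ → ℕ → ℚ} {t : ℕ → ℕ}
    (ht : ∀ k < G.n j, σ.nat 6 (G.off j + k) = t k)
    (he : Elim (G.n j) G.r (G.r + 1 + G.n j) M₀ t (G.n j) (matOf (G.r + 1 + G.n j) σ)) :
    wp b K roundGroup σ fun τ => (∀ p, τ.rat 4 p = 0 ∨ τ.rat 4 p = 1) ∧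
      (∀ p, p < G.off j ∨ G.off (j + 1) ≤ p → τ.rat 4 p = σ.rat 4 p) ∧
      Rounds (G.n j) G.r M₀ t (xOf G τ j) := by
  have hb := hB.one_le_b
  have hnN := G.n_le_N hl.hj
  set W := G.r + 1 + G.n j with hW
  let S : ℕ → ℚ → Prop := fun k v =>
    (t k = 1 → v = 0) ∧ (t k = 2 → v = 1) ∧
      (t k = 0 → (LexPos (G.n j + 1) (fun c => matOf W σ k (G.r + c)) → v = 1) ∧
        (¬ LexPos (G.n j + 1) (fun c => matOf W σ k (G.r + c)) → v = 0))
  refine wp_for hb hσ (G.n j) (by have := hB.K_le; omega) hB.le_b (by decide)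
    (fun k' τ => (∀ p, τ.rat 4 p = 0 ∨ τ.rat 4 p = 1) ∧
      (∀ p, p < G.off j ∨ G.off j + k' ≤ p → τ.rat 4 p = σ.rat 4 p) ∧
      ∀ k < k', S k (τ.rat 4 (G.off j + k))) ?_ ?_ ?_ ?_
  · intro τ hF
    simp [NExpr.eval, hF.nat 23 (by decide), hl.nj]
  · exact ⟨by simpa using hbin, by simp, by simp⟩
  · rintro k hk τ hτ hF hv ⟨h1, h2, h3⟩
    have hl' : Level G j τ := hl.frame hF (by decide) (by decide)
    have htk : τ.nat 6 (G.off j + k) = t k := by rw [hF.nat 6 (by decide), ht k hk]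
    have hM : matOf W τ = matOf W σ := by unfold matOf; rw [hF.rat 3 (by decide)]
    refine (wp_roundVar hB hτ hl' hv).imp ?_
    rintro τ₁ _ _ ⟨v, e, hv01, hv1, hv2, hv0⟩ _ _ _ _
    rw [htk] at hv1 hv2 hv0
    rw [← hW, hM] at hv0
    simp only [Mem.writeNat_rat, e]
    refine ⟨fun p => ?_, fun p hp => ?_, fun k' hk' => ?_⟩
    · by_cases hp : p = G.off j + k
      · simpa [hp] using hv01
      · simpa [hp] using h1 p
    · rw [Function.update_of_ne (by omega)]
      exact h2 p (by omega)
    · by_cases hkk : k' = k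
      · subst hkk
        rw [Function.update_self]
        exact ⟨hv1, hv2, hv0⟩
      · rw [Function.update_of_ne (by omega)]
        exact h3 k' (by omega)
  · rintro τ _ _ _ ⟨h1, h2, h3⟩
    refine ⟨h1, fun p hp => h2 p (by rwa [G.off_succ] at hp), fun k hk => ?_⟩
    obtain ⟨h4, h5, h6⟩ := h3 k hk
    refine ⟨h4, h5, fun htk => ?_⟩
    obtain ⟨w, hw, hw', hwM⟩ := he.result (by omega) hk htk
    obtain ⟨h7, h8⟩ := h6 htk
    have e : ∀ c < G.n j + 1, matOf W σ k (G.r + c) =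
        M₀ k (G.r + c) - ∑ l ∈ Finset.range (G.n j), w l * M₀ l (G.r + c) := fun c hc =>
      hwM (G.r + c) (by omega)
    have hcong : LexPos (G.n j + 1) (fun c => matOf W σ k (G.r + c)) ↔ LexPos (G.n j + 1)
        (fun c => M₀ k (G.r + c) - ∑ l ∈ Finset.range (G.n j), w l * M₀ l (G.r + c)) :=
      ⟨LexPos.congr e, LexPos.congr fun c hc => (e c hc).symm⟩
    exact ⟨w, hw, hw', fun h => h7 (hcong.2 h), fun h => h8 fun h' => h (hcong.1 h')⟩

theorem xOf_binary (hbin : ∀ p, σ.rat 4 p = 0 ∨ σ.rat 4 p = 1) : G.Binary (xOf G σ) :=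
  fun _ _ _ _ => hbin _

theorem wp_updateGam (hB : Bounds G b K E F) (hσ : Bdd b σ) {j : ℕ} (hl : Level G j σ)
    (hbin : ∀ p, σ.rat 4 p = 0 ∨ σ.rat 4 p = 1)
    (hg : ∀ i < G.r, σ.rat 2 i = G.gam (xOf G σ) (j + 1) i) :
    wp b K updateGam σ fun τ => ∀ i < G.r, τ.rat 2 i = G.gam (xOf G σ) j i := by
  have hb := hB.one_le_b
  have hnN := G.n_le_N hl.hj
  have hx : G.Binary (xOf G σ) := xOf_binary hbin
  refine wp_for hb hσ G.r (by have := hB.K_le; omega) hB.le_b (by decide)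
    (fun i' τ => (∀ i < i', τ.rat 2 i = G.gam (xOf G σ) j i) ∧
      ∀ i, i' ≤ i → i < G.r → τ.rat 2 i = G.gam (xOf G σ) (j + 1) i) ?_ ?_ ?_
      (fun τ _ _ _ h => h.1)
  · intro τ hF
    simp [NExpr.eval, hF.nat 0 (by decide), hl.r]
  · exact ⟨by simp, fun i _ hi => by simpa using hg i hi⟩
  · rintro i hi τ hτ hF hv ⟨h1, h2⟩
    have hl' : Level G j τ := hl.frame hF (by decide) (by decide)
    have hinc := hl'.inc i hi j hl.hj
    refine wp_ite hb hτ (by simp [Test.DivOk]) (fun h => ?_) (fun h => ?_)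
    · simp only [Test.Holds, NExpr.eval, hv, hl'.s, hl'.jv, hinc] at h
      refine wp_seq (wp_setRat hb hτ (by simp [RExpr.DivOk]) hB.zero_le fun hτ₁ hF₁ => ?_)
      have hl₁ := hl'.frame hF₁ (by decide) (by decide)
      have hfac : ∑ k' ∈ Finset.range (G.n j), G.c i j k' * xOf G σ j k' = G.fac (xOf G σ) i j := by
        rw [Inst.fac, if_pos h]
      refine wp_seq (wp_for hb hτ₁ (G.n j) (by have := hB.K_le; omega) hB.le_b (by decide)
        (fun k τ' => τ'.rat 5 0 = ∑ k' ∈ Finset.range k, G.c i j k' * xOf G σ j k') ?_ ?_ ?_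
        (fun τ₂ hτ₂ hF₂ hv₂ hI _ hF₂' => ?_))
      · intro τ' hF'
        simp [NExpr.eval, hF'.nat 23 (by decide), hl'.nj]
      · simp [NExpr.eval, RExpr.eval]
      · intro k hk τ' hτ' hF' hv' hI
        have hl'' : Level G j τ' := hl₁.frame hF' (by decide) (by decide)
        have hiv : τ'.nat 11 0 = i := by
          rw [hF'.nat 11 (by decide), hF₁.nat 11 (by decide), hv]
        have hc := hl''.c i hi j hl.hj k hk
        have hxk : τ'.rat 4 (G.off j + k) = xOf G σ j k := by
          rw [hF'.rat 4 (by decide), hF₁.rat 4 (by decide), hF.rat 4 (by decide)]; rfl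
        have hval : RExpr.eval τ' (.add (rv 5) (.mul (.get 0 coefAt) (.get 4 (.add (gv 25) (gv 13)))))
            = ∑ k' ∈ Finset.range (k + 1), G.c i j k' * xOf G σ j k' := by
          rw [Finset.sum_range_succ, ← hI]
          simp only [RExpr.eval, NExpr.eval, hiv, hv', hl''.N, hl''.o, hc, hxk]
        refine wp_setRat hb hτ' (by simp [RExpr.DivOk]) ?_ ?_
        · rw [hval]
          exact hB.ratSize_le (hB.fac _ hx i hi j hl.hj (k + 1) hk)
        · rw [hval]
          intro _ _ _ _
          simp [NExpr.eval]
      · have hiv : τ₂.nat 11 0 = i := by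
          rw [hF₂.nat 11 (by decide), hF₁.nat 11 (by decide), hv]
        have hg₂ : τ₂.rat 2 = τ.rat 2 := by
          rw [hF₂.rat 2 (by decide), hF₁.rat 2 (by decide)]
        have hval : RExpr.eval τ₂ (.mul (.get 2 (gv 11)) (rv 5)) = G.gam (xOf G σ) j i := by
          rw [Inst.gam_step _ hl.hj, ← hfac, ← hI]
          simp only [RExpr.eval, NExpr.eval, hiv, hg₂, h2 i le_rfl hi]
          ring
        refine wp_setRat hb hτ₂ (by simp [RExpr.DivOk]) ?_ ?_
        · rw [hval]
          exact hB.ratSize_le (hB.gam _ hx i hi j hl.hj.le)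
        · rw [hval]
          intro _ _ _ _
          simp only [NExpr.eval, hiv, Mem.writeNat_rat, Mem.writeRat_rat_self, hg₂]
          refine ⟨fun i' hi' => ?_, fun i' hi' hi'' => ?_⟩
          · by_cases e : i' = i
            · simp [e]
            · simpa [e] using h1 i' (by omega)
          · rw [Function.update_of_ne (by omega)]
            exact h2 i' (by omega) hi''
    · simp only [Test.Holds, NExpr.eval, hv, hl'.s, hl'.jv, hinc] at h
      refine wp_skip hτ fun _ _ _ _ => ⟨fun i' hi' => ?_, fun i' hi' hi'' => ?_⟩
      · by_cases e : i' = i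
        · subst e
          rw [Inst.gam_step _ hl.hj, Inst.fac, if_neg h, one_mul]
          exact h2 i' le_rfl hi
        · exact h1 i' (by omega)
      · exact h2 i' (by omega) hi''

end Specs

/-! ### The value of a choice, and the best solution so far -/

/-- Computes the value of the solution in the memory from the values of the products. -/
def sumObj : Prog :=
  .seq (.setRat 5 (.lit 0) (.lit 0))
    (.forTo 11 rE (.setRat 5 (.lit 0) (.add (rv 5) (.get 2 (gv 11)))))

/-- Replaces the best solution so far by the current solution, if the latter is better. -/
def keepBest : Prog :=
  .ite (.ratLt (rv 7) (rv 5))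
    (.seq (.setRat 7 (.lit 0) (rv 5)) (.forTo 16 (gv 10) (.setRat 1 (gv 16) (.get 4 (gv 16)))))
    .skip

/-- Evaluates the ternary vectors in the memory and updates the best solution. -/
def tryChoice : Prog := .seq evalChoice (.seq sumObj keepBest)

/-- The output of the program in the memory. -/
def outOf (G : Inst) (σ : Mem) (j k : ℕ) : ℚ := σ.rat 1 (G.off j + k)

theorem Inst.RoundsFrom.congr {G : Inst} {j₀ : ℕ} {t : ℕ → ℕ → ℕ} {x y : ℕ → ℕ → ℚ}
    (h : G.RoundsFrom j₀ t x) (hxy : ∀ j, j₀ ≤ j → j < G.s → ∀ k < G.n j, y j k = x j k) :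
    G.RoundsFrom j₀ t y := by
  intro j hj hj'
  have hc : G.constPart y j = G.constPart x j :=
    funext fun k => Inst.constPart_congr (fun l hl hl' => hxy l (by omega) hl') k
  rw [hc]
  intro k hk
  rw [hxy j hj hj' k hk]
  exact h j hj hj' k hk

section Specs

variable {G : Inst} {b K E F : ℕ} {σ : Mem} {Q : Mem → Prop}

theorem wp_setLevel (hB : Bounds G b K E F) (hσ : Bdd b σ) (he : Env G σ) {j : ℕ} (hj : j < G.s)
    (hjv : G.s - 1 - σ.nat 21 0 = j) : wp b K setLevel σ fun τ => Level G j τ := by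
  have hb := hB.one_le_b
  have hnN := G.n_le_N hj
  have hoN := G.off_mono hj.le
  have hK := hB.K_le
  have hs := hB.s_le
  refine wp_seq (wp_setNat hb hσ (hB.size_le (by simp only [NExpr.eval, he.s]; omega)) ?_)
  intro hσ₁ hF₁
  have he₁ := he.frame hF₁ (by decide) (by decide)
  set σ₁ := σ.writeNat 12 _ _ with hσ₁def
  have hj₁ : σ₁.nat 12 0 = j := by simp [hσ₁def, NExpr.eval, he.s, hjv]
  have hn₁ : NExpr.eval σ₁ (.get 1 (gv 12)) = G.n j := by simp [NExpr.eval, hj₁, he₁.n j hj]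
  refine wp_seq (wp_setNat hb hσ₁ (hB.size_le (by rw [hn₁]; omega)) ?_)
  rw [hn₁]
  intro hσ₂ hF₂
  have he₂ := he₁.frame hF₂ (by decide) (by decide)
  set σ₂ := σ₁.writeNat 23 _ _ with hσ₂def
  have hj₂ : σ₂.nat 12 0 = j := by simp [hσ₂def, hj₁]
  have hn₂ : σ₂.nat 23 0 = G.n j := by simp [hσ₂def, NExpr.eval]
  have hW₂ : NExpr.eval σ₂ (.add (.add rE (.lit 1)) (gv 23)) = G.r + 1 + G.n j := by
    simp [NExpr.eval, hn₂, he₂.r]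
  refine wp_seq (wp_setNat hb hσ₂ (hB.size_le (by rw [hW₂]; omega)) ?_)
  rw [hW₂]
  intro hσ₃ hF₃
  have he₃ := he₂.frame hF₃ (by decide) (by decide)
  set σ₃ := σ₂.writeNat 24 _ _ with hσ₃def
  have hj₃ : σ₃.nat 12 0 = j := by simp [hσ₃def, hj₂]
  have hn₃ : σ₃.nat 23 0 = G.n j := by simp [hσ₃def, hn₂]
  have hW₃ : σ₃.nat 24 0 = G.r + 1 + G.n j := by simp [hσ₃def, NExpr.eval]
  have ho₃ : NExpr.eval σ₃ (.get 3 (gv 12)) = G.off j := by simp [NExpr.eval, hj₃, he₃.off j hj]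
  refine wp_setNat hb hσ₃ (hB.size_le (by rw [ho₃]; unfold Inst.N at hK; omega)) ?_
  rw [ho₃]
  exact ⟨he₃.of_eq (by simp) (by simp), hj, by simp [hj₃], by simp [hn₃], by simp [hW₃],
    by simp [NExpr.eval]⟩

theorem Bounds.tableau_le (hB : Bounds G b K E F) {j : ℕ} (hj : j < G.s) {x : ℕ → ℕ → ℚ}
    (hx : G.Binary x) {k : ℕ} (hk : k < G.n j) (c : ℕ) :
    FracLe E F (tableau G.r (G.linPart j) (G.constPart x j) k c) := by
  unfold tableau
  split_ifs with h1 h2 h3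
  · unfold Inst.linPart
    split_ifs with h
    · exact hB.entry c h1 j hj k hk
    · exact .zero E F
  · classical
    exact hB.term x hx j hj k hk _ G.r le_rfl
  · exact ⟨E, by simp, by simpa using hB.E_le_F⟩
  · exact .zero E F

theorem wp_groupStep (hB : Bounds G b K E F) (hσ : Bdd b σ) (he : Env G σ) {j : ℕ} (hj : j < G.s)
    (hjv : G.s - 1 - σ.nat 21 0 = j) (hbin : ∀ p, σ.rat 4 p = 0 ∨ σ.rat 4 p = 1)
    (hg : ∀ i < G.r, σ.rat 2 i = G.gam (xOf G σ) (j + 1) i)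
    (hr : G.RoundsFrom (j + 1) (tOf G σ) (xOf G σ)) :
    wp b K groupStep σ fun τ => (∀ p, τ.rat 4 p = 0 ∨ τ.rat 4 p = 1) ∧
      (∀ i < G.r, τ.rat 2 i = G.gam (xOf G τ) j i) ∧ G.RoundsFrom j (tOf G σ) (xOf G τ) := by
  have hx : G.Binary (xOf G σ) := xOf_binary hbin
  refine wp_seq ((wp_setLevel hB hσ he hj hjv).imp fun τ₁ hτ₁ hF₁ hl₁ _ _ => ?_)
  refine wp_seq ((wp_buildMat hB hτ₁ hl₁ hx
    (by rw [hF₁.rat 2 (by decide)]; exact hg)).imp fun τ₂ hτ₂ hF₂ hM _ _ => ?_)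
  have hl₂ := hl₁.frame hF₂ (by decide) (by decide)
  have ht₂ : τ₂.nat 6 = σ.nat 6 := by rw [hF₂.nat 6 (by decide), hF₁.nat 6 (by decide)]
  have htj : ∀ k < G.n j, σ.nat 6 (G.off j + k) = tOf G σ j k := fun k hk => by
    simp [tOf, hj, hk]
  refine wp_seq ((wp_elimMat hB hτ₂ hl₂ (t := tOf G σ j) (by rw [ht₂]; exact htj)
    (fun k hk c _ => hB.tableau_le hj hx hk c) hM).imp fun τ₃ hτ₃ hF₃ hE _ _ => ?_)
  have hl₃ := hl₂.frame hF₃ (by decide) (by decide)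
  have ht₃ : τ₃.nat 6 = σ.nat 6 := by rw [hF₃.nat 6 (by decide), ht₂]
  have hx₃ : τ₃.rat 4 = σ.rat 4 := by
    rw [hF₃.rat 4 (by decide), hF₂.rat 4 (by decide), hF₁.rat 4 (by decide)]
  refine wp_seq ((wp_roundGroup hB hτ₃ hl₃ (by rw [hx₃]; exact hbin) (t := tOf G σ j)
    (by rw [ht₃]; exact htj) hE).imp ?_)
  rintro τ₄ hτ₄ hF₄ ⟨hbin₄, hsame, hR⟩ _ _
  have hl₄ := hl₃.frame hF₄ (by decide) (by decide)
  have hx₄ : ∀ l, j + 1 ≤ l → ∀ k, xOf G τ₄ l k = xOf G σ l k := by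
    intro l hl k
    have := G.off_mono hl
    rw [xOf, hsame _ (by omega), hx₃]
    rfl
  have hg₄ : ∀ i < G.r, τ₄.rat 2 i = G.gam (xOf G τ₄) (j + 1) i := by
    intro i hi
    rw [hF₄.rat 2 (by decide), hF₃.rat 2 (by decide), hF₂.rat 2 (by decide), hF₁.rat 2 (by decide),
      hg i hi]
    exact Inst.gam_congr (fun l hl _ k _ => (hx₄ l hl k).symm) i
  refine (wp_updateGam hB hτ₄ hl₄ hbin₄ hg₄).imp fun τ₅ _ hF₅ hg₅ => ?_
  have hx₅ : τ₅.rat 4 = τ₄.rat 4 := hF₅.rat 4 (by decide)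
  have hx₅' : xOf G τ₅ = xOf G τ₄ := by unfold xOf; rw [hx₅]
  rw [hx₅, hx₅']
  refine ⟨hbin₄, hg₅, fun l hl hls => ?_⟩
  by_cases e : l = j
  · subst e
    have hc : G.constPart (xOf G τ₄) l = G.constPart (xOf G σ) l :=
      funext fun k => Inst.constPart_congr (fun l hl _ k _ => hx₄ l hl k) k
    rw [hc]
    exact hR
  · exact hr.congr (fun l hl _ k _ => hx₄ l hl k) l (by omega) hls

theorem wp_evalChoice (hB : Bounds G b K E F) (hσ : Bdd b σ) (he : Env G σ)
    (hbin : ∀ p, σ.rat 4 p = 0 ∨ σ.rat 4 p = 1) :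
    wp b K evalChoice σ fun τ => (∀ p, τ.rat 4 p = 0 ∨ τ.rat 4 p = 1) ∧
      (∀ i < G.r, τ.rat 2 i = G.gam (xOf G τ) 0 i) ∧ G.RoundsFrom 0 (tOf G σ) (xOf G τ) := by
  have hb := hB.one_le_b
  have hK := hB.K_le
  have hs := hB.s_le
  refine wp_seq ((wp_initGam hB hσ he).imp fun τ₁ hτ₁ hF₁ hg₁ _ _ => ?_)
  have he₁ := he.frame hF₁ (by decide) (by decide)
  refine wp_for hb hτ₁ G.s (by omega) hB.le_b (by decide)
    (fun jj τ => (∀ p, τ.rat 4 p = 0 ∨ τ.rat 4 p = 1) ∧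
      (∀ i < G.r, τ.rat 2 i = G.gam (xOf G τ) (G.s - jj) i) ∧
      G.RoundsFrom (G.s - jj) (tOf G σ) (xOf G τ)) ?_ ?_ ?_ ?_
  · intro τ hF
    simp [NExpr.eval, hF.nat 0 (by decide), he₁.s]
  · refine ⟨by simpa [hF₁.rat 4 (by decide)] using hbin, fun i hi => ?_, fun j hj hj' => by omega⟩
    rw [Nat.sub_zero, Inst.gam_self]
    simpa using hg₁ i hi
  · rintro jj hjj τ hτ hF hv ⟨h1, h2, h3⟩
    have he' : Env G τ := he₁.frame hF (by decide) (by decide)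
    have ht : tOf G τ = tOf G σ := by
      unfold tOf; rw [hF.nat 6 (by decide), hF₁.nat 6 (by decide)]
    have hj : G.s - jj = G.s - 1 - jj + 1 := by omega
    rw [hj] at h2 h3
    refine (wp_groupStep hB hτ he' (j := G.s - 1 - jj) (by omega) (by rw [hv]) h1 h2
      (by rwa [ht])).imp ?_
    rintro τ' _ _ ⟨h4, h5, h6⟩ _ _ _ _
    rw [ht] at h6
    have e : G.s - (jj + 1) = G.s - 1 - jj := by omega
    rw [e]
    exact ⟨h4, h5, h6⟩
  · rintro τ _ _ _ ⟨h1, h2, h3⟩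
    rw [Nat.sub_self] at h2 h3
    exact ⟨h1, h2, h3⟩

theorem wp_sumObj (hB : Bounds G b K E F) (hσ : Bdd b σ) (he : Env G σ) {x : ℕ → ℕ → ℚ}
    (hx : G.Binary x) (hg : ∀ i < G.r, σ.rat 2 i = G.gam x 0 i) :
    wp b K sumObj σ fun τ => τ.rat 5 0 = G.obj x := by
  have hb := hB.one_le_b
  refine wp_seq (wp_setRat hb hσ (by simp [RExpr.DivOk]) hB.zero_le ?_)
  intro hσ₁ hF₁
  refine wp_for hb hσ₁ G.r (by have := hB.K_le; omega) hB.le_b (by decide)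
    (fun i τ => τ.rat 5 0 = ∑ i' ∈ Finset.range i, G.gam x 0 i') ?_ ?_ ?_ ?_
  · intro τ hF
    simp [NExpr.eval, hF.nat 0 (by decide), he.r]
  · simp [NExpr.eval, RExpr.eval]
  · intro i hi τ hτ hF hv hI
    have hval : RExpr.eval τ (.add (rv 5) (.get 2 (gv 11))) =
        ∑ i' ∈ Finset.range (i + 1), G.gam x 0 i' := by
      rw [Finset.sum_range_succ, ← hI, ← hg i hi]
      simp [RExpr.eval, NExpr.eval, hv, hF.rat 2 (by decide)]
    refine wp_setRat hb hτ (by simp [RExpr.DivOk]) ?_ ?_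
    · rw [hval]; exact hB.ratSize_le (hB.obj x hx (i + 1) hi)
    · rw [hval]
      intro _ _ _ _
      simp [NExpr.eval]
  · intro τ _ _ _ h
    rw [h, Inst.obj]
    exact Finset.sum_congr rfl fun i _ => Inst.gam_zero x i

theorem wp_keepBest (hB : Bounds G b K E F) (hσ : Bdd b σ) (he : Env G σ)
    (hbin : ∀ p, σ.rat 4 p = 0 ∨ σ.rat 4 p = 1) (hout : ∀ p, σ.rat 1 p = 0 ∨ σ.rat 1 p = 1)
    (hobj : σ.rat 5 0 = G.obj (xOf G σ)) (hbest : σ.rat 7 0 ≤ G.obj (outOf G σ)) :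
    wp b K keepBest σ fun τ => (∀ p, τ.rat 1 p = 0 ∨ τ.rat 1 p = 1) ∧
      τ.rat 7 0 ≤ G.obj (outOf G τ) ∧ σ.rat 7 0 ≤ τ.rat 7 0 ∧ G.obj (xOf G σ) ≤ τ.rat 7 0 := by
  have hb := hB.one_le_b
  have hK := hB.K_le
  refine wp_ite hb hσ (by simp [Test.DivOk, RExpr.DivOk]) (fun h => ?_) (fun h => ?_)
  · simp only [Test.Holds, RExpr.eval, NExpr.eval, hobj] at h
    refine wp_seq (wp_setRat hb hσ (by simp [RExpr.DivOk]) (hσ.rat _ _) ?_)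
    intro hσ₁ hF₁
    refine wp_for hb hσ₁ G.N (by omega) hB.le_b (by decide)
      (fun p' τ => (∀ p, τ.rat 1 p = 0 ∨ τ.rat 1 p = 1) ∧
        ∀ p < p', τ.rat 1 p = σ.rat 4 p) ?_ ?_ ?_ ?_
    · intro τ hF
      simp [NExpr.eval, hF.nat 10 (by decide), he.N]
    · exact ⟨by simpa using hout, by simp⟩
    · rintro p hp τ hτ hF hv ⟨h1, h2⟩
      have hx : τ.rat 4 = σ.rat 4 := by rw [hF.rat 4 (by decide), hF₁.rat 4 (by decide)]
      refine wp_setRat hb hτ (by simp [RExpr.DivOk]) (hτ.rat _ _) fun _ _ _ _ => ?_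
      simp only [NExpr.eval, RExpr.eval, hv, hx, Mem.writeNat_rat, Mem.writeRat_rat_self]
      refine ⟨fun p' => ?_, fun p' hp' => ?_⟩
      · by_cases e : p' = p
        · simpa [e] using hbin p
        · simpa [e] using h1 p'
      · by_cases e : p' = p
        · simp [e]
        · simpa [e] using h2 p' (by omega)
    · rintro τ _ hF _ ⟨h1, h2⟩
      have h7 : τ.rat 7 0 = G.obj (xOf G σ) := by
        rw [hF.rat 7 (by decide), ← hobj]
        simp [NExpr.eval, RExpr.eval]
      have h8 : G.obj (outOf G τ) = G.obj (xOf G σ) := Inst.obj_congr fun j hj k hk =>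
        h2 _ (G.off_add_lt hj hk)
      rw [h7, h8]
      exact ⟨h1, le_rfl, h.le, le_rfl⟩
  · simp only [Test.Holds, RExpr.eval, NExpr.eval, hobj, not_lt] at h
    exact wp_skip hσ ⟨hout, hbest, le_rfl, h⟩

/-- The new best value is attained by the output and is not exceeded by the old one or by the value of
the rounding that belongs to the ternary vectors. -/
theorem wp_tryChoice (hB : Bounds G b K E F) (hσ : Bdd b σ) (he : Env G σ)
    (hbin : ∀ p, σ.rat 4 p = 0 ∨ σ.rat 4 p = 1) (hout : ∀ p, σ.rat 1 p = 0 ∨ σ.rat 1 p = 1)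
    (hbest : σ.rat 7 0 ≤ G.obj (outOf G σ)) :
    wp b K tryChoice σ fun τ => (∀ p, τ.rat 4 p = 0 ∨ τ.rat 4 p = 1) ∧
      (∀ p, τ.rat 1 p = 0 ∨ τ.rat 1 p = 1) ∧
      τ.rat 7 0 ≤ G.obj (outOf G τ) ∧ σ.rat 7 0 ≤ τ.rat 7 0 ∧
      ∃ x, G.RoundsFrom 0 (tOf G σ) x ∧ G.obj x ≤ τ.rat 7 0 := by
  refine wp_seq ((wp_evalChoice hB hσ he hbin).imp ?_)
  rintro τ₁ hτ₁ hF₁ ⟨hbin₁, hg₁, hr₁⟩ _ _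
  have he₁ := he.frame hF₁ (by decide) (by decide)
  refine wp_seq ((wp_sumObj hB hτ₁ he₁ (xOf_binary hbin₁) hg₁).imp fun τ₂ hτ₂ hF₂ hobj _ _ => ?_)
  have he₂ := he₁.frame hF₂ (by decide) (by decide)
  have hx₂ : τ₂.rat 4 = τ₁.rat 4 := hF₂.rat 4 (by decide)
  have hxo : xOf G τ₂ = xOf G τ₁ := by unfold xOf; rw [hx₂]
  have ho₂ : τ₂.rat 1 = σ.rat 1 := by rw [hF₂.rat 1 (by decide), hF₁.rat 1 (by decide)]
  have hoo : outOf G τ₂ = outOf G σ := by unfold outOf; rw [ho₂]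
  have h7 : τ₂.rat 7 = σ.rat 7 := by rw [hF₂.rat 7 (by decide), hF₁.rat 7 (by decide)]
  refine (wp_keepBest hB hτ₂ he₂ (by rw [hx₂]; exact hbin₁) (by rw [ho₂]; exact hout)
    (by rw [hxo]; exact hobj) (by rw [h7, hoo]; exact hbest)).imp ?_
  rintro τ₃ _ hF₃ ⟨h1, h2, h3, h4⟩
  rw [hF₃.rat 4 (by decide), hx₂]
  rw [h7] at h3
  rw [hxo] at h4
  exact ⟨hbin₁, h1, h2, h3, _, hr₁, h4⟩

end Specs

/-! ### Counting with few nonzero digits -/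

/-- The number of nonzero digits of `t` in the group `j`, among the positions from `p` on. -/
def cntFrom (N : ℕ) (g t : ℕ → ℕ) (p j : ℕ) : ℕ :=
  ((Finset.range N).filter fun q => p ≤ q ∧ g q = j ∧ t q ≠ 0).card

/-- The ternary vectors of length `N` that have at most `m j` nonzero digits in the group `j`. -/
structure Adm (N : ℕ) (g m t : ℕ → ℕ) : Prop where
  le_two : ∀ p, t p ≤ 2
  eq_zero : ∀ p, N ≤ p → t p = 0
  cnt_le : ∀ j, cntFrom N g t 0 j ≤ m j

/-- The number with the ternary digits `t`, the lowest digit first. -/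
def val (N : ℕ) (t : ℕ → ℕ) : ℕ := ∑ p ∈ Finset.range N, t p * 3 ^ p

theorem val_succ (N : ℕ) (t : ℕ → ℕ) : val (N + 1) t = val N t + t N * 3 ^ N :=
  Finset.sum_range_succ _ _

theorem val_lt (N : ℕ) {t : ℕ → ℕ} (ht : ∀ p, t p ≤ 2) : val N t < 3 ^ N := by
  induction N with
  | zero => simp [val]
  | succ N ih =>
    rw [val_succ, pow_succ]
    have := Nat.mul_le_mul_right (3 ^ N) (ht N)
    omega

theorem val_lt_val {N p : ℕ} {t t' : ℕ → ℕ} (ht : ∀ q, t q ≤ 2) (hp : p < N) (h : t p < t' p)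
    (habove : ∀ q, p < q → q < N → t q = t' q) : val N t < val N t' := by
  induction N with
  | zero => omega
  | succ N ih =>
    rw [val_succ, val_succ]
    by_cases e : p = N
    · subst e
      have h1 := val_lt p ht
      have h2 := Nat.mul_le_mul_right (3 ^ p) (show t p + 1 ≤ t' p from h)
      rw [add_mul, one_mul] at h2
      omega
    · have := ih (by omega) fun q hq hq' => habove q hq (by omega)
      rw [habove N (by omega) (by omega)]
      omega

theorem exists_of_val_lt_val {N : ℕ} {t t' : ℕ → ℕ} (ht' : ∀ q, t' q ≤ 2)
    (h : val N t < val N t') :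
    ∃ p < N, t p < t' p ∧ ∀ q, p < q → q < N → t q = t' q := by
  induction N with
  | zero => simp [val] at h
  | succ N ih =>
    rcases lt_trichotomy (t N) (t' N) with e | e | e
    · exact ⟨N, by omega, e, fun q h1 h2 => by omega⟩
    · rw [val_succ, val_succ, e] at h
      obtain ⟨p, hp, h1, h2⟩ := ih (by omega)
      refine ⟨p, by omega, h1, fun q h3 h4 => ?_⟩
      by_cases e' : q = N
      · subst e'; exact e
      · exact h2 q h3 (by omega)
    · exact absurd (val_lt_val ht' (Nat.lt_succ_self N) e fun q h1 h2 => by omega) h.not_gt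

theorem val_inj {N : ℕ} {t t' : ℕ → ℕ} (ht : ∀ q, t q ≤ 2) (ht' : ∀ q, t' q ≤ 2)
    (h : val N t = val N t') : ∀ p < N, t p = t' p := by
  induction N with
  | zero => intro p hp; omega
  | succ N ih =>
    rcases lt_trichotomy (t N) (t' N) with e | e | e
    · exact absurd (val_lt_val ht (Nat.lt_succ_self N) e fun q h1 h2 => by omega) h.not_lt
    · rw [val_succ, val_succ, e] at h
      intro p hp
      by_cases e' : p = N
      · subst e'; exact e
      · exact ih (by omega) p (by omega)
    · exact absurd (val_lt_val ht' (Nat.lt_succ_self N) e fun q h1 h2 => by omega) h.not_gt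

section Successor

variable {N : ℕ} {g m t t' : ℕ → ℕ}

/-- The digit at position `q` cannot be increased when the lower digits are zero. -/
def Blocked (N : ℕ) (g m t : ℕ → ℕ) (q : ℕ) : Prop :=
  t q = 2 ∨ (t q = 0 ∧ m (g q) ≤ cntFrom N g t (q + 1) (g q))

theorem Blocked.not_lt {q : ℕ} (hb : Blocked N g m t q) (hq : q < N) {u : ℕ → ℕ}
    (hu : Adm N g m u) (h : t q < u q) (habove : ∀ q', q < q' → q' < N → t q' = u q') : False := by
  rcases hb with e | ⟨e, hm⟩
  · have := hu.le_two q
    omega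
  · have h1 : cntFrom N g t (q + 1) (g q) + 1 ≤ cntFrom N g u 0 (g q) := by
      unfold cntFrom
      rw [← Finset.card_insert_of_notMem (a := q)
        (s := (Finset.range N).filter fun q' => q + 1 ≤ q' ∧ g q' = g q ∧ t q' ≠ 0) (by simp)]
      refine Finset.card_le_card fun q' hq' => ?_
      simp only [Finset.mem_insert, Finset.mem_filter, Finset.mem_range] at hq' ⊢
      rcases hq' with rfl | ⟨h1, h2, h3, h4⟩
      · exact ⟨hq, by omega, rfl, by omega⟩
      · exact ⟨h1, by omega, h3, by rw [← habove q' (by omega) h1]; exact h4⟩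
    have := hu.cnt_le (g q)
    omega

/-- A vector in which no digit can be increased is the last one. -/
theorem no_later_of_blocked (hb : ∀ q < N, Blocked N g m t q) {u : ℕ → ℕ} (hu : Adm N g m u) :
    ¬ val N t < val N u := by
  intro h
  obtain ⟨q, hq, h1, h2⟩ := exists_of_val_lt_val hu.le_two h
  exact (hb q hq).not_lt hq hu h1 h2

/-- The vector in which a digit has been increased and the lower digits, which could not be
increased, have been set to zero is the successor of the original vector. -/
theorem no_between_of_blocked {p : ℕ} (hp : p < N) (hb : ∀ q < p, Blocked N g m t q)
    (ht' : ∀ q, t' q = if q < p then 0 else if q = p then t p + 1 else t q) (h2 : ∀ q, t q ≤ 2)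
    (h2' : ∀ q, t' q ≤ 2) :
    val N t < val N t' ∧ ∀ u, Adm N g m u → val N t < val N u → val N t' ≤ val N u := by
  have habove : ∀ q, p < q → t' q = t q := fun q hq => by
    rw [ht', if_neg (by omega), if_neg (by omega)]
  have hat : t' p = t p + 1 := by rw [ht', if_neg (by omega), if_pos rfl]
  refine ⟨val_lt_val h2 hp (by omega) fun q hq _ => (habove q hq).symm, fun u hu h => ?_⟩
  obtain ⟨q, hq, h3, h4⟩ := exists_of_val_lt_val hu.le_two h
  rcases lt_trichotomy q p with e | e | e
  · exact ((hb q e).not_lt hq hu h3 h4).elim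
  · subst e
    by_contra hlt
    obtain ⟨q', hq', h5, h6⟩ := exists_of_val_lt_val h2' (not_le.1 hlt)
    rcases lt_trichotomy q' q with e | e | e
    · rw [ht' q', if_pos e] at h5; omega
    · subst e; omega
    · rw [habove q' e, h4 q' e hq'] at h5; omega
  · exact (val_lt_val h2' hq (by rw [habove q e]; exact h3) fun q' h5 h6 => by
      rw [habove q' (by omega)]; exact h4 q' h5 h6).le

theorem cntFrom_zero_low {p j : ℕ} (h : ∀ q < p, t q = 0) :
    cntFrom N g t 0 j = cntFrom N g t p j := by
  unfold cntFrom
  congr 1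
  ext q
  simp only [Finset.mem_filter, Finset.mem_range, Nat.zero_le, true_and]
  refine ⟨fun ⟨h1, h2, h3⟩ => ⟨h1, ?_, h2, h3⟩, fun ⟨h1, _, h2, h3⟩ => ⟨h1, h2, h3⟩⟩
  by_contra hq
  exact h3 (h q (by omega))

theorem cntFrom_succ {p : ℕ} (hp : p < N) (j : ℕ) :
    cntFrom N g t p j = cntFrom N g t (p + 1) j + if g p = j ∧ t p ≠ 0 then 1 else 0 := by
  unfold cntFrom
  split_ifs with h
  · rw [← Finset.card_insert_of_notMem (a := p)
      (s := (Finset.range N).filter fun q' => p + 1 ≤ q' ∧ g q' = j ∧ t q' ≠ 0) (by simp)]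
    congr 1
    ext q
    simp only [Finset.mem_insert, Finset.mem_filter, Finset.mem_range]
    constructor
    · rintro ⟨h1, h2, h3⟩
      by_cases e : q = p
      · exact Or.inl e
      · exact Or.inr ⟨h1, by omega, h3⟩
    · rintro (rfl | ⟨h1, h2, h3⟩)
      · exact ⟨hp, le_rfl, h⟩
      · exact ⟨h1, by omega, h3⟩
  · rw [add_zero]
    congr 1
    ext q
    simp only [Finset.mem_filter, Finset.mem_range]
    constructor
    · rintro ⟨h1, h2, h3⟩
      refine ⟨h1, ?_, h3⟩
      have : q ≠ p := by rintro rfl; exact h h3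
      omega
    · rintro ⟨h1, h2, h3⟩
      exact ⟨h1, by omega, h3⟩

theorem cntFrom_congr {p j : ℕ} (h : ∀ q < N, p ≤ q → (t q = 0 ↔ t' q = 0)) :
    cntFrom N g t p j = cntFrom N g t' p j := by
  unfold cntFrom
  congr 1
  refine Finset.filter_congr fun q hq => ?_
  rw [Finset.mem_range] at hq
  constructor
  · rintro ⟨h1, h2, h3⟩; exact ⟨h1, h2, fun e => h3 ((h q hq h1).2 e)⟩
  · rintro ⟨h1, h2, h3⟩; exact ⟨h1, h2, fun e => h3 ((h q hq h1).1 e)⟩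

end Successor

/-! ### The number of ternary vectors with few nonzero digits -/

/-- There are at most `n ^ i / i!` supports of size `i`, and `∑ 2 ^ i / i! ≤ exp 2 ≤ 8`. -/
theorem sum_choose_two_pow_le (n m : ℕ) (hn : 1 ≤ n) :
    ∑ i ∈ Finset.range (n + 1), n.choose i * (if i ≤ m then 2 ^ i else 0) ≤ 8 * n ^ m := by
  have h1 : ∀ i ∈ Finset.range (n + 1),
      ((n.choose i * (if i ≤ m then 2 ^ i else 0) : ℕ) : ℝ) ≤
        (n : ℝ) ^ m * (2 ^ i / (i.factorial : ℝ)) := by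
    intro i _
    by_cases him : i ≤ m
    · rw [if_pos him]
      push_cast
      have h2 : ((n.choose i : ℕ) : ℝ) ≤ (n : ℝ) ^ i / (i.factorial : ℝ) :=
        Nat.choose_le_pow_div i n
      have h3 : (n : ℝ) ^ i ≤ (n : ℝ) ^ m := pow_le_pow_right₀ (by exact_mod_cast hn) him
      calc ((n.choose i : ℕ) : ℝ) * 2 ^ i ≤ ((n : ℝ) ^ i / (i.factorial : ℝ)) * 2 ^ i := by gcongr
        _ = (n : ℝ) ^ i * (2 ^ i / (i.factorial : ℝ)) := by ring
        _ ≤ _ := by gcongr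
    · rw [if_neg him]
      simp only [mul_zero, Nat.cast_zero]
      positivity
  have h2 := Finset.sum_le_sum h1
  rw [← Finset.mul_sum] at h2
  have h3 : ∑ i ∈ Finset.range (n + 1), (2 : ℝ) ^ i / (i.factorial : ℝ) ≤ 8 := by
    refine (Real.sum_le_exp_of_nonneg (by norm_num) (n + 1)).trans ?_
    have h4 : Real.exp 2 = Real.exp 1 * Real.exp 1 := by rw [← Real.exp_add]; norm_num
    have h5 := Real.exp_one_lt_d9
    have h6 := Real.exp_pos 1
    rw [h4]
    nlinarith
  have h4 : (n : ℝ) ^ m * ∑ i ∈ Finset.range (n + 1), (2 : ℝ) ^ i / (i.factorial : ℝ) ≤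
      (n : ℝ) ^ m * 8 := by gcongr
  have h5 := h2.trans h4
  rw [← Nat.cast_sum] at h5
  have h6 : ((n : ℝ) ^ m * 8) = ((8 * n ^ m : ℕ) : ℝ) := by push_cast; ring
  rw [h6] at h5
  exact_mod_cast h5

/-- The number of choices for a group of `n` variables. -/
theorem card_ternary_le (n m : ℕ) (hn : 1 ≤ n) :
    (Finset.univ.filter fun f : Fin n → Fin 3 =>
      (Finset.univ.filter fun k => f k ≠ 0).card ≤ m).card ≤ 8 * n ^ m := by
  classical
  let A : Finset (Fin n) → Finset (Fin n → Fin 3) := fun S =>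
    Fintype.piFinset fun k => if k ∈ S then {1, 2} else {0}
  have hA : ∀ S, (A S).card = 2 ^ S.card := by
    intro S
    rw [Fintype.card_piFinset]
    have : ∀ k, (if k ∈ S then ({1, 2} : Finset (Fin 3)) else {0}).card =
        if k ∈ S then 2 else 1 := fun k => by split_ifs <;> rfl
    simp only [this]
    rw [Finset.prod_ite]
    simp
  have hsub : (Finset.univ.filter fun f : Fin n → Fin 3 =>
      (Finset.univ.filter fun k => f k ≠ 0).card ≤ m) ⊆
      ((Finset.univ : Finset (Fin n)).powerset.filter fun S => S.card ≤ m).biUnion A := by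
    intro f hf
    simp only [Finset.mem_filter, Finset.mem_univ, true_and] at hf
    refine Finset.mem_biUnion.2 ⟨Finset.univ.filter fun k => f k ≠ 0, by simpa using hf, ?_⟩
    refine Fintype.mem_piFinset.2 fun k => ?_
    have h3 : ∀ x : Fin 3, x ≠ 0 → x = 1 ∨ x = 2 := by decide
    by_cases hk : f k = 0
    · simp [hk]
    · simpa [hk] using h3 _ hk
  refine (Finset.card_le_card hsub).trans (Finset.card_biUnion_le.trans ?_)
  simp only [hA]
  rw [Finset.sum_filter, Finset.sum_powerset_apply_card (fun i => if i ≤ m then 2 ^ i else 0)]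
  simpa using sum_choose_two_pow_le n m hn

/-! ### Ternary vectors indexed by positions -/

namespace Inst

variable (G : Inst)

/-- The group of the variable at position `p`. -/
noncomputable def grp (p : ℕ) : ℕ := if h : p < G.N then (G.exists_off_add h).choose else 0

theorem grp_off_add {j k : ℕ} (hj : j < G.s) (hk : k < G.n j) : G.grp (G.off j + k) = j := by
  have h := G.off_add_lt hj hk
  obtain ⟨k', -, hk', he⟩ := (G.exists_off_add h).choose_spec
  rw [grp, dif_pos h]
  exact (G.off_add_inj hk hk' he).1.symm

theorem grp_lt {p : ℕ} (hp : p < G.N) : G.grp p < G.s := by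
  obtain ⟨j, k, hj, hk, rfl⟩ := G.exists_off_add hp
  rwa [G.grp_off_add hj hk]

/-- The vectors of the groups, from the vector indexed by positions. -/
def unflat (t : ℕ → ℕ) (j k : ℕ) : ℕ := if j < G.s ∧ k < G.n j then t (G.off j + k) else 0

theorem m_le (j : ℕ) : G.m j ≤ G.r := by
  classical
  exact (Finset.card_filter_le _ _).trans (by simp)

theorem m_zero : G.m 0 = 0 := by
  classical
  simp [m, Q]

variable {G}

theorem cntFrom_eq (t : ℕ → ℕ) {j : ℕ} (hj : j < G.s) :
    cntFrom G.N G.grp t 0 j =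
      ((Finset.range (G.n j)).filter fun k => t (G.off j + k) ≠ 0).card := by
  unfold cntFrom
  rw [← Finset.card_map (s := (Finset.range (G.n j)).filter fun k => t (G.off j + k) ≠ 0)
    ⟨fun k => G.off j + k, fun a b h => by simpa using h⟩]
  congr 1
  ext p
  simp only [Finset.mem_filter, Finset.mem_range, Finset.mem_map]
  constructor
  · rintro ⟨hp, -, hg, ht⟩
    obtain ⟨j', k, hj', hk, rfl⟩ := G.exists_off_add hp
    rw [G.grp_off_add hj' hk] at hg
    subst hg
    exact ⟨k, ⟨hk, ht⟩, rfl⟩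
  · rintro ⟨k, ⟨hk, ht⟩, rfl⟩
    exact ⟨G.off_add_lt hj hk, Nat.zero_le _, G.grp_off_add hj hk, ht⟩

/-- The choices for the groups and the ternary vectors indexed by positions correspond to each other. -/
theorem Admissible.exists_adm {T : ℕ → ℕ → ℕ} (hT : G.Admissible T) :
    ∃ t, Adm G.N G.grp G.m t ∧ G.unflat t = T := by
  let t : ℕ → ℕ := fun p => if p < G.N then T (G.grp p) (p - G.off (G.grp p)) else 0
  have ht : ∀ j k, j < G.s → k < G.n j → t (G.off j + k) = T j k := by
    intro j k hj hk
    simp [t, G.off_add_lt hj hk, G.grp_off_add hj hk]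
  refine ⟨t, ⟨fun p => ?_, fun p hp => by simp [t, hp.not_gt], fun j => ?_⟩, ?_⟩
  · simp only [t]
    split_ifs
    · exact hT.le_two _ _
    · omega
  · by_cases hj : j < G.s
    · rw [cntFrom_eq t hj]
      refine le_trans (le_of_eq ?_) (hT.card_le j hj)
      congr 1
      refine Finset.filter_congr fun k hk => ?_
      rw [ht j k hj (Finset.mem_range.1 hk)]
    · have : cntFrom G.N G.grp t 0 j = 0 := by
        unfold cntFrom
        rw [Finset.card_eq_zero, Finset.filter_eq_empty_iff]
        rintro p hp ⟨-, hg, -⟩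
        have := G.grp_lt (Finset.mem_range.1 hp)
        omega
      omega
  · funext j k
    unfold unflat
    split_ifs with h
    · exact ht j k h.1 h.2
    · by_cases hj : j < G.s
      · exact (hT.eq_zero j k (by omega)).symm
      · exact (hT.eq_zero' j k (by omega)).symm

/-- The number of choices for all groups. -/
theorem adm_finite_card (hn : ∀ j < G.s, 1 ≤ G.n j) :
    {t | Adm G.N G.grp G.m t}.Finite ∧
      {t | Adm G.N G.grp G.m t}.ncard ≤ ∏ j ∈ Finset.range G.s, 8 * G.n j ^ G.m j := by
  classical
  let φ : (ℕ → ℕ) → (j : Fin G.s) → Fin (G.n j) → Fin 3 := fun t j k => Fin.ofNat 3 (t (G.off j + k))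
  -- the vector is determined by its digits in the groups
  let S : Finset ((j : Fin G.s) → Fin (G.n j) → Fin 3) := Fintype.piFinset fun j =>
    Finset.univ.filter fun f : Fin (G.n j) → Fin 3 =>
      (Finset.univ.filter fun k => f k ≠ 0).card ≤ G.m j
  have hne : ∀ x : ℕ, x ≤ 2 → (Fin.ofNat 3 x ≠ 0 ↔ x ≠ 0) := by
    intro x hx
    interval_cases x <;> decide
  have hmaps : ∀ t ∈ {t | Adm G.N G.grp G.m t}, φ t ∈ (S : Set _) := by
    intro t ht
    refine Finset.mem_coe.2 (Fintype.mem_piFinset.2 fun j => ?_)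
    simp only [Finset.mem_filter, Finset.mem_univ, true_and, φ, hne _ (ht.le_two _)]
    refine le_trans (le_of_eq ?_) (ht.cnt_le j)
    rw [cntFrom_eq t j.2, ← Finset.card_map Fin.valEmbedding]
    congr 1
    ext k
    simp only [Finset.mem_filter, Finset.mem_range, Finset.mem_map, Fin.valEmbedding_apply,
      Finset.mem_univ, true_and]
    constructor
    · rintro ⟨k, hk, rfl⟩
      exact ⟨k.2, hk⟩
    · rintro ⟨hk, h⟩
      exact ⟨⟨k, hk⟩, h, rfl⟩
  have hinj : Set.InjOn φ {t | Adm G.N G.grp G.m t} := by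
    intro t ht u hu h
    funext p
    by_cases hp : p < G.N
    · obtain ⟨j, k, hj, hk, rfl⟩ := G.exists_off_add hp
      have h1 := congrFun (congrFun h ⟨j, hj⟩) ⟨k, hk⟩
      have h2 := congrArg Fin.val h1
      simp only [φ, Fin.ofNat] at h2
      rwa [Nat.mod_eq_of_lt (by have := ht.le_two (G.off j + k); omega),
        Nat.mod_eq_of_lt (by have := hu.le_two (G.off j + k); omega)] at h2
    · rw [ht.eq_zero p (by omega), hu.eq_zero p (by omega)]
  refine ⟨Set.Finite.of_injOn hmaps hinj S.finite_toSet,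
    (Set.ncard_le_ncard_of_injOn φ hmaps hinj S.finite_toSet).trans ?_⟩
  rw [Set.ncard_coe_finset, Fintype.card_piFinset, Finset.prod_range]
  exact Finset.prod_le_prod' fun j _ => card_ternary_le _ _ (hn j j.2)

end Inst

/-! ### The successor of a ternary vector -/

/-- Replaces the ternary vector in the memory by its successor among the vectors with at most `m j`
nonzero digits in each group `j`, and sets the variable `19` to `1` if there is one: the lowest digit that
can be increased is increased, and the lower digits are set to zero. -/
def advance : Prog :=
  .seq (.setNat 19 (.lit 0) (.lit 0))
    (.forTo 16 (gv 10) (.ite (.natEq (gv 19) (.lit 0))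
      (.ite (.natEq (.get 6 (gv 16)) (.lit 2))
        (.seq (.setNat 6 (gv 16) (.lit 0))
          (.setNat 8 (.get 7 (gv 16)) (.sub (.get 8 (.get 7 (gv 16))) (.lit 1))))
        (.ite (.natEq (.get 6 (gv 16)) (.lit 1))
          (.seq (.setNat 6 (gv 16) (.lit 2)) (.setNat 19 (.lit 0) (.lit 1)))
          (.ite (.natLt (.get 8 (.get 7 (gv 16))) (.get 5 (.get 7 (gv 16))))
            (.seq (.setNat 6 (gv 16) (.lit 1))
              (.seq (.setNat 8 (.get 7 (gv 16)) (.add (.get 8 (.get 7 (gv 16))) (.lit 1)))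
                (.setNat 19 (.lit 0) (.lit 1))))
            .skip)))
      .skip))

theorem cntFrom_anti {N : ℕ} {g t : ℕ → ℕ} {p q : ℕ} (h : p ≤ q) (j : ℕ) :
    cntFrom N g t q j ≤ cntFrom N g t p j := by
  refine Finset.card_le_card fun x hx => ?_
  simp only [Finset.mem_filter, Finset.mem_range] at hx ⊢
  exact ⟨hx.1, by omega, hx.2.2⟩

/-- The ternary vector `t` in the memory, with the numbers of nonzero digits. -/
structure Choice (G : Inst) (t : ℕ → ℕ) (σ : Mem) : Prop where
  t_eq : σ.nat 6 = t
  adm : Adm G.N G.grp G.m t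
  cnt : ∀ j < G.s, σ.nat 8 j = cntFrom G.N G.grp t 0 j

section Specs

variable {G : Inst} {b K E F : ℕ} {σ : Mem} {Q : Mem → Prop}

theorem Env.grp_eq (he : Env G σ) {p : ℕ} (hp : p < G.N) : σ.nat 7 p = G.grp p := by
  obtain ⟨j, k, hj, hk, rfl⟩ := G.exists_off_add hp
  rw [he.grp j hj k hk, G.grp_off_add hj hk]

/-- After `advance`, the memory holds the next admissible vector, or there is none. -/
theorem wp_advance (hB : Bounds G b K E F) (hσ : Bdd b σ) (he : Env G σ) {t : ℕ → ℕ}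
    (hc : Choice G t σ) :
    wp b K advance σ fun τ =>
      (τ.nat 19 0 = 1 ∧ ∃ t', Choice G t' τ ∧ val G.N t < val G.N t' ∧
        ∀ u, Adm G.N G.grp G.m u → val G.N t < val G.N u → val G.N t' ≤ val G.N u) ∨
      (τ.nat 19 0 ≠ 1 ∧ ∀ u, Adm G.N G.grp G.m u → ¬ val G.N t < val G.N u) := by
  have hb := hB.one_le_b
  have hK := hB.K_le
  have hs := hB.s_le
  have hb3 := hB.three_le_b
  have hadm := hc.adm
  refine wp_seq (wp_setNat hb hσ (by simp [NExpr.eval]) ?_)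
  intro hσ₁ hF₁
  have he₁ := he.frame hF₁ (by decide) (by decide)
  refine wp_for hb hσ₁ G.N (by omega) hB.le_b (by decide)
    (fun p τ =>
      (τ.nat 19 0 = 1 ∧ ∃ t', Choice G t' τ ∧ val G.N t < val G.N t' ∧
        ∀ u, Adm G.N G.grp G.m u → val G.N t < val G.N u → val G.N t' ≤ val G.N u) ∨
      (τ.nat 19 0 = 0 ∧ (∀ q < p, Blocked G.N G.grp G.m t q) ∧
        (∀ q, τ.nat 6 q = if q < p then 0 else t q) ∧
        ∀ j < G.s, τ.nat 8 j = cntFrom G.N G.grp t p j)) ?_ ?_ ?_ ?_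
  · intro τ hF
    simp [NExpr.eval, hF.nat 10 (by decide), he.N]
  · right
    simpa [NExpr.eval, hc.t_eq] using hc.cnt
  · intro p hp τ hτ hF hv hI
    have he' : Env G τ := he₁.frame hF (by decide) (by decide)
    have hgp := he'.grp_eq hp
    have hgs := G.grp_lt hp
    refine wp_ite hb hτ (by simp [Test.DivOk]) (fun h => ?_) (fun h => ?_)
    · simp only [Test.Holds, NExpr.eval] at h
      obtain ⟨-, hbl, ht6, hcnt⟩ := hI.resolve_left (by omega)
      have htp : τ.nat 6 p = t p := by rw [ht6, if_neg (lt_irrefl p)]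
      have hcp : ∀ j, cntFrom G.N G.grp t p j =
          cntFrom G.N G.grp t (p + 1) j + if G.grp p = j ∧ t p ≠ 0 then 1 else 0 :=
        fun j => cntFrom_succ hp j
      -- the vector in which the digit at `p` is increased
      have hnew : ∀ t' : ℕ → ℕ, (∀ q, t' q = if q < p then 0 else if q = p then t p + 1 else t q) →
          t p + 1 ≤ 2 → (∀ j, cntFrom G.N G.grp t' 0 j = cntFrom G.N G.grp t (p + 1) j +
            if G.grp p = j then 1 else 0) ∧ ((t p = 0 → cntFrom G.N G.grp t p (G.grp p) <
              G.m (G.grp p)) → Adm G.N G.grp G.m t') ∧ val G.N t < val G.N t' ∧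
            ∀ u, Adm G.N G.grp G.m u → val G.N t < val G.N u → val G.N t' ≤ val G.N u := by
        intro t' ht' h2
        have h2' : ∀ q, t' q ≤ 2 := by
          intro q
          rw [ht']
          split_ifs
          · omega
          · exact h2
          · exact hadm.le_two q
        have hcnt' : ∀ j, cntFrom G.N G.grp t' 0 j = cntFrom G.N G.grp t (p + 1) j +
            if G.grp p = j then 1 else 0 := by
          intro j
          rw [cntFrom_zero_low (p := p) fun q hq => by rw [ht', if_pos hq], cntFrom_succ hp,
            cntFrom_congr (t' := t) fun q _ hq => by
              rw [ht', if_neg (by omega), if_neg (by omega)]]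
          have : t' p ≠ 0 := by rw [ht', if_neg (by omega), if_pos rfl]; omega
          simp [this]
        refine ⟨hcnt', fun hlt => ⟨h2', fun q hq => ?_, fun j => ?_⟩,
          no_between_of_blocked hp hbl ht' hadm.le_two h2'⟩
        · rw [ht', if_neg (by omega), if_neg (by omega), hadm.eq_zero q hq]
        · rw [hcnt']
          have h3 := hadm.cnt_le j
          have h4 := cntFrom_anti (N := G.N) (g := G.grp) (t := t) (Nat.zero_le p) j
          have h5 := hcp j
          by_cases hj : G.grp p = j
          · subst hj
            by_cases h0 : t p = 0
            · have := hlt h0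
              simp [h0] at h5 ⊢
              omega
            · simp [h0] at h5 ⊢
              omega
          · simp [hj] at h5 ⊢
            omega
      refine wp_ite hb hτ (by simp [Test.DivOk]) (fun h1 => ?_) (fun h1 => ?_)
      · simp only [Test.Holds, NExpr.eval, hv, htp] at h1
        refine wp_seq (wp_setNat hb hτ (by simp [NExpr.eval]) fun hτ₁ hF₁ => ?_)
        refine wp_setNat hb hτ₁ ((Nat.size_le_size (Nat.sub_le _ _)).trans (hτ₁.nat _ _))
          fun _ _ _ _ => ?_
        right
        refine ⟨by simpa using h, fun q hq => ?_, fun q => ?_, fun j hj => ?_⟩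
        · by_cases e : q = p
          · subst e; exact Or.inl h1
          · exact hbl q (by omega)
        · simp only [NExpr.eval, hv]
          by_cases e : q = p
          · simp [e]
          · simp [e, ht6, show q < p + 1 ↔ q < p by omega]
        · have h5 := hcp j
          simp only [NExpr.eval, hv]
          by_cases e : j = G.grp p
          · subst e
            simp [hv, hgp, hcnt _ hj, h5, h1]
          · simp [hv, hgp, e, hcnt _ hj, h5, Ne.symm e]
      · simp only [Test.Holds, NExpr.eval, hv, htp] at h1
        refine wp_ite hb hτ (by simp [Test.DivOk]) (fun h2 => ?_) (fun h2 => ?_)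
        · simp only [Test.Holds, NExpr.eval, hv, htp] at h2
          refine wp_seq (wp_setNat hb hτ ((size_le_self _).trans (by simp only [NExpr.eval]; omega))
            fun hτ₁ hF₁ => ?_)
          refine wp_setNat hb hτ₁ (by simpa [NExpr.eval] using hb) fun _ _ _ _ => ?_
          left
          obtain ⟨h3, h4, h5⟩ := hnew (fun q => if q < p then 0 else if q = p then t p + 1 else t q)
            (fun _ => rfl) (by omega)
          refine ⟨by simp [NExpr.eval], _, ⟨?_, h4 (by omega), fun j hj => ?_⟩, h5⟩
          · funext q
            simp only [NExpr.eval, hv]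
            by_cases e : q = p
            · simp [e, h2]
            · simp [e, ht6]
          · rw [h3]
            have h6 := hcp j
            simp only [h2, ne_eq, one_ne_zero, not_false_eq_true, and_true] at h6
            rw [← h6]
            simpa using hcnt j hj
        · simp only [Test.Holds, NExpr.eval, hv, htp] at h2
          have h0 : t p = 0 := by have := hadm.le_two p; omega
          refine wp_ite hb hτ (by simp [Test.DivOk]) (fun h3 => ?_) (fun h3 => ?_)
          · simp only [Test.Holds, NExpr.eval, hv, hgp, hcnt _ hgs, he'.m _ hgs] at h3
            refine wp_seq (wp_setNat hb hτ (by simpa [NExpr.eval] using hb) fun hτ₁ hF₁ => ?_)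
            have hmr := G.m_le (G.grp p)
            refine wp_seq (wp_setNat hb hτ₁ (hB.size_le ?_) fun hτ₂ hF₂ => ?_)
            · simp [NExpr.eval, hv, hgp, hcnt _ hgs]
              omega
            refine wp_setNat hb hτ₂ (by simpa [NExpr.eval] using hb) fun _ _ _ _ => ?_
            left
            obtain ⟨h4, h5, h6⟩ := hnew
              (fun q => if q < p then 0 else if q = p then t p + 1 else t q)
              (fun _ => rfl) (by omega)
            refine ⟨by simp [NExpr.eval], _, ⟨?_, h5 fun _ => h3, fun j hj => ?_⟩, h6⟩
            · funext q
              simp only [NExpr.eval, hv]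
              by_cases e : q = p
              · simp [e, h0]
              · simp [e, ht6]
            · rw [h4]
              have h7 := hcp j
              simp only [h0, ne_eq, not_true_eq_false, and_false, if_false, add_zero] at h7
              rw [← h7]
              simp only [NExpr.eval, hv]
              by_cases e : j = G.grp p
              · subst e
                simp [hv, hgp, hcnt _ hj]
              · simp [hv, hgp, e, hcnt _ hj, Ne.symm e]
          · simp only [Test.Holds, NExpr.eval, hv, hgp, hcnt _ hgs, he'.m _ hgs, not_lt] at h3
            have h7 : ∀ j, cntFrom G.N G.grp t p j = cntFrom G.N G.grp t (p + 1) j := by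
              intro j
              rw [hcp j]
              simp [h0]
            refine wp_skip hτ fun _ _ _ _ => ?_
            right
            refine ⟨by simpa using h, fun q hq => ?_, fun q => ?_, fun j hj => ?_⟩
            · by_cases e : q = p
              · subst e; exact Or.inr ⟨h0, by rw [← h7]; exact h3⟩
              · exact hbl q (by omega)
            · by_cases e : q = p
              · simp [e, htp, h0]
              · simp [ht6, show q < p + 1 ↔ q < p by omega]
            · rw [← h7]
              simpa using hcnt j hj
    · simp only [Test.Holds, NExpr.eval] at h
      obtain ⟨h1, t', ⟨h2, h3, h4⟩, h5⟩ := hI.resolve_right (fun h' => h h'.1)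
      refine wp_skip hτ fun _ _ _ _ => ?_
      left
      exact ⟨by simpa using h1, t', ⟨by simpa using h2, h3, by simpa using h4⟩, h5⟩
  · intro τ _ _ _ hI
    rcases hI with h | ⟨h, hbl, -, -⟩
    · exact Or.inl h
    · exact Or.inr ⟨by omega, fun u hu => no_later_of_blocked hbl hu⟩

end Specs

/-! ### The tables and the enumeration -/

/-- Computes the positions of the groups, the group of each variable, and the number of variables. -/
def groupTables : Prog :=
  .forTo 12 (.get 0 (.lit 0)) (.seq (.setNat 3 (gv 12) (gv 10))
    (.forTo 13 (.get 1 (gv 12)) (.seq (.setNat 7 (gv 10) (gv 12))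
      (.setNat 10 (.lit 0) (.add (gv 10) (.lit 1))))))

/-- Computes the relation `Q` and the numbers `m j`. -/
def productTables : Prog :=
  .forTo 11 rE (.seq (.setNat 18 (.lit 0) (.lit 0))
    (.forTo 12 (.get 0 (.lit 0)) (.ite (.natEq (.get 2 incAt) (.lit 1))
      (.seq (.setNat 4 incAt (gv 18))
        (.seq (.setNat 5 (gv 12) (.add (.get 5 (gv 12)) (gv 18)))
          (.setNat 18 (.lit 0) (.lit 1))))
      .skip)))

/-- The whole program: all admissible ternary vectors are tried in the order of `val`. The first one
is the zero vector, and the initial solution is zero with the value bound `0`, both of which are in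
the memory from the start. -/
def solve : Prog :=
  .seq groupTables (.seq productTables (.seq (.setNat 19 (.lit 0) (.lit 1))
    (.loop (.natEq (gv 19) (.lit 1)) (.seq tryChoice advance))))

/-- The memory before the execution: it holds the input and is zero elsewhere. -/
structure Start (G : Inst) (σ : Mem) : Prop extends Input G σ where
  nat_zero : ∀ a i, 3 ≤ a → σ.nat a i = 0
  rat_zero : ∀ a i, 1 ≤ a → σ.rat a i = 0

theorem Input.frame {G : Inst} {σ τ : Mem} {p : Prog} (h : Input G σ) (hF : Frame p σ τ)
    (hn : ∀ a ∈ [0, 1, 2], a ∉ p.natW) (hr : 0 ∉ p.ratW) : Input G τ :=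
  h.of_eq (fun a ha => hF.nat a (hn a ha)) (hF.rat 0 hr)

/-- The number of products before the product `i` that involve the group `j` and a group before
it. -/
noncomputable def Inst.cntQ (G : Inst) (i j : ℕ) : ℕ :=
  open Classical in ((Finset.range i).filter fun i' => G.Q i' j).card

theorem Inst.cntQ_succ (G : Inst) (i j : ℕ) [Decidable (G.Q i j)] :
    G.cntQ (i + 1) j = G.cntQ i j + if G.Q i j then 1 else 0 := by
  classical
  unfold cntQ
  rw [Finset.range_add_one, Finset.filter_insert]
  split_ifs with h
  · rw [Finset.card_insert_of_notMem (by simp)]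
  · rfl

theorem Inst.cntQ_le (G : Inst) (i j : ℕ) : G.cntQ i j ≤ i := by
  classical
  exact (Finset.card_filter_le _ _).trans (by simp)

section Specs

variable {G : Inst} {b K E F : ℕ} {σ : Mem}

theorem wp_groupTables (hB : Bounds G b K E F) (hσ : Bdd b σ) (hi : Input G σ)
    (h0 : σ.nat 10 0 = 0) :
    wp b K groupTables σ fun τ => τ.nat 10 0 = G.N ∧ (∀ j < G.s, τ.nat 3 j = G.off j) ∧
      ∀ j < G.s, ∀ k < G.n j, τ.nat 7 (G.off j + k) = j := by
  have hb := hB.one_le_b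
  have hK := hB.K_le
  have hs := hB.s_le
  refine wp_for hb hσ G.s (by omega) hB.le_b (by decide)
    (fun j τ => τ.nat 10 0 = G.off j ∧ (∀ j' < j, τ.nat 3 j' = G.off j') ∧
      ∀ p < G.off j, τ.nat 7 p = G.grp p) ?_ ?_ ?_ ?_
  · intro τ hF
    simp [NExpr.eval, hF.nat 0 (by decide), hi.s]
  · simp [h0, Inst.off]
  · intro j hj τ hτ hF hv hI
    have hi' : Input G τ := hi.frame hF (by decide) (by decide)
    have hnN := G.n_le_N hj
    refine wp_seq (wp_setNat hb hτ (hτ.nat _ _) fun hτ₁ hF₁ => ?_)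
    have hi₁ : Input G (τ.writeNat 3 _ _) := hi'.frame hF₁ (by decide) (by decide)
    refine wp_for hb hτ₁ (G.n j) (by omega) hB.le_b (by decide)
      (fun k υ => υ.nat 10 0 = G.off j + k ∧ (∀ j' < j + 1, υ.nat 3 j' = G.off j') ∧
        ∀ p < G.off j + k, υ.nat 7 p = G.grp p) ?_ ?_ ?_ ?_
    · intro υ hF'
      simp [NExpr.eval, hF'.nat 12 (by decide), hF'.nat 1 (by decide), hv, hi'.n j hj]
    · refine ⟨by simpa using hI.1, fun j' hj' => ?_, by simpa using hI.2.2⟩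
      by_cases e : j' = j
      · subst e; simp [NExpr.eval, hv, hI.1]
      · simpa [NExpr.eval, hv, e] using hI.2.1 j' (by omega)
    · intro k hk υ hυ hF' hv' hI'
      have hlt := G.off_add_lt hj hk
      have h12 : υ.nat 12 0 = j := by
        rw [hF'.nat 12 (by decide), hF₁.nat 12 (by decide), hv]
      refine wp_seq (wp_setNat hb hυ (hυ.nat _ _) fun hυ₁ hF₂ => ?_)
      refine wp_setNat hb hυ₁ (hB.size_le (by simp [NExpr.eval, hI'.1]; omega)) fun _ _ _ _ => ?_
      refine ⟨by simp [NExpr.eval, hI'.1, add_assoc], by simpa using hI'.2.1, fun p hp => ?_⟩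
      by_cases e : p = G.off j + k
      · subst e
        simp [NExpr.eval, hI'.1, h12, G.grp_off_add hj hk]
      · simpa [NExpr.eval, hI'.1, e] using hI'.2.2 p (by omega)
    · intro υ _ _ _ hI' _ _ _ _
      simpa [G.off_succ, Nat.lt_succ_iff] using hI'
  · intro τ _ _ _ hI
    refine ⟨hI.1, hI.2.1, fun j hj k hk => ?_⟩
    rw [hI.2.2 _ (G.off_add_lt hj hk), G.grp_off_add hj hk]

theorem wp_productTables (hB : Bounds G b K E F) (hσ : Bdd b σ) (hi : Input G σ)
    (h4 : ∀ p, σ.nat 4 p = 0) (h5 : ∀ p, σ.nat 5 p = 0) :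
    wp b K productTables σ fun τ =>
      (∀ i < G.r, ∀ j < G.s, (τ.nat 4 (i * G.s + j) = 1 ↔ G.Q i j)) ∧
        ∀ j < G.s, τ.nat 5 j = G.m j := by
  classical
  have hb := hB.one_le_b
  have hK := hB.K_le
  have hs := hB.s_le
  refine wp_for hb hσ G.r (by omega) hB.le_b (by decide)
    (fun i τ => (∀ i' j', j' < G.s → τ.nat 4 (i' * G.s + j') = if i' < i ∧ G.Q i' j' then 1 else 0) ∧
      ∀ j' < G.s, τ.nat 5 j' = G.cntQ i j') ?_ ?_ ?_ ?_
  · intro τ hF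
    simp [NExpr.eval, hF.nat 0 (by decide), hi.r]
  · simp [h4, h5, Inst.cntQ]
  · intro i hi_lt τ hτ hF hv hI
    have hi' : Input G τ := hi.frame hF (by decide) (by decide)
    refine wp_seq (wp_setNat hb hτ (by simp [NExpr.eval]) fun hτ₁ hF₁ => ?_)
    have hi₁ : Input G (τ.writeNat 18 _ _) := hi'.frame hF₁ (by decide) (by decide)
    refine wp_for hb hτ₁ G.s (by omega) hB.le_b (by decide)
      (fun j υ => (∀ i' j', j' < G.s → υ.nat 4 (i' * G.s + j') =
          if (i' < i ∨ (i' = i ∧ j' < j)) ∧ G.Q i' j' then 1 else 0) ∧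
        (∀ j' < G.s, υ.nat 5 j' = G.cntQ i j' + if j' < j ∧ G.Q i j' then 1 else 0) ∧
        υ.nat 18 0 = if ∃ l < j, G.inc i l = 1 then 1 else 0) ?_ ?_ ?_ ?_
    · intro υ hF'
      simp [NExpr.eval, hF'.nat 0 (by decide), hi'.s]
    · refine ⟨by simpa using hI.1, by simpa using hI.2, by simp [NExpr.eval]⟩
    · intro j hj υ hυ hF' hv' hI'
      have hi₂ : Input G υ := hi₁.frame hF' (by decide) (by decide)
      have h11 : υ.nat 11 0 = i := by
        rw [hF'.nat 11 (by decide), hF₁.nat 11 (by decide), hv]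
      have hinc := hi₂.inc i hi_lt j hj
      obtain ⟨hI1, hI2, hI3⟩ := hI'
      refine wp_ite hb hυ (by simp [Test.DivOk]) (fun h => ?_) (fun h => ?_)
      · simp only [Test.Holds, NExpr.eval, hv', h11, hi₂.s, hinc] at h
        have hq : G.Q i j ↔ ∃ l < j, G.inc i l = 1 := by simp [Inst.Q, h]
        replace hI3 := hI3.trans (if_congr hq.symm rfl rfl)
        refine wp_seq (wp_setNat hb hυ (hυ.nat _ _) fun hυ₁ hF₂ => ?_)
        refine wp_seq (wp_setNat hb hυ₁ (hB.size_le ?_) fun hυ₂ hF₃ => ?_)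
        · have hc := G.cntQ_le i j
          simp only [NExpr.eval]
          simp [hv', hI2 j hj, hI3]
          split_ifs <;> omega
        refine wp_setNat hb hυ₂ (by simpa [NExpr.eval] using hb) fun _ _ _ _ => ?_
        refine ⟨fun i' j' hj' => ?_, fun j' hj' => ?_, ?_⟩
        · by_cases e : i' * G.s + j' = i * G.s + j
          · obtain ⟨rfl, rfl⟩ := flat_inj hj' hj e
            simp [NExpr.eval, h11, hi₂.s, hv', hI3]
          · have hne : ¬ (i' = i ∧ j' = j) := by rintro ⟨rfl, rfl⟩; exact e rfl
            have hiff : (i' < i ∨ (i' = i ∧ j' < j + 1)) ↔ (i' < i ∨ (i' = i ∧ j' < j)) := by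
              omega
            rw [if_congr (and_congr_left' hiff) rfl rfl]
            simp [NExpr.eval, h11, hi₂.s, hv', e, hI1 i' j' hj']
        · by_cases e : j' = j
          · subst e
            simp [NExpr.eval, hv', hI2 _ hj', hI3]
          · have hiff : j' < j + 1 ↔ j' < j := by omega
            rw [if_congr (and_congr_left' hiff) rfl rfl]
            simp [NExpr.eval, hv', e, hI2 _ hj']
        · have : ∃ l < j + 1, G.inc i l = 1 := ⟨j, by omega, h⟩
          rw [if_pos this]
          simp [NExpr.eval]
      · simp only [Test.Holds, NExpr.eval, hv', h11, hi₂.s, hinc] at h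
        have hq : ¬ G.Q i j := fun hq => h hq.1
        refine wp_skip hυ fun _ _ _ _ => ?_
        refine ⟨fun i' j' hj' => ?_, fun j' hj' => ?_, ?_⟩
        · have hiff : ((i' < i ∨ (i' = i ∧ j' < j + 1)) ∧ G.Q i' j') ↔
              ((i' < i ∨ (i' = i ∧ j' < j)) ∧ G.Q i' j') := by
            by_cases e : i' = i ∧ j' = j
            · obtain ⟨rfl, rfl⟩ := e
              simp [hq]
            · have : (i' < i ∨ (i' = i ∧ j' < j + 1)) ↔ (i' < i ∨ (i' = i ∧ j' < j)) := by omega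
              rw [this]
          rw [Mem.writeNat_nat_ne _ _ _ (by decide), hI1 i' j' hj']
          exact if_congr hiff.symm rfl rfl
        · have hiff : (j' < j + 1 ∧ G.Q i j') ↔ (j' < j ∧ G.Q i j') := by
            by_cases e : j' = j
            · subst e; simp [hq]
            · have : j' < j + 1 ↔ j' < j := by omega
              rw [this]
          rw [Mem.writeNat_nat_ne _ _ _ (by decide), hI2 j' hj', if_congr hiff.symm rfl rfl]
        · have hiff : (∃ l < j + 1, G.inc i l = 1) ↔ ∃ l < j, G.inc i l = 1 := by
            constructor
            · rintro ⟨l, hl, h'⟩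
              refine ⟨l, ?_, h'⟩
              rcases Nat.lt_succ_iff_lt_or_eq.1 hl with h'' | rfl
              · exact h''
              · exact absurd h' h
            · rintro ⟨l, hl, h'⟩
              exact ⟨l, by omega, h'⟩
          rw [Mem.writeNat_nat_ne _ _ _ (by decide), hI3]
          exact if_congr hiff.symm rfl rfl
    · intro υ _ _ _ hI' _ _ _ _
      obtain ⟨hI1, hI2, -⟩ := hI'
      refine ⟨fun i' j' hj' => ?_, fun j' hj' => ?_⟩
      · have hiff : (i' < i ∨ (i' = i ∧ j' < G.s)) ↔ i' < i + 1 := by omega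
        simp [hI1 i' j' hj', hiff]
      · simp [hI2 j' hj', hj', Inst.cntQ_succ]
  · intro τ _ _ _ hI
    refine ⟨fun i hi' j hj => ?_, fun j hj => ?_⟩
    · rw [hI.1 i j hj]
      simp [hi']
    · rw [hI.2 j hj]
      rfl

/-- The state of the enumeration before the ternary vector `t` is tried: all smaller admissible
vectors have been tried. -/
structure Visited (G : Inst) (t : ℕ → ℕ) (σ : Mem) : Prop extends Env G σ, Choice G t σ where
  bin : ∀ p, σ.rat 4 p = 0 ∨ σ.rat 4 p = 1
  out : ∀ p, σ.rat 1 p = 0 ∨ σ.rat 1 p = 1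
  best : σ.rat 7 0 ≤ G.obj (outOf G σ)
  visited : ∀ u, Adm G.N G.grp G.m u → val G.N u < val G.N t →
    ∃ x, G.RoundsFrom 0 (G.unflat u) x ∧ G.obj x ≤ σ.rat 7 0

/-- The state after the enumeration: all admissible vectors have been tried. -/
structure Complete (G : Inst) (σ : Mem) : Prop where
  out : ∀ p, σ.rat 1 p = 0 ∨ σ.rat 1 p = 1
  le : ∀ u, Adm G.N G.grp G.m u →
    ∃ x, G.RoundsFrom 0 (G.unflat u) x ∧ G.obj x ≤ G.obj (outOf G σ)

theorem Adm.eq_of_val_eq {N : ℕ} {g m t u : ℕ → ℕ} (ht : Adm N g m t) (hu : Adm N g m u)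
    (h : val N t = val N u) : t = u := by
  funext p
  by_cases hp : p < N
  · exact val_inj ht.le_two hu.le_two h p hp
  · rw [ht.eq_zero p (by omega), hu.eq_zero p (by omega)]

/-- One repetition of the main loop. -/
theorem wp_tryChoice_advance (hB : Bounds G b K E F) (hσ : Bdd b σ) {t : ℕ → ℕ}
    (h : Visited G t σ) :
    wp b K (.seq tryChoice advance) σ fun τ =>
      (τ.nat 19 0 = 1 ∧ ∃ t', Visited G t' τ ∧ val G.N t < val G.N t') ∨
      (τ.nat 19 0 ≠ 1 ∧ Complete G τ) := by
  have he := h.toEnv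
  refine wp_seq ((wp_tryChoice hB hσ he h.bin h.out h.best).imp ?_)
  rintro τ₁ hτ₁ hF₁ ⟨hbin, hout, hbest, hmono, x, hx, hxle⟩ _ _
  have he₁ : Env G τ₁ := he.frame hF₁ (by decide) (by decide)
  have hc₁ : Choice G t τ₁ := ⟨by rw [hF₁.nat 6 (by decide), h.t_eq], h.adm,
    by rw [hF₁.nat 8 (by decide)]; exact h.cnt⟩
  have hxt : G.RoundsFrom 0 (G.unflat t) x := by
    rw [← h.t_eq]; exact hx
  have hvis : ∀ u, Adm G.N G.grp G.m u → val G.N u ≤ val G.N t →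
      ∃ x, G.RoundsFrom 0 (G.unflat u) x ∧ G.obj x ≤ τ₁.rat 7 0 := by
    intro u hu hle
    rcases hle.lt_or_eq with hlt | heq
    · obtain ⟨x', h1, h2⟩ := h.visited u hu hlt
      exact ⟨x', h1, h2.trans hmono⟩
    · rw [hu.eq_of_val_eq h.adm heq]
      exact ⟨x, hxt, hxle⟩
  refine (wp_advance hB hτ₁ he₁ hc₁).imp fun τ₂ hτ₂ hF₂ hpost => ?_
  have he₂ : Env G τ₂ := he₁.frame hF₂ (by decide) (by decide)
  have hr1 : τ₂.rat 1 = τ₁.rat 1 := hF₂.rat 1 (by decide)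
  have hr4 : τ₂.rat 4 = τ₁.rat 4 := hF₂.rat 4 (by decide)
  have hr7 : τ₂.rat 7 = τ₁.rat 7 := hF₂.rat 7 (by decide)
  have ho : outOf G τ₂ = outOf G τ₁ := by unfold outOf; rw [hr1]
  rcases hpost with ⟨h19, t', hc', hlt, hmin⟩ | ⟨h19, hmax⟩
  · refine Or.inl ⟨h19, t', ⟨he₂, hc', by rwa [hr4], by rwa [hr1], by rwa [hr7, ho], ?_⟩, hlt⟩
    intro u hu hlt'
    rw [hr7]
    refine hvis u hu ?_
    by_contra hcon
    have := hmin u hu (by omega)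
    omega
  · refine Or.inr ⟨h19, by rwa [hr1], fun u hu => ?_⟩
    obtain ⟨x', h1, h2⟩ := hvis u hu (not_lt.1 (hmax u hu))
    exact ⟨x', h1, h2.trans (by rw [ho]; exact hbest)⟩

/-- Each repetition of the main loop moves on to a larger vector, so that `R` bounds the number of
repetitions if it bounds the number of admissible vectors from `t` on. -/
theorem runs_loop (hB : Bounds G b K E F) (hn : ∀ j < G.s, 1 ≤ G.n j) (R : ℕ) :
    ∀ (σ : Mem) (t : ℕ → ℕ), Bdd b σ → Visited G t σ → σ.nat 19 0 = 1 →
      {u | Adm G.N G.grp G.m u ∧ val G.N t ≤ val G.N u}.ncard ≤ R →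
      ∃ T τ, Runs ((Prog.loop (.natEq (gv 19) (.lit 1)) (.seq tryChoice advance)).wt * b)
        (.loop (.natEq (gv 19) (.lit 1)) (.seq tryChoice advance)) σ T τ ∧
        T ≤ R * (5 + (Prog.seq tryChoice advance).time.eval K) + 5 ∧ Complete G τ := by
  have hb := hB.one_le_b
  have hfin := (Inst.adm_finite_card hn).1
  induction R with
  | zero =>
    intro σ t hσ h h19 hR
    have hf : {u | Adm G.N G.grp G.m u ∧ val G.N t ≤ val G.N u}.Finite :=
      hfin.subset fun u hu => hu.1
    rw [Nat.le_zero, Set.ncard_eq_zero hf] at hR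
    have : t ∈ {u | Adm G.N G.grp G.m u ∧ val G.N t ≤ val G.N u} := ⟨h.adm, le_rfl⟩
    rw [hR] at this
    exact this.elim
  | succ R ih =>
    intro σ t hσ h h19 hR
    have hf : {u | Adm G.N G.grp G.m u ∧ val G.N t ≤ val G.N u}.Finite :=
      hfin.subset fun u hu => hu.1
    have htest : ∀ τ, Bdd b τ → (Test.natEq (gv 19) (.lit 1)).Ok
        ((Prog.loop (.natEq (gv 19) (.lit 1)) (.seq tryChoice advance)).wt * b) τ := fun τ hτ =>
      (Test.ok_of_bdd hb hτ _ (by simp [Test.DivOk])).mono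
        (Nat.mul_le_mul_right _ (by simp only [Prog.wt]; omega))
    have hcost : (Test.natEq (gv 19) (.lit 1)).cost + 1 = 5 := by simp [Test.cost, NExpr.cost]
    obtain ⟨T₁, τ, hrun, hT₁, hτ, hpost⟩ := wp_tryChoice_advance hB hσ h
    have hrun' := hrun.mono (B' :=
      (Prog.loop (.natEq (gv 19) (.lit 1)) (.seq tryChoice advance)).wt * b)
      (Nat.mul_le_mul_right _ (Nat.le_add_left _ _))
    rcases hpost with ⟨h19', t', hv', hlt⟩ | ⟨h19', hcomp⟩
    · have hcard : {u | Adm G.N G.grp G.m u ∧ val G.N t' ≤ val G.N u}.ncard <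
          {u | Adm G.N G.grp G.m u ∧ val G.N t ≤ val G.N u}.ncard := by
        refine Set.ncard_lt_ncard ⟨fun u hu => ⟨hu.1, hlt.le.trans hu.2⟩, fun hsub => ?_⟩ hf
        have := (hsub (show t ∈ _ from ⟨h.adm, le_rfl⟩)).2
        omega
      obtain ⟨T₂, υ, hrun₂, hT₂, hcomp⟩ := ih τ t' hτ hv' h19' (by omega)
      refine ⟨_, υ, .loopStep (htest σ hσ) h19 hrun' hrun₂, ?_, hcomp⟩
      rw [hcost, add_mul, one_mul]
      omega
    · refine ⟨_, τ, .loopStep (htest σ hσ) h19 hrun' (.loopDone (htest τ hτ) h19'), ?_, hcomp⟩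
      rw [hcost, add_mul, one_mul]
      omega

/-- The initial value bound `0` is correct for the initial solution: each product that involves some
group vanishes, and the others are `1`. -/
theorem Inst.obj_nonneg_of_eq_zero {x : ℕ → ℕ → ℚ} (hx : ∀ j k, x j k = 0) : 0 ≤ G.obj x := by
  refine Finset.sum_nonneg fun i _ => Finset.prod_nonneg fun j _ => ?_
  unfold Inst.fac
  split_ifs <;> simp [hx]

/-- The program is correct, and its time is that of the tables plus, for each ternary vector, that of
one repetition of the main loop. -/
theorem runs_solve (hB : Bounds G b K E F) (hn : ∀ j < G.s, 1 ≤ G.n j) (hσ : Bdd b σ)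
    (h : Start G σ) :
    ∃ T τ, Runs (solve.wt * b) solve σ T τ ∧
      T ≤ (groupTables.time + productTables.time + 4).eval K +
        (∏ j ∈ Finset.range G.s, 8 * G.n j ^ G.m j) *
          (5 + (Prog.seq tryChoice advance).time.eval K) + 5 ∧
      (∀ p, τ.rat 1 p = 0 ∨ τ.rat 1 p = 1) ∧
      ∀ y, G.Binary y → G.obj y ≤ G.obj (outOf G τ) := by
  have hb := hB.one_le_b
  -- the tables
  obtain ⟨T₁, τ₁, hrun₁, hT₁, hτ₁, hN, hoff, hgrp⟩ :=
    wp_groupTables hB hσ h.toInput (h.nat_zero 10 0 (by decide))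
  have hF₁ := hrun₁.frame
  obtain ⟨T₂, τ₂, hrun₂, hT₂, hτ₂, hq, hm⟩ := wp_productTables hB hτ₁
    (h.toInput.frame hF₁ (by decide) (by decide))
    (fun p => by rw [hF₁.nat 4 (by decide), h.nat_zero 4 p (by decide)])
    (fun p => by rw [hF₁.nat 5 (by decide), h.nat_zero 5 p (by decide)])
  have hF₂ := hrun₂.frame
  have he₂ : Env G τ₂ := {
    toInput := (h.toInput.frame hF₁ (by decide) (by decide)).frame hF₂ (by decide) (by decide)
    off := by rw [hF₂.nat 3 (by decide)]; exact hoff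
    q := hq
    m := hm
    grp := by rw [hF₂.nat 7 (by decide)]; exact hgrp
    N := by rw [hF₂.nat 10 (by decide)]; exact hN }
  obtain ⟨T₃, τ₃, hrun₃, hT₃, hτ₃, rfl⟩ := wp_setNat (K := K) (a := 19) (i := .lit 0) (e := .lit 1)
    hb hτ₂ (by simpa [NExpr.eval] using hb) (Q := fun τ => τ = τ₂.writeNat 19 0 1) rfl
  have hr : ∀ a p, 1 ≤ a → a ∉ groupTables.ratW → a ∉ productTables.ratW → τ₂.rat a p = 0 := by
    intro a p ha h1 h2
    rw [hF₂.rat a h2, hF₁.rat a h1, h.rat_zero a p ha]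
  have hz : ∀ a p, 3 ≤ a → a ∉ groupTables.natW → a ∉ productTables.natW → τ₂.nat a p = 0 := by
    intro a p ha h1 h2
    rw [hF₂.nat a h2, hF₁.nat a h1, h.nat_zero a p ha]
  have hadm : Adm G.N G.grp G.m fun _ => 0 := ⟨by simp, by simp, by simp [cntFrom]⟩
  have hV : Visited G (fun _ => 0) (τ₂.writeNat 19 0 1) := {
    toEnv := he₂.of_eq (by simp) (by simp)
    t_eq := by
      funext p
      simpa using hz 6 p (by decide) (by decide) (by decide)
    adm := hadm
    cnt := fun j hj => by
      simpa [cntFrom] using hz 8 j (by decide) (by decide) (by decide)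
    bin := fun p => Or.inl (by simpa using hr 4 p (by decide) (by decide) (by decide))
    out := fun p => Or.inl (by simpa using hr 1 p (by decide) (by decide) (by decide))
    best := by
      have h7 : (τ₂.writeNat 19 0 1).rat 7 0 = 0 := by
        simpa using hr 7 0 (by decide) (by decide) (by decide)
      rw [h7]
      refine Inst.obj_nonneg_of_eq_zero fun j k => ?_
      simpa [outOf] using hr 1 (G.off j + k) (by decide) (by decide) (by decide)
    visited := fun u _ hu => by simp [val] at hu }
  obtain ⟨T₄, τ₄, hrun₄, hT₄, hcomp⟩ := runs_loop hB hn _ _ _ hτ₃ hV (by simp)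
    ((Set.ncard_le_ncard (fun u hu => hu.1) (Inst.adm_finite_card hn).1).trans
      (Inst.adm_finite_card hn).2)
  refine ⟨_, τ₄, .seq (hrun₁.mono ?_) (.seq (hrun₂.mono ?_) (.seq (hrun₃.mono ?_)
    (hrun₄.mono ?_))), ?_, hcomp.out, fun y hy => ?_⟩
  · exact Nat.mul_le_mul_right _ (by simp only [solve, Prog.wt]; omega)
  · exact Nat.mul_le_mul_right _ (by simp only [solve, Prog.wt]; omega)
  · exact Nat.mul_le_mul_right _ (by simp only [solve, Prog.wt]; omega)
  · exact Nat.mul_le_mul_right _ (by simp only [solve, Prog.wt]; omega)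
  · have : T₃ ≤ 4 := hT₃.trans (by simp [Prog.time, NExpr.cost])
    simp only [Polynomial.eval_add, Polynomial.eval_ofNat]
    omega
  · -- an optimal solution is the rounding of some admissible vector
    obtain ⟨t, ht, y₀, hy₀, hopt, hround⟩ := G.exists_admissible 0 (Nat.zero_le _)
    obtain ⟨u, hu, rfl⟩ := ht.exists_adm
    obtain ⟨x, hx, hxle⟩ := hcomp.le u hu
    calc G.obj y ≤ G.obj y₀ := hopt y hy
      _ = G.obj x := (Inst.obj_congr fun j hj k hk => hround x hx j (Nat.zero_le _) hj k hk).symm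
      _ ≤ _ := hxle

end Specs

/-! ### The problem as an instance indexed by natural numbers -/

namespace Data

variable (P : Data)

/-- The problem with its data extended by zeros to all indices. -/
def inst : Inst where
  s := P.s
  r := P.r
  n j := if h : j < P.s then P.n ⟨j, h⟩ else 0
  inc i j := if h : i < P.r ∧ j < P.s then (if ⟨j, h.2⟩ ∈ P.I ⟨i, h.1⟩ then 1 else 0) else 0
  c i j k := if h : i < P.r ∧ j < P.s then
    (if h' : k < P.n ⟨j, h.2⟩ then P.entry ⟨i, h.1⟩ ⟨j, h.2⟩ ⟨k, h'⟩ else 0) else 0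
  c_eq_zero i j k h := by
    split_ifs with h1 h2
    · rw [dif_pos h1] at h
      rw [entry, if_neg fun h3 => h (if_pos h3)]
    · rfl
    · rfl

@[simp] theorem inst_s : P.inst.s = P.s := rfl

@[simp] theorem inst_r : P.inst.r = P.r := rfl

@[simp] theorem inst_n (j : Fin P.s) : P.inst.n j = P.n j := by
  simp [inst]

@[simp] theorem inst_inc (i : Fin P.r) (j : Fin P.s) :
    P.inst.inc i j = if j ∈ P.I i then 1 else 0 := by
  simp [inst]

@[simp] theorem inst_c (i : Fin P.r) (j : Fin P.s) (k : Fin (P.n j)) :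
    P.inst.c i j k = P.entry i j k := by
  simp [inst]

theorem inst_off (j : Fin P.s) (k : Fin (P.n j)) : P.inst.off j + k = P.pos j k := by
  rw [pos, finSigmaFinEquiv_apply, Inst.off, Finset.sum_range]
  congr 1
  exact Finset.sum_congr rfl fun i _ => P.inst_n (Fin.castLE j.2.le i)

theorem inst_N : P.inst.N = ∑ j, P.n j := by
  rw [Inst.N, Inst.off, inst_s, Finset.sum_range]
  exact Finset.sum_congr rfl fun i _ => P.inst_n i

theorem inst_obj {x : (j : Fin P.s) → Fin (P.n j) → ℚ} {X : ℕ → ℕ → ℚ}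
    (h : ∀ j k, X (j : Fin P.s) (k : Fin (P.n j)) = x j k) : P.inst.obj X = P.objective x := by
  rw [Inst.obj, objective, inst_r, Finset.sum_range]
  refine Finset.sum_congr rfl fun i _ => ?_
  rw [inst_s, Finset.prod_range, ← Fintype.prod_ite_mem (P.I i)]
  refine Finset.prod_congr rfl fun j _ => ?_
  rw [Inst.fac, inst_inc]
  by_cases hj : j ∈ P.I i
  · rw [if_pos hj, if_pos hj, if_pos rfl, inst_n, Finset.sum_range]
    refine Finset.sum_congr rfl fun k _ => ?_
    rw [inst_c, h, entry, if_pos hj]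
  · rw [if_neg hj, if_neg hj, if_neg (by decide)]

theorem inst_Q (i : Fin P.r) (j : Fin P.s) :
    P.inst.Q i j ↔ j ∈ P.I i ∧ ∃ l ∈ P.I i, l < j := by
  rw [Inst.Q, inst_inc]
  refine and_congr (by simp) ⟨?_, ?_⟩
  · rintro ⟨l, hl, h⟩
    have h' := P.inst_inc i ⟨l, hl.trans j.2⟩
    simp only [h] at h'
    refine ⟨⟨l, hl.trans j.2⟩, ?_, hl⟩
    by_contra hcon
    simp [hcon] at h'
  · rintro ⟨l, hl, h⟩
    exact ⟨l, h, by simp [hl]⟩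

theorem inst_m (j : Fin P.s) : P.inst.m j = P.m j := by
  classical
  rw [Inst.m, m, ← Finset.card_map Fin.valEmbedding]
  congr 1
  ext i
  simp only [inst_r, Finset.mem_filter, Finset.mem_range, Finset.mem_map, Finset.mem_univ,
    true_and, Fin.valEmbedding_apply]
  constructor
  · rintro ⟨hi, h⟩
    exact ⟨⟨i, hi⟩, (P.inst_Q ⟨i, hi⟩ j).1 h, rfl⟩
  · rintro ⟨i, h, rfl⟩
    exact ⟨i.2, (P.inst_Q i j).2 h⟩

theorem input_inc (i : Fin P.r) (j : Fin P.s) {p : ℕ} (hp : p = finProdFinEquiv (i, j)) :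
    P.input.nat 2 p = if j ∈ P.I i then 1 else 0 := by
  subst hp
  unfold input
  dsimp only
  rw [if_neg (by decide), if_neg (by decide), if_pos rfl, dif_pos (Fin.is_lt _), Fin.eta,
    Equiv.symm_apply_apply]

theorem input_coef (i : Fin P.r) (j : Fin P.s) (k : Fin (P.n j)) {p : ℕ}
    (hp : p = finProdFinEquiv (i, finSigmaFinEquiv (⟨j, k⟩ : (j : Fin P.s) × Fin (P.n j)))) :
    P.input.rat 0 p = P.entry i j k := by
  subst hp
  unfold input
  dsimp only
  rw [if_pos rfl, dif_pos (Fin.is_lt _), Fin.eta, Equiv.symm_apply_apply,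
    Equiv.symm_apply_apply]

theorem start_input : Start P.inst P.input where
  s := rfl
  r := rfl
  n j hj := by
    have hj : j < P.s := hj
    simp [input, inst, hj]
  inc i hi j hj := by
    rw [P.inst_inc ⟨i, hi⟩ ⟨j, hj⟩]
    refine P.input_inc _ _ ?_
    simp [finProdFinEquiv]
    ring
  c i hi j hj k hk := by
    have hk' : k < P.n ⟨j, hj⟩ := by
      have := P.inst_n ⟨j, hj⟩
      simp only at this
      omega
    have hp := P.inst_off ⟨j, hj⟩ ⟨k, hk'⟩
    rw [P.inst_c ⟨i, hi⟩ ⟨j, hj⟩ ⟨k, hk'⟩]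
    refine P.input_coef _ _ _ ?_
    simp only at hp
    rw [inst_N, hp]
    simp [finProdFinEquiv, pos]
    ring
  nat_zero a i ha := by
    simp only [input]
    rw [if_neg (by omega), if_neg (by omega), if_neg (by omega)]
  rat_zero a i ha := by
    simp only [input]
    rw [if_neg (by omega)]

/-! ### Sizes -/

theorem ratSize_entry_le (i : Fin P.r) (j : Fin P.s) (k : Fin (P.n j)) :
    ratSize (P.entry i j k) ≤ P.size := by
  have h1 := Finset.single_le_sum (f := fun k => ratSize (P.entry i j k))
    (fun _ _ => Nat.zero_le _) (Finset.mem_univ k)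
  have h2 := Finset.single_le_sum (f := fun j => ∑ k, ratSize (P.entry i j k))
    (fun _ _ => Nat.zero_le _) (Finset.mem_univ j)
  have h3 := Finset.single_le_sum (f := fun i => ∑ j, ∑ k, ratSize (P.entry i j k))
    (fun _ _ => Nat.zero_le _) (Finset.mem_univ i)
  unfold size
  omega

theorem r_mul_numVars_le : P.r * P.inst.N ≤ ∑ i, ∑ j, ∑ k, ratSize (P.entry i j k) := by
  have h : ∑ i : Fin P.r, ∑ j : Fin P.s, ∑ _k : Fin (P.n j), 1 = P.r * P.inst.N := by
    simp [inst_N]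
  rw [← h]
  exact Finset.sum_le_sum fun i _ => Finset.sum_le_sum fun j _ => Finset.sum_le_sum fun k _ =>
    one_le_ratSize _

theorem N_le_size : P.inst.N ≤ P.size := by
  have h1 := P.r_mul_numVars_le
  have h2 : P.inst.N ≤ P.r * P.inst.N := Nat.le_mul_of_pos_left _ P.r_pos
  unfold size
  omega

theorem r_le_size : P.r ≤ P.size := by
  have h2 : P.r ≤ P.r * P.s := Nat.le_mul_of_pos_right _ P.s_pos
  unfold size
  omega

theorem s_le_N : P.s ≤ P.inst.N := by
  rw [inst_N]
  calc P.s = ∑ _j : Fin P.s, 1 := by simp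
    _ ≤ _ := Finset.sum_le_sum fun j _ => P.n_pos j

theorem two_le_size : 2 ≤ P.size := by
  have h1 : 1 ≤ Nat.size P.s := Nat.size_pos.2 P.s_pos
  have h2 : 1 ≤ Nat.size P.r := Nat.size_pos.2 P.r_pos
  unfold size
  omega

theorem input_bdd : Bdd P.size P.input where
  nat a i := by
    have h2 := P.two_le_size
    have hs : Nat.size P.s ≤ P.size := by unfold size; omega
    have hr : Nat.size P.r ≤ P.size := by unfold size; omega
    have hn : ∀ j, Nat.size (P.n j) ≤ P.size := fun j => by
      have := Finset.single_le_sum (f := fun j => Nat.size (P.n j))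
        (fun _ _ => Nat.zero_le _) (Finset.mem_univ j)
      unfold size
      omega
    simp only [input]
    split_ifs
    all_goals first | assumption | exact hn _ | (simp; done) | (simp; omega)
  rat a i := by
    have h2 := P.two_le_size
    simp only [input]
    split_ifs
    · exact P.ratSize_entry_le _ _ _
    · rwa [ratSize_zero]
    · rwa [ratSize_zero]

/-- A common denominator of the coefficients. -/
def commonDen : ℕ := ∏ i, ∏ j, ∏ k, (P.entry i j k).den

theorem commonDen_pos : 1 ≤ P.commonDen :=
  Finset.prod_pos fun _ _ => Finset.prod_pos fun _ _ => Finset.prod_pos fun _ _ => Rat.den_pos _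

theorem commonDen_le : P.commonDen ≤ 2 ^ P.size := by
  have h : P.commonDen ≤ 2 ^ ∑ i, ∑ j, ∑ k, ratSize (P.entry i j k) := by
    simp only [← Finset.prod_pow_eq_pow_sum]
    refine Finset.prod_le_prod' fun i _ => Finset.prod_le_prod' fun j _ =>
      Finset.prod_le_prod' fun k _ => (Nat.lt_size_self _).le.trans ?_
    exact Nat.pow_le_pow_right (by decide) (by unfold ratSize; omega)
  exact h.trans (Nat.pow_le_pow_right (by decide) (by unfold size; omega))

theorem fracLe_entry (i : Fin P.r) (j : Fin P.s) (k : Fin (P.n j)) :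
    FracLe P.commonDen (2 ^ (2 * P.size)) (P.entry i j k) := by
  have hdvd : (P.entry i j k).den ∣ P.commonDen :=
    ((Finset.dvd_prod_of_mem (fun k => (P.entry i j k).den) (Finset.mem_univ k)).trans
      (Finset.dvd_prod_of_mem (fun j => ∏ k, (P.entry i j k).den) (Finset.mem_univ j))).trans
      (Finset.dvd_prod_of_mem (fun i => ∏ j, ∏ k, (P.entry i j k).den) (Finset.mem_univ i))
  obtain ⟨e, he⟩ := hdvd
  have hsize := P.ratSize_entry_le i j k
  set q := P.entry i j k
  refine ⟨q.num * e, ?_, ?_⟩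
  · rw [he]
    push_cast
    rw [← mul_assoc, Rat.mul_den_eq_num]
  · rw [Int.natAbs_mul, Int.natAbs_natCast, two_mul, pow_add]
    have he' : e ≤ P.commonDen := by
      rw [he]; exact Nat.le_mul_of_pos_left _ q.den_pos
    refine Nat.mul_le_mul ((Nat.lt_size_self _).le.trans (Nat.pow_le_pow_right (by decide) ?_))
      (he'.trans P.commonDen_le)
    unfold ratSize at hsize
    omega

end Data

/-- Fractions with different powers of `D` as denominators are brought to the same denominator. -/
theorem FracLe.pad {D A a e : ℕ} {x : ℚ} (h : FracLe (D ^ a) (A ^ a) x) (hDA : D ≤ A) (hae : a ≤ e) :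
    FracLe (D ^ e) (A ^ e) x := by
  obtain ⟨d, rfl⟩ := Nat.exists_eq_add_of_le hae
  rw [pow_add, pow_add]
  exact (h.scale (D ^ d)).mono (Nat.mul_le_mul_left _ (Nat.pow_le_pow_left hDA d))

theorem FracLe.prod {ι : Type*} (s : Finset ι) {D A : ℕ} {f : ι → ℚ}
    (h : ∀ i ∈ s, FracLe D A (f i)) : FracLe (D ^ s.card) (A ^ s.card) (∏ i ∈ s, f i) := by
  classical
  induction s using Finset.induction_on with
  | empty => exact ⟨1, by simp, by simp⟩
  | insert i s hi ih =>
    rw [Finset.prod_insert hi, Finset.card_insert_of_notMem hi, pow_succ', pow_succ']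
    exact (h i (by simp)).mul (ih fun j hj => h j (by simp [hj]))

/-- With a common denominator `D` of the coefficients, every part of a product is a fraction with
denominator `D ^ s`, and its numerator is bounded accordingly; so the sizes are polynomial in `L`. -/
theorem bounds_of_fracLe {G : Inst} {D L : ℕ} (hs : 1 ≤ G.s) (hsN : G.s ≤ G.N) (hN : G.N ≤ L)
    (hr : G.r ≤ L) (hD : 1 ≤ D) (hDL : D ≤ 2 ^ L)
    (hc : ∀ i < G.r, ∀ j < G.s, ∀ k < G.n j, FracLe D (2 ^ (2 * L)) (G.c i j k)) :
    Bounds G (2 * (1 + 2 * ((2 * L + 2) * (5 * L ^ 2 + 5 * L + 5)))) (G.N + G.r + 1) (D ^ G.s)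
      ((G.N + G.r + 1) * ((G.N + G.r + 1) * 2 ^ (2 * L)) ^ G.s) := by
  set K := G.N + G.r + 1 with hK
  set A := K * 2 ^ (2 * L) with hA
  have hKL : K ≤ 2 * L + 1 := by omega
  have hDA₀ : D ≤ 2 ^ (2 * L) := hDL.trans (Nat.pow_le_pow_right (by decide) (by omega))
  have hA₀ : 2 ^ (2 * L) ≤ A := Nat.le_mul_of_pos_left _ (by omega)
  have hDA : D ≤ A := hDA₀.trans hA₀
  have hAF : A ^ G.s ≤ K * A ^ G.s := Nat.le_mul_of_pos_left _ (by omega)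
  have hc1 : ∀ i < G.r, ∀ j < G.s, ∀ k < G.n j, FracLe (D ^ 1) (A ^ 1) (G.c i j k) :=
    fun i hi j hj k hk => by simpa using (hc i hi j hj k hk).mono hA₀
  have hpart : ∀ x, G.Binary x → ∀ i < G.r, ∀ j < G.s, ∀ k ≤ G.n j,
      FracLe (D ^ 1) (A ^ 1) (∑ k' ∈ Finset.range k, G.c i j k' * x j k') := by
    intro x hx i hi j hj k hk
    have h := FracLe.sum (Finset.range k) (D := D) (A := 2 ^ (2 * L))
      (f := fun k' => G.c i j k' * x j k') fun k' hk' => by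
        have hk' : k' < G.n j := (Finset.mem_range.1 hk').trans_le hk
        rcases hx j hj k' hk' with h | h
        · rw [h, mul_zero]; exact .zero _ _
        · rw [h, mul_one]; exact hc i hi j hj k' hk'
    rw [pow_one, pow_one]
    refine h.mono ?_
    rw [Finset.card_range]
    have := G.n_le_N hj
    exact Nat.mul_le_mul_right _ (by omega)
  have hfac : ∀ x, G.Binary x → ∀ i < G.r, ∀ j < G.s, FracLe D A (G.fac x i j) := by
    intro x hx i hi j hj
    unfold Inst.fac
    split_ifs
    · simpa using hpart x hx i hi j hj _ le_rfl
    · exact ⟨D, by simp, by simpa using hDA⟩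
  have hgam : ∀ x, G.Binary x → ∀ i < G.r, ∀ j ≤ G.s,
      FracLe (D ^ (G.s - j)) (A ^ (G.s - j)) (G.gam x j i) := by
    intro x hx i hi j hj
    have h := FracLe.prod (Finset.Ico j G.s) (f := fun l => G.fac x i l) fun l hl =>
      hfac x hx i hi l (Finset.mem_Ico.1 hl).2
    rwa [Nat.card_Ico] at h
  have hsum : ∀ (i : ℕ) (f : ℕ → ℚ), i ≤ G.r → (∀ i' < i, FracLe (D ^ G.s) (A ^ G.s) (f i')) →
      FracLe (D ^ G.s) (K * A ^ G.s) (∑ i' ∈ Finset.range i, f i') := by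
    intro i f hi hf
    refine (FracLe.sum (Finset.range i) fun i' hi' => hf i' (Finset.mem_range.1 hi')).mono ?_
    rw [Finset.card_range]
    exact Nat.mul_le_mul_right _ (by omega)
  refine ⟨hsN, le_rfl, ?_, Nat.one_le_pow _ _ hD, (Nat.pow_le_pow_left hDA _).trans hAF, ?_,
    ?_, ?_, ?_, ?_, ?_⟩
  · nlinarith
  · have h1 : Nat.size (K + 1) ≤ 2 * L + 2 := (size_le_self _).trans (by omega)
    have hsL : L * G.s ≤ L ^ 2 := by rw [sq]; exact Nat.mul_le_mul_left _ (by omega)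
    have h2 : Nat.size (D ^ G.s) ≤ L ^ 2 + 1 := by
      rw [Nat.size_le]
      calc D ^ G.s ≤ (2 ^ L) ^ G.s := Nat.pow_le_pow_left hDL _
        _ = 2 ^ (L * G.s) := (pow_mul _ _ _).symm
        _ ≤ 2 ^ L ^ 2 := Nat.pow_le_pow_right (by decide) hsL
        _ < 2 ^ (L ^ 2 + 1) := Nat.pow_lt_pow_right (by decide) (by omega)
    have hK2 : K < 2 ^ (2 * L + 1) := hKL.trans_lt Nat.lt_two_pow_self
    have h3 : Nat.size (K * A ^ G.s) ≤ 4 * L ^ 2 + 3 * L + 1 := by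
      rw [Nat.size_le]
      calc K * A ^ G.s < 2 ^ (2 * L + 1) * A ^ G.s :=
            Nat.mul_lt_mul_of_pos_right hK2 (Nat.pow_pos (hD.trans hDA))
        _ ≤ 2 ^ (2 * L + 1) * (2 ^ (2 * L + 1) * 2 ^ (2 * L)) ^ G.s :=
            Nat.mul_le_mul_left _ (Nat.pow_le_pow_left (Nat.mul_le_mul_right _ hK2.le) _)
        _ = 2 ^ (2 * L + 1 + (4 * L + 1) * G.s) := by
            rw [← pow_add, ← pow_mul, ← pow_add]; congr 2; ring
        _ ≤ 2 ^ (4 * L ^ 2 + 3 * L + 1) := Nat.pow_le_pow_right (by decide) (by nlinarith)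
    have h4 : (K + 1) * (Nat.size (K + 1) + Nat.size (D ^ G.s) + Nat.size (K * A ^ G.s)) ≤
        (2 * L + 2) * (5 * L ^ 2 + 5 * L + 5) := Nat.mul_le_mul (by omega) (by omega)
    omega
  · exact fun i hi j hj k hk => ((hc1 i hi j hj k hk).pad hDA hs).mono hAF
  · exact fun x hx i hi j hj k hk => ((hpart x hx i hi j hj k hk).pad hDA hs).mono hAF
  · exact fun x hx i hi j hj => ((hgam x hx i hi j hj).pad hDA (Nat.sub_le _ _)).mono hAF
  · intro x hx j hj k hk p _ i hi
    refine hsum i _ hi fun i' hi' => ?_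
    split_ifs
    · exact .zero _ _
    · have h := (hgam x hx i' (by omega) (j + 1) hj).mul (hc1 i' (by omega) j hj k hk)
      rw [← pow_add, ← pow_add] at h
      exact h.pad hDA (by omega)
  · exact fun x hx i hi => hsum i _ hi fun i' hi' =>
      (hgam x hx i' (by omega) 0 (Nat.zero_le _)).pad hDA (Nat.sub_le _ _)

theorem Data.bounds (P : Data) :
    Bounds P.inst (2 * (1 + 2 * ((2 * P.size + 2) * (5 * P.size ^ 2 + 5 * P.size + 5))))
      (P.inst.N + P.inst.r + 1) (P.commonDen ^ P.inst.s)
      ((P.inst.N + P.inst.r + 1) * ((P.inst.N + P.inst.r + 1) * 2 ^ (2 * P.size)) ^ P.inst.s) := by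
  refine bounds_of_fracLe P.s_pos P.s_le_N P.N_le_size P.r_le_size P.commonDen_pos P.commonDen_le ?_
  intro i hi j hj k hk
  have hk' : k < P.n ⟨j, hj⟩ := by
    have := P.inst_n ⟨j, hj⟩
    simp only at this
    omega
  have h := P.fracLe_entry ⟨i, hi⟩ ⟨j, hj⟩ ⟨k, hk'⟩
  rwa [← P.inst_c] at h

/-! ### The bounds for the time -/

theorem eval_mono (f : Polynomial ℕ) {x y : ℕ} (h : x ≤ y) : f.eval x ≤ f.eval y := by
  rw [Polynomial.eval_eq_sum, Polynomial.eval_eq_sum]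
  exact Finset.sum_le_sum fun i _ => Nat.mul_le_mul_left _ (Nat.pow_le_pow_left h i)

/-- A bound for the time for the tables plus eight repetitions of the main loop, as a polynomial in
the number of variables plus the number of products. The factor eight is the number of choices for
the first group. -/
noncomputable def timePoly : Polynomial ℕ :=
  ((groupTables.time + productTables.time + 4) + 5 +
    8 * (5 + (Prog.seq tryChoice advance).time)).comp (Polynomial.X + 1)

/-- A bound for the number of bits of all numbers, as a polynomial in the size of the input. -/
noncomputable def bitPoly : Polynomial ℕ :=
  Polynomial.C solve.wt * (2 * (1 + 2 * ((2 * Polynomial.X + 2) *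
    (5 * Polynomial.X ^ 2 + 5 * Polynomial.X + 5))))

/-- The number of choices; the first group has no factor `n ^ m` because `m = 0` for it. -/
theorem Data.prod_choices (P : Data) :
    ∏ j ∈ Finset.range P.inst.s, 8 * P.inst.n j ^ P.inst.m j =
      8 * (8 ^ (P.s - 1) * ∏ j with 0 < (j : Fin P.s).val, P.n j ^ P.m j) := by
  rw [Finset.prod_mul_distrib, Finset.prod_const, Finset.card_range, inst_s, Finset.prod_range,
    ← mul_assoc, ← pow_succ', Nat.sub_add_cancel P.s_pos]
  congr 1
  rw [Finset.prod_filter]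
  refine Finset.prod_congr rfl fun j _ => ?_
  rw [inst_n, inst_m]
  split_ifs with h
  · rfl
  · have h0 : P.inst.m j = 0 := by rw [show (j : ℕ) = 0 by omega]; exact Inst.m_zero _
    rw [← inst_m, h0, pow_zero]

theorem solves_solve (P : Data) :
    Solves solve P (P.s * 8 ^ (P.s - 1) * (∏ j with 0 < (j : Fin P.s).val, P.n j ^ P.m j) *
      timePoly.eval ((∑ j, P.n j) + P.r)) (bitPoly.eval P.size) := by
  have hn : ∀ j < P.inst.s, 1 ≤ P.inst.n j := fun j hj => by
    have := P.inst_n ⟨j, hj⟩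
    simp only at this
    rw [this]
    exact P.n_pos _
  have hsize : P.size ≤ 2 * (1 + 2 * ((2 * P.size + 2) * (5 * P.size ^ 2 + 5 * P.size + 5))) := by
    nlinarith
  have hbdd : Bdd (2 * (1 + 2 * ((2 * P.size + 2) * (5 * P.size ^ 2 + 5 * P.size + 5)))) P.input :=
    ⟨fun a i => (P.input_bdd.nat a i).trans hsize, fun a i => (P.input_bdd.rat a i).trans hsize⟩
  obtain ⟨T, τ, hrun, hT, hbin, hopt⟩ := runs_solve P.bounds hn hbdd P.start_input
  have hout : P.inst.obj (outOf P.inst τ) = P.objective (P.output τ) :=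
    P.inst_obj fun j k => by rw [outOf, P.inst_off]; rfl
  refine ⟨T, τ, by simpa [bitPoly] using hrun, hT.trans ?_, fun j k => hbin _, fun y hy => ?_⟩
  · rw [P.prod_choices, P.inst_r, P.inst_N]
    have hW : 1 ≤ 8 ^ (P.s - 1) * ∏ j with 0 < (j : Fin P.s).val, P.n j ^ P.m j :=
      Nat.mul_pos (by positivity) (Finset.prod_pos fun j _ => Nat.pow_pos (P.n_pos j))
    rw [mul_assoc P.s]
    set W := 8 ^ (P.s - 1) * ∏ j with 0 < (j : Fin P.s).val, P.n j ^ P.m j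
    have hsW : W ≤ P.s * W := Nat.le_mul_of_pos_left _ P.s_pos
    simp only [timePoly, Polynomial.eval_comp, Polynomial.eval_add, Polynomial.eval_mul,
      Polynomial.eval_ofNat, Polynomial.eval_X, Polynomial.eval_one]
    -- one factor `W` suffices, the factor `s` is not needed
    refine le_trans ?_ (Nat.mul_le_mul_right _ hsW)
    set K := ∑ j, P.n j + P.r + 1
    -- the times are opaque numbers in what follows
    generalize groupTables.time.eval K = a
    generalize productTables.time.eval K = b
    generalize (Prog.seq tryChoice advance).time.eval K = c
    nlinarith [Nat.mul_le_mul_right (a + b + 9) hW]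
  · let Y : ℕ → ℕ → ℚ := fun j k =>
      if h : j < P.s then (if h' : k < P.n ⟨j, h⟩ then y ⟨j, h⟩ ⟨k, h'⟩ else 0) else 0
    have hY : P.inst.obj Y = P.objective y := P.inst_obj fun j k => by simp [Y]
    rw [← hY, ← hout]
    refine hopt Y fun j _ k _ => ?_
    simp only [Y]
    split_ifs
    · exact hy _ _
    · exact Or.inl rfl
    · exact Or.inl rfl

theorem Solves.mono {p : Prog} {P : Data} {T T' B : ℕ} (h : Solves p P T B) (hT : T ≤ T') :
    Solves p P T' B := by
  obtain ⟨t, σ, h1, h2, h3⟩ := h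
  exact ⟨t, σ, h1, h2.trans hT, h3⟩

theorem Data.m_le (P : Data) (j : Fin P.s) : P.m j ≤ P.r := by
  rw [← inst_m]
  exact P.inst.m_le j

theorem stronglyPolynomialOn_solve (S M : ℕ) :
    StronglyPolynomialOn solve {P | P.s ≤ S ∧ ∀ j : Fin P.s, 0 < j.val → P.m j ≤ M} := by
  refine ⟨Polynomial.C (S * 8 ^ S) * Polynomial.X ^ (M * S) * timePoly, bitPoly, ?_⟩
  rintro P ⟨hS, hM⟩
  refine (solves_solve P).mono ?_
  have hN : P.numVars ≤ P.r * P.numVars := Nat.le_mul_of_pos_left _ P.r_pos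
  have hr : P.r ≤ P.r * P.s := Nat.le_mul_of_pos_right _ P.s_pos
  have hdim : P.numVars + P.r ≤ P.dim := by unfold Data.dim; omega
  have hdim1 : 1 ≤ P.dim := by unfold Data.dim; omega
  simp only [Polynomial.eval_mul, Polynomial.eval_C, Polynomial.eval_pow, Polynomial.eval_X]
  refine Nat.mul_le_mul (Nat.mul_le_mul (Nat.mul_le_mul hS
    (Nat.pow_le_pow_right (by decide) (by omega))) ?_) (eval_mono _ hdim)
  calc ∏ j with 0 < (j : Fin P.s).val, P.n j ^ P.m j
      ≤ ∏ j with 0 < (j : Fin P.s).val, P.dim ^ M := by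
        refine Finset.prod_le_prod' fun j hj => ?_
        have hj' : P.n j ≤ P.numVars := Finset.single_le_sum (f := P.n)
          (fun _ _ => Nat.zero_le _) (Finset.mem_univ j)
        exact (Nat.pow_le_pow_left (by omega) _).trans
          (Nat.pow_le_pow_right hdim1 (hM j (Finset.mem_filter.1 hj).2))
    _ = P.dim ^ (M * (Finset.univ.filter fun j : Fin P.s => 0 < j.val).card) := by
        rw [Finset.prod_const, pow_mul]
    _ ≤ P.dim ^ (M * S) := Nat.pow_le_pow_right hdim1 (Nat.mul_le_mul_left _
        (((Finset.card_le_univ _).trans_eq (Fintype.card_fin _)).trans hS))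

end FBPO

theorem mainTheorem1 :
    ∃ p : FBPO.Prog,
      -- the bound on the number of operations and on the size of the numbers
      (∃ (θ : ℕ) (f g : Polynomial ℕ), ∀ P : FBPO.Data,
        FBPO.Solves p P
          (P.s * θ ^ (P.s - 1) * (∏ j with 0 < (j : Fin P.s).val, P.n j ^ P.m j) *
            f.eval ((∑ j, P.n j) + P.r))
          (g.eval P.size)) ∧
      -- strongly polynomial time when `s` and `m_2, …, m_s` are bounded by constants
      (∀ S M : ℕ, FBPO.StronglyPolynomialOn p
        {P | P.s ≤ S ∧ ∀ j : Fin P.s, 0 < j.val → P.m j ≤ M}) ∧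
      -- strongly polynomial time when `s` and the cardinality of the family are bounded by constants
      (∀ S R : ℕ, FBPO.StronglyPolynomialOn p {P | P.s ≤ S ∧ P.r ≤ R}) := by
  refine ⟨FBPO.solve, ⟨8, FBPO.timePoly, FBPO.bitPoly, FBPO.solves_solve⟩,
    FBPO.stronglyPolynomialOn_solve, fun S R => ?_⟩
  obtain ⟨f, g, h⟩ := FBPO.stronglyPolynomialOn_solve S R
  exact ⟨f, g, fun P hP => h P ⟨hP.1, fun j _ => (P.m_le j).trans hP.2⟩⟩
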